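/- Notation. Let $\mu=(\mu_1,\mu_2,\mu_3)\in\mathbb{C}^3$ with $\mu_1+\mu_2+\mu_3=0$, $\rho=(1,0,-1)$, $U(\mathbb{R})$ the group of matrices $x=\begin{pmatrix}1&x_2&x_3\\&1&x_1\\&&1\end{pmatrix}$ with $dx=dx_1\,dx_2\,dx_3$, $\psi_{11}(x)=e^{2\pi i(x_1+x_2)}$, and $Y(\mathbb{R})$ the set of matrices $y=\mathrm{diag}(y_1y_2,y_1,1)$ with $y_1,y_2>0$ and $dy=\frac{dy_1\,dy_2}{(y_1y_2)^3}$. The power function is $p_{\mu}(r\,xyk)=y_1^{\mu_1+\mu_2}y_2^{\mu_1}$ ($r>0$ a scalar, $x\in U(\mathbb{R})$, $y\in Y(\mathbb{R})$, $k\in SO(3,\mathbb{R})$). With $w_l=\begin{pmatrix}&&1\\&-1&\\1&&\end{pmatrix}$, the Jacquet-Whittaker function is \[ W(y,\mu,\psi_{11})=\int_{U(\mathbb{R})}p_{\rho+\mu}(w_l u y)\,\psi_{11}(u)\,du \] for $\mathrm{Re}\,\mu_1>\mathrm{Re}\,\mu_2>\mathrm{Re}\,\mu_3$, and is extended to all $\mu$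 by analytic continuation. Put \[ M_{\rm poly}(a,b,c;\mu)=|1+i\,\mathrm{Im}(\mu_1-\mu_2)|^a\,|1+i\,\mathrm{Im}(\mu_1-\mu_3)|^b\,|1+i\,\mathrm{Im}(\mu_2-\mu_3)|^c, \] \[ M_{\rm sym}(\kappa,\delta;\mu)=\sum_{w\in S_3}M_{\rm poly}\Big(\tfrac{\kappa-\delta}{2}+\epsilon,\tfrac{\kappa-\delta}{2}+\epsilon,\delta+\epsilon;\mu^w\Big), \] where $\mu^w$ runs over the permutations of $\mu$, and \[ \Lambda_{\rm poly}(\mu)=M_{\rm poly}\Big(\tfrac{\mathrm{Re}(\mu_1-\mu_2)}{2},\tfrac{\mathrm{Re}(\mu_1-\mu_3)}{2},\tfrac{\mathrm{Re}(\mu_2-\mu_3)}{2};\mu\Big). \] Proposition. Fix $\mathfrak{s}_1,\mathfrak{s}_2\in\mathbb{R}$, the real parts $\mathrm{Re}\,\mu_i$, and $\epsilon>0$, and suppose that $\mathfrak{s}_1-\mathrm{Re}\,\mu_i>0$ and $\mathfrak{s}_2+\mathrm{Re}\,\mu_i>0$ for $i=1,2,3$. Then the following integral converges and \[ \int_{Y(\mathbb{R})}|W(t,\mu,\psi_{11})|\,t_1^{\mathfrak{s}_1+1}t_2^{\mathfrak{s}_2+1}\,dt\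 \ll\ \frac{M_{\rm sym}(\mathfrak{s}_1+\mathfrak{s}_2-\frac12,\delta;\mu)}{\Lambda_{\rm poly}(\mu)}, \] where \[ \delta=\min_{i}\Big\{\tfrac{2\mathfrak{s}_1+\mathrm{Re}\,\mu_i}{2},\tfrac{\mathfrak{s}_1-\mathrm{Re}\,\mu_i}{2},\tfrac{2\mathfrak{s}_2-\mathrm{Re}\,\mu_i}{2},\tfrac{\mathfrak{s}_2+\mathrm{Re}\,\mu_i}{2}\Big\}, \] and the implied constant depends only on $\mathfrak{s}_1,\mathfrak{s}_2$, the $\mathrm{Re}\,\mu_i$ and $\epsilon$ (so the bound is uniform in the imaginary parts of $\mu$). -/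

import Mathlib

open MeasureTheory

noncomputable section

namespace SL3

/-- The unipotent upper triangular matrix with coordinates `(x₁, x₂, x₃)`; note the ordering of the
indices. -/
def unip (x : ℝ × ℝ × ℝ) : Matrix (Fin 3) (Fin 3) ℝ :=
  !![1, x.2.1, x.2.2; 0, 1, x.1; 0, 0, 1]

/-- The diagonal matrix `diag(y₁ y₂, y₁, 1)` attached to a pair `y = (y₁, y₂)`. -/
def torus (y : ℝ × ℝ) : Matrix (Fin 3) (Fin 3) ℝ :=
  !![y.1 * y.2, 0, 0; 0, y.1, 0; 0, 0, 1]

/-- The long Weyl element. -/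
def longWeyl : Matrix (Fin 3) (Fin 3) ℝ :=
  !![0, 0, 1; 0, -1, 0; 1, 0, 0]

/-- The pair `(y₁, y₂)` of the Iwasawa decomposition `g = r x y k` of an invertible matrix `g`
(`r > 0` a scalar, `x` unipotent upper triangular, `y = diag(y₁ y₂, y₁, 1)` with `y₁, y₂ > 0`, and
`k` orthogonal), read off from the lower right minors `m₁, m₂, m₃` of `S = g gᵀ`:
`m₁ = r²`, `m₂ = r⁴ y₁²`, `m₃ = r⁶ y₁⁴ y₂²`. See `iwasawaY_eq`. -/
def iwasawaY (g : Matrix (Fin 3) (Fin 3) ℝ) : ℝ × ℝ :=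
  let S := g * g.transpose
  let m₁ := S 2 2
  let m₂ := S 1 1 * S 2 2 - S 1 2 * S 2 1
  let m₃ := S.det
  (Real.sqrt m₂ / m₁, Real.sqrt (m₃ * m₁) / m₂)

/-- `iwasawaY` is the `y`-part of the Iwasawa decomposition. -/
theorem iwasawaY_eq (r : ℝ) (hr : 0 < r) (x : ℝ × ℝ × ℝ) (y : ℝ × ℝ) (hy₁ : 0 < y.1)
    (hy₂ : 0 < y.2) (k : Matrix (Fin 3) (Fin 3) ℝ) (hk : k * k.transpose = 1) :
    iwasawaY (r • (unip x * torus y * k)) = y := by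
  have hS : (r • (unip x * torus y * k)) * (r • (unip x * torus y * k)).transpose
      = (r • (unip x * torus y)) * (r • (unip x * torus y)).transpose := by
    simp only [Matrix.transpose_smul, Matrix.transpose_mul, Matrix.smul_mul, Matrix.mul_smul]
    congr 2
    calc unip x * torus y * k * (k.transpose * ((torus y).transpose * (unip x).transpose))
        = unip x * torus y * (k * k.transpose) * ((torus y).transpose * (unip x).transpose) := by
          simp only [Matrix.mul_assoc]
      _ = _ := by rw [hk, Matrix.mul_one]
  obtain ⟨a, b⟩ := y
  obtain ⟨x₁, x₂, x₃⟩ := x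
  simp only at hy₁ hy₂
  have h2 : Real.sqrt (r ^ 4 * a ^ 2) = r ^ 2 * a := by
    rw [show r ^ 4 * a ^ 2 = (r ^ 2 * a) ^ 2 by ring, Real.sqrt_sq (by positivity)]
  have h3 : Real.sqrt (r ^ 6 * a ^ 4 * b ^ 2 * r ^ 2) = r ^ 4 * a ^ 2 * b := by
    rw [show r ^ 6 * a ^ 4 * b ^ 2 * r ^ 2 = (r ^ 4 * a ^ 2 * b) ^ 2 by ring,
      Real.sqrt_sq (by positivity)]
  have e1 : ((r • (unip (x₁, x₂, x₃) * torus (a, b))) *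
      (r • (unip (x₁, x₂, x₃) * torus (a, b))).transpose) 2 2 = r ^ 2 := by
    simp [unip, torus, Matrix.mul_apply, Fin.sum_univ_three]; ring
  have e2 : ((r • (unip (x₁, x₂, x₃) * torus (a, b))) *
      (r • (unip (x₁, x₂, x₃) * torus (a, b))).transpose) 1 1 * ((r • (unip (x₁, x₂, x₃) *
        torus (a, b))) * (r • (unip (x₁, x₂, x₃) * torus (a, b))).transpose) 2 2
      - ((r • (unip (x₁, x₂, x₃) * torus (a, b))) *
      (r • (unip (x₁, x₂, x₃) * torus (a, b))).transpose) 1 2 * ((r • (unip (x₁, x₂, x₃) *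
        torus (a, b))) * (r • (unip (x₁, x₂, x₃) * torus (a, b))).transpose) 2 1
      = r ^ 4 * a ^ 2 := by
    simp [unip, torus, Matrix.mul_apply, Fin.sum_univ_three]; ring
  have e3 : ((r • (unip (x₁, x₂, x₃) * torus (a, b))) *
      (r • (unip (x₁, x₂, x₃) * torus (a, b))).transpose).det = r ^ 6 * a ^ 4 * b ^ 2 := by
    rw [Matrix.det_mul, Matrix.det_transpose]
    simp [unip, torus, Matrix.det_fin_three]; ring
  simp only [iwasawaY]
  rw [hS, e2, e3, e1, h2, h3]
  ext
  · simp only; field_simp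
  · simp only; field_simp

/-- `ρ = (1, 0, -1)`. -/
def rho : Fin 3 → ℂ := ![1, 0, -1]

/-- The power function `p_μ(xyk) = y₁^{μ₁+μ₂} y₂^{μ₁}`. -/
def powerFn (μ : Fin 3 → ℂ) (g : Matrix (Fin 3) (Fin 3) ℝ) : ℂ :=
  ((iwasawaY g).1 : ℂ) ^ (μ 0 + μ 1) * ((iwasawaY g).2 : ℂ) ^ (μ 0)

/-- The character `ψ_m(x) = e(m₁ x₁ + m₂ x₂)`, where `e(θ) = exp(2πiθ)`. -/
def psi (m : ℝ × ℝ) (x : ℝ × ℝ × ℝ) : ℂ :=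
  Complex.exp (2 * Real.pi * Complex.I * ((m.1 * x.1 + m.2 * x.2.1 : ℝ) : ℂ))

/-- Jacquet's integral `∫_{U(ℝ)} p_{ρ+μ}(w_l u z) ψ_m(u) du`, absolutely convergent for
`Re μ₁ > Re μ₂ > Re μ₃`. -/
def jacquetIntegral (z : Matrix (Fin 3) (Fin 3) ℝ) (μ : Fin 3 → ℂ) (m : ℝ × ℝ) : ℂ :=
  ∫ x : ℝ × ℝ × ℝ, powerFn (rho + μ) (longWeyl * unip x * z) * psi m x

/-- `F` is the holomorphic continuation, to all `(μ₁, μ₂) ∈ ℂ²` (with `μ₃ = -μ₁-μ₂`), of Jacquet's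
integral from its domain of absolute convergence `Re μ₁ > Re μ₂ > Re μ₃`. By the identity theorem
there is at most one such `F`. -/
def IsJacquetContinuation (z : Matrix (Fin 3) (Fin 3) ℝ) (m : ℝ × ℝ) (F : ℂ × ℂ → ℂ) : Prop :=
  Differentiable ℂ F ∧ ∀ a b : ℂ, b.re < a.re → (-a - b).re < b.re →
    F (a, b) = jacquetIntegral z ![a, b, -a - b] m

open Classical in
/-- The Jacquet-Whittaker function `W(z; μ, ψ_m)`, for `m₁ m₂ ≠ 0` and `μ₁ + μ₂ + μ₃ = 0`: the
value at `μ` of the entire continuation of Jacquet's integral. -/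
def whittaker (z : Matrix (Fin 3) (Fin 3) ℝ) (μ : Fin 3 → ℂ) (m : ℝ × ℝ) : ℂ :=
  if h : ∃ F : ℂ × ℂ → ℂ, IsJacquetContinuation z m F then h.choose (μ 0, μ 1) else 0

/-- The measure `dy = dy₁ dy₂ / (y₁ y₂)³` on `Y(ℝ) = {(y₁, y₂) : y₁, y₂ > 0}`. -/
def measY : Measure (ℝ × ℝ) :=
  (volume.restrict (Set.Ioi 0 ×ˢ Set.Ioi 0)).withDensity
    fun y => ENNReal.ofReal (1 / (y.1 * y.2) ^ 3)

/-- `M_poly(a, b, c; μ)`. -/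
def Mpoly (a b c : ℝ) (μ : Fin 3 → ℂ) : ℝ :=
  ‖1 + Complex.I * ((μ 0 - μ 1).im : ℂ)‖ ^ a * ‖1 + Complex.I * ((μ 0 - μ 2).im : ℂ)‖ ^ b *
    ‖1 + Complex.I * ((μ 1 - μ 2).im : ℂ)‖ ^ c

/-- `M_sym(κ, δ; μ)`; the Weyl group acts on `μ` by all permutations of the coordinates. The
parameter `ε` is written out. -/
def Msym (ε κ δ : ℝ) (μ : Fin 3 → ℂ) : ℝ :=
  ∑ w : Equiv.Perm (Fin 3), Mpoly ((κ - δ) / 2 + ε) ((κ - δ) / 2 + ε) (δ + ε) (μ ∘ w)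

/-- `Λ_poly(μ)`. -/
def LambdaPoly (μ : Fin 3 → ℂ) : ℝ :=
  Mpoly ((μ 0 - μ 1).re / 2) ((μ 0 - μ 2).re / 2) ((μ 1 - μ 2).re / 2) μ

/-- The exponent `δ`, a minimum over `i` of four linear expressions. -/
def deltaExp (s₁ s₂ : ℝ) (μ : Fin 3 → ℂ) : ℝ :=
  Finset.univ.inf' Finset.univ_nonempty fun i : Fin 3 =>
    min (min ((2 * s₁ + (μ i).re) / 2) ((s₁ - (μ i).re) / 2))
      (min ((2 * s₂ - (μ i).re) / 2) ((s₂ + (μ i).re) / 2))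

end SL3

end

/-!
Writing the powers in Jacquet's integrand as beta and Gamma integrals turns the integral over `U(ℝ)`
into Gaussian integrals and gives, with `y = (y₁, y₂)`,
`W(y, μ, ψ₁₁) = π ^ (3/2) y₁ ^ (1 - μ₃) y₂ ^ (1 + μ₃) T(y, μ) / ∏_{i < j} Γ((1 + μᵢ - μⱼ) / 2)`,
where the absolutely convergent triple integral `T` is entire in `μ`; this is the continuation.
Mellin inversion turns `T` into a double Mellin–Barnes integral of six Gamma factors over one, and
the contours may be moved within `s₁ > Re μᵢ`, `s₂ > -Re μᵢ`.

For the size of the integrand one needs `‖Γ(x + i y)‖` up to constants. By Euler's limit formula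
`log (‖Γ(x + i y)‖ / Γ x)` is concave in `x`, so it suffices to know it at half-integers, where the
reflection formula gives it. The exponential parts of the Gamma factors, including those in front
of `T`, cancel exactly when the imaginary parts of the two contour variables interlace those of
`μ`; elsewhere there is exponential decay. On the interlacing region the polynomial part is bounded
by an elementary piecewise linear inequality between logarithms.

Applying this with the contours moved by `±e` in each variable bounds `W` near `0` and near `∞` in
`y₁` and `y₂`, with the same dependence on `Im μ`, which makes the integral over `Y(ℝ)` converge.
-/

open Filter Topology
open Complex (I)
open scoped Real

noncomputable section

namespace SL3

/-! ### The Gamma function on vertical lines -/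

/-- The logarithm of the bracket `1 + |x|`, in which all polynomial bounds are expressed. -/
def logBracket (x : ℝ) : ℝ := Real.log (1 + |x|)

/-- The main term of Stirling's formula for `log ‖Γ (x + i y)‖` as `|y| → ∞`, with `|y|` replaced
by `1 + |y|` in the logarithm so that it is regular at `y = 0`. -/
def stirlingLog (x y : ℝ) : ℝ := (x - 1 / 2) * logBracket y - π / 2 * |y|

/-- The logarithm of `‖Γ (x + i y)‖ / Γ x`. By Euler's limit formula it is a limit of sums of
concave functions of `x`. -/
def gammaLogRatio (x y : ℝ) : ℝ := Real.log ‖Complex.Gamma (x + y * I)‖ - Real.log (Real.Gamma x)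

lemma logBracket_nonneg (x : ℝ) : 0 ≤ logBracket x := Real.log_nonneg (by linarith [abs_nonneg x])

lemma add_mul_I_ne_zero {x : ℝ} (hx : 0 < x) (y : ℝ) : (x + y * I : ℂ) ≠ 0 := fun h =>
  hx.ne' (by simpa using congrArg Complex.re h)

lemma Gamma_vertical_ne_zero {x : ℝ} (hx : 0 < x) (y : ℝ) : Complex.Gamma (x + y * I) ≠ 0 :=
  Complex.Gamma_ne_zero_of_re_pos (by simpa using hx)

lemma norm_Gamma_vertical_pos {x : ℝ} (hx : 0 < x) (y : ℝ) : 0 < ‖Complex.Gamma (x + y * I)‖ :=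
  norm_pos_iff.2 (Gamma_vertical_ne_zero hx y)

lemma concaveOn_log_sub_log_norm_add_mul_I (y : ℝ) :
    ConcaveOn ℝ (Set.Ioi 0) fun t : ℝ => Real.log t - Real.log ‖(t + y * I : ℂ)‖ := by
  have hderiv : ∀ t ∈ Set.Ioi (0 : ℝ), HasDerivAt
      (fun t : ℝ => Real.log t - Real.log ‖(t + y * I : ℂ)‖) (y ^ 2 / (t * (t ^ 2 + y ^ 2))) t := by
    intro t ht
    have ht : 0 < t := ht
    have hlog := (Real.hasDerivAt_log ht.ne').sub
      (((((hasDerivAt_id t).pow 2).add_const (y ^ 2)).log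
        (by simp only [Pi.pow_apply, id_eq]; positivity)).div_const 2)
    convert! hlog using 1
    · funext t
      simp [Complex.norm_add_mul_I, Real.log_sqrt (by positivity : 0 ≤ t ^ 2 + y ^ 2)]
    · simp
      field_simp
      ring
  refine AntitoneOn.concaveOn_of_deriv (convex_Ioi 0)
    (fun t ht => (hderiv t ht).continuousAt.continuousWithinAt) ?_ ?_ <;> rw [interior_Ioi]
  · exact fun t ht => (hderiv t ht).differentiableAt.differentiableWithinAt
  · intro s hs t ht hst
    have hs : 0 < s := hs
    have ht : 0 < t := ht
    rw [(hderiv s hs).deriv, (hderiv t ht).deriv]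
    gcongr

lemma tendsto_sum_gammaLogRatio {x : ℝ} (hx : 0 < x) (y : ℝ) :
    Tendsto (fun n : ℕ => ∑ j ∈ Finset.range (n + 1),
      (Real.log (x + j) - Real.log ‖((x + j : ℝ) + y * I : ℂ)‖)) atTop (𝓝 (gammaLogRatio x y)) := by
  have hcomplex := (Complex.GammaSeq_tendsto_Gamma (x + y * I)).norm.log
    (norm_Gamma_vertical_pos hx y).ne'
  have hreal := (Real.GammaSeq_tendsto_Gamma x).log (Real.Gamma_pos_of_pos hx).ne'
  refine (hcomplex.sub hreal).congr' ?_
  filter_upwards [eventually_gt_atTop 0] with n hn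
  have hpow : (n : ℝ) ^ x ≠ 0 := by positivity
  have hfactorial : (n.factorial : ℝ) ≠ 0 := by positivity
  have hfactor (j : ℕ) : ‖(x + y * I + j : ℂ)‖ = ‖((x + j : ℝ) + y * I : ℂ)‖ := by
    push_cast; ring_nf
  have hnorm (j : ℕ) : ‖((x + j : ℝ) + y * I : ℂ)‖ ≠ 0 :=
    norm_ne_zero_iff.2 (add_mul_I_ne_zero (by positivity) y)
  have hre : (x + y * I : ℂ).re = x := by simp
  simp only [Complex.GammaSeq, Real.GammaSeq, norm_div, norm_mul, norm_prod, Complex.norm_natCast,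
    Complex.norm_natCast_cpow_of_pos hn, hfactor, hre]
  rw [Real.log_div (mul_ne_zero hpow hfactorial) (Finset.prod_ne_zero_iff.2 fun j _ => hnorm j),
    Real.log_div (mul_ne_zero hpow hfactorial)
      (Finset.prod_ne_zero_iff.2 fun j _ => by positivity),
    Real.log_prod fun j _ => hnorm j, Real.log_prod fun j _ => by positivity,
    Finset.sum_sub_distrib]
  ring

lemma concaveOn_gammaLogRatio (y : ℝ) : ConcaveOn ℝ (Set.Ioi 0) fun x => gammaLogRatio x y := by
  refine ⟨convex_Ioi 0, fun x₀ hx₀ x₁ hx₁ a b ha hb hab => ?_⟩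
  have hx : 0 < a • x₀ + b • x₁ := convex_Ioi 0 hx₀ hx₁ ha hb hab
  refine le_of_tendsto_of_tendsto'
    (((tendsto_sum_gammaLogRatio hx₀ y).const_smul a).add
      ((tendsto_sum_gammaLogRatio hx₁ y).const_smul b))
    (tendsto_sum_gammaLogRatio hx y) fun n => ?_
  rw [Finset.smul_sum, Finset.smul_sum, ← Finset.sum_add_distrib]
  refine Finset.sum_le_sum fun j _ => ?_
  have hshift : a • (x₀ + j) + b • (x₁ + j) = a • x₀ + b • x₁ + j := by
    simp only [smul_eq_mul]; linear_combination (j : ℝ) * hab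
  simpa only [hshift] using (concaveOn_log_sub_log_norm_add_mul_I y).2
    (Set.mem_Ioi.2 (add_pos_of_pos_of_nonneg hx₀ j.cast_nonneg))
    (Set.mem_Ioi.2 (add_pos_of_pos_of_nonneg hx₁ j.cast_nonneg)) ha hb hab

lemma concaveOn_gammaLogRatio_sub_stirlingLog (y : ℝ) :
    ConcaveOn ℝ (Set.Ioi 0) fun x => gammaLogRatio x y - stirlingLog x y := by
  refine ⟨convex_Ioi 0, fun x₀ hx₀ x₁ hx₁ a b ha hb hab => ?_⟩
  have hconcave := (concaveOn_gammaLogRatio y).2 hx₀ hx₁ ha hb hab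
  have haffine : stirlingLog (a • x₀ + b • x₁) y = a * stirlingLog x₀ y + b * stirlingLog x₁ y := by
    simp only [stirlingLog, smul_eq_mul]
    linear_combination (logBracket y / 2 + π / 2 * |y|) * hab
  simp only [smul_eq_mul] at hconcave haffine ⊢
  linarith

lemma norm_Gamma_one_half_add_mul_I_sq (y : ℝ) :
    ‖Complex.Gamma ((1 / 2 : ℝ) + y * I)‖ ^ 2 = π / Real.cosh (π * y) := by
  have hreflect := Complex.Gamma_mul_Gamma_one_sub ((1 / 2 : ℝ) + y * I)
  have hconj : (1 - ((1 / 2 : ℝ) + y * I) : ℂ) = (starRingEnd ℂ) ((1 / 2 : ℝ) + y * I) := by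
    apply Complex.ext
    · norm_num
    · simp
  have hsin : Complex.sin (π * ((1 / 2 : ℝ) + y * I)) = (Real.cosh (π * y) : ℂ) := by
    rw [show (π * ((1 / 2 : ℝ) + y * I) : ℂ) = (π * y : ℝ) * I + π / 2 by push_cast; ring,
      Complex.sin_add_pi_div_two, Complex.cos_mul_I, Complex.ofReal_cosh]
  rw [hconj, Complex.Gamma_conj, Complex.mul_conj, Complex.normSq_eq_norm_sq, hsin] at hreflect
  exact_mod_cast hreflect

lemma abs_log_cosh_sub_abs_le (t : ℝ) : |Real.log (Real.cosh t) - (|t|)| ≤ Real.log 2 := by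
  have hcosh : Real.cosh t = (Real.exp |t| + Real.exp (-|t|)) / 2 := by
    rw [← Real.cosh_abs, Real.cosh_eq]
  have hmono : Real.exp (-|t|) ≤ Real.exp |t| := Real.exp_le_exp.2 (by linarith [abs_nonneg t])
  have hpos := Real.exp_pos (-|t|)
  have hlower : |t| - Real.log 2 ≤ Real.log (Real.cosh t) := by
    rw [Real.le_log_iff_exp_le (Real.cosh_pos t), Real.exp_sub, Real.exp_log two_pos]
    linarith
  have hupper : Real.log (Real.cosh t) ≤ |t| := by
    rw [Real.log_le_iff_le_exp (Real.cosh_pos t)]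
    linarith
  rw [abs_le]
  exact ⟨by linarith, by linarith [Real.log_nonneg one_le_two]⟩

lemma exists_abs_log_norm_Gamma_one_half_sub_stirlingLog_le :
    ∃ C : ℝ, ∀ y : ℝ,
      |Real.log ‖Complex.Gamma ((1 / 2 : ℝ) + y * I)‖ - stirlingLog (1 / 2) y| ≤ C := by
  refine ⟨(|Real.log π| + Real.log 2) / 2, fun y => ?_⟩
  have hsq := congrArg Real.log (norm_Gamma_one_half_add_mul_I_sq y)
  rw [Real.log_pow, Real.log_div Real.pi_ne_zero (Real.cosh_pos _).ne'] at hsq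
  have hcosh := abs_le.1 (abs_log_cosh_sub_abs_le (π * y))
  rw [abs_mul, abs_of_pos Real.pi_pos] at hcosh
  have hpi := abs_le.1 (le_refl |Real.log π|)
  simp only [stirlingLog, sub_self, zero_mul]
  rw [Nat.cast_ofNat] at hsq
  exact abs_le.2 ⟨by linarith [hcosh.2], by linarith [hcosh.1]⟩

lemma norm_add_mul_I_le (x y : ℝ) : ‖(x + y * I : ℂ)‖ ≤ (1 + |x|) * (1 + |y|) := by
  calc ‖(x + y * I : ℂ)‖ ≤ |x| + |y| := by simpa using norm_add_le (x : ℂ) (y * I)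
    _ ≤ _ := by nlinarith [abs_nonneg x, abs_nonneg y]

lemma exists_abs_log_norm_add_mul_I_sub_logBracket_le {x : ℝ} (hx : 0 < x) :
    ∃ C : ℝ, ∀ y : ℝ, |Real.log ‖(x + y * I : ℂ)‖ - logBracket y| ≤ C := by
  refine ⟨max (Real.log (1 + |x|)) (-Real.log (x / (1 + x))), fun y => ?_⟩
  have hbracket : 0 < 1 + |y| := by positivity
  have hnorm : 0 < ‖(x + y * I : ℂ)‖ := norm_pos_iff.2 (add_mul_I_ne_zero hx y)
  have hupper := Real.log_le_log hnorm (norm_add_mul_I_le x y)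
  have hlower : x / (1 + x) * (1 + |y|) ≤ ‖(x + y * I : ℂ)‖ := by
    have hre : x ≤ ‖(x + y * I : ℂ)‖ := by
      simpa [abs_of_pos hx] using Complex.abs_re_le_norm (x + y * I : ℂ)
    have him : |y| ≤ ‖(x + y * I : ℂ)‖ := by simpa using Complex.abs_im_le_norm (x + y * I : ℂ)
    rw [div_mul_eq_mul_div, div_le_iff₀ (by positivity)]
    nlinarith
  have hlower := Real.log_le_log (by positivity) hlower
  rw [Real.log_mul (by positivity) hbracket.ne'] at hupper hlower
  rw [abs_le, neg_le_sub_iff_le_add, sub_le_iff_le_add]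
  unfold logBracket
  exact ⟨by linarith [le_max_right (Real.log (1 + |x|)) (-Real.log (x / (1 + x)))],
    by linarith [le_max_left (Real.log (1 + |x|)) (-Real.log (x / (1 + x)))]⟩

lemma log_norm_Gamma_add_one {x : ℝ} (hx : 0 < x) (y : ℝ) :
    Real.log ‖Complex.Gamma ((x + 1 : ℝ) + y * I)‖ =
      Real.log ‖(x + y * I : ℂ)‖ + Real.log ‖Complex.Gamma (x + y * I)‖ := by
  have hz := add_mul_I_ne_zero hx y
  rw [show ((x + 1 : ℝ) + y * I : ℂ) = x + y * I + 1 by push_cast; ring,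
    Complex.Gamma_add_one _ hz, norm_mul,
    Real.log_mul (norm_ne_zero_iff.2 hz) (norm_Gamma_vertical_pos hx y).ne']

lemma stirlingLog_add_one (x y : ℝ) : stirlingLog (x + 1) y = logBracket y + stirlingLog x y := by
  unfold stirlingLog; ring

lemma exists_abs_log_norm_Gamma_nat_add_half_sub_stirlingLog_le (n : ℕ) :
    ∃ C : ℝ, ∀ y : ℝ,
      |Real.log ‖Complex.Gamma ((n + 1 / 2 : ℝ) + y * I)‖ - stirlingLog (n + 1 / 2) y| ≤ C := by
  induction n with
  | zero => simpa using exists_abs_log_norm_Gamma_one_half_sub_stirlingLog_le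
  | succ n ih =>
    obtain ⟨C, hC⟩ := ih
    have hx : (0 : ℝ) < n + 1 / 2 := by positivity
    obtain ⟨C', hC'⟩ := exists_abs_log_norm_add_mul_I_sub_logBracket_le hx
    refine ⟨C' + C, fun y => ?_⟩
    rw [show ((n + 1 : ℕ) + 1 / 2 : ℝ) = n + 1 / 2 + 1 by push_cast; ring,
      log_norm_Gamma_add_one hx, stirlingLog_add_one, add_sub_add_comm]
    exact (abs_add_le _ _).trans (add_le_add (hC' y) (hC y))

lemma exists_abs_gammaLogRatio_nat_add_half_sub_stirlingLog_le (n : ℕ) :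
    ∃ C : ℝ, ∀ y : ℝ, |gammaLogRatio (n + 1 / 2) y - stirlingLog (n + 1 / 2) y| ≤ C := by
  obtain ⟨C, hC⟩ := exists_abs_log_norm_Gamma_nat_add_half_sub_stirlingLog_le n
  refine ⟨C + |Real.log (Real.Gamma (n + 1 / 2))|, fun y => ?_⟩
  unfold gammaLogRatio
  rw [sub_right_comm]
  exact (abs_sub _ _).trans (add_le_add_left (hC y) _)

/-- The upper bound extrapolates a concave function from the half-integers `n + 1 / 2 < n + 3 / 2`
to the right of `x`. -/
lemma exists_log_norm_Gamma_le {x : ℝ} (hx : 0 < x) :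
    ∃ C : ℝ, ∀ y : ℝ, Real.log ‖Complex.Gamma (x + y * I)‖ ≤ C + stirlingLog x y := by
  obtain ⟨n, hn⟩ := exists_nat_gt x
  obtain ⟨C₀, h₀⟩ := exists_abs_gammaLogRatio_nat_add_half_sub_stirlingLog_le n
  obtain ⟨C₁, h₁⟩ := exists_abs_gammaLogRatio_nat_add_half_sub_stirlingLog_le (n + 1)
  set d : ℝ := n + 1 / 2 - x with hd
  have hd0 : 0 < d := by linarith
  refine ⟨Real.log (Real.Gamma x) + (C₀ + d * (C₀ + C₁)), fun y => ?_⟩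
  have hslope := (concaveOn_gammaLogRatio_sub_stirlingLog y).slope_anti_adjacent
    (x := x) (y := n + 1 / 2) (z := (n + 1 : ℕ) + 1 / 2) hx (Set.mem_Ioi.2 (by positivity))
    (by linarith) (by push_cast; linarith)
  rw [← hd, le_div_iff₀ hd0, show ((n + 1 : ℕ) + 1 / 2 - (n + 1 / 2) : ℝ) = 1 by push_cast; ring,
    div_one] at hslope
  have hstep := mul_le_mul_of_nonneg_right
    (sub_le_sub (abs_le.1 (h₁ y)).1 (abs_le.1 (h₀ y)).2) hd0.le
  have hratio : Real.log ‖Complex.Gamma (x + y * I)‖ =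
      gammaLogRatio x y + Real.log (Real.Gamma x) := by
    unfold gammaLogRatio; ring
  linarith [(abs_le.1 (h₀ y)).2]

/-- The lower bound interpolates a concave function between `1 / 2` and `n + 1 / 2`. -/
lemma exists_le_log_norm_Gamma {x : ℝ} (hx : 1 / 2 ≤ x) :
    ∃ C : ℝ, ∀ y : ℝ, stirlingLog x y ≤ Real.log ‖Complex.Gamma (x + y * I)‖ + C := by
  obtain ⟨n, hn⟩ := exists_nat_gt x
  obtain ⟨C₀, h₀⟩ := exists_abs_gammaLogRatio_nat_add_half_sub_stirlingLog_le 0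
  obtain ⟨C₁, h₁⟩ := exists_abs_gammaLogRatio_nat_add_half_sub_stirlingLog_le n
  refine ⟨max C₀ C₁ - Real.log (Real.Gamma x), fun y => ?_⟩
  have hmin := (concaveOn_gammaLogRatio_sub_stirlingLog y).min_le_of_mem_Icc
    (x := ((0 : ℕ) + 1 / 2 : ℝ)) (y := (n + 1 / 2 : ℝ)) (z := x) (by norm_num)
    (Set.mem_Ioi.2 (by positivity)) ⟨by simpa using hx, by linarith⟩
  have hlower : -max C₀ C₁ ≤ gammaLogRatio x y - stirlingLog x y :=
    (le_min ((neg_le_neg (le_max_left _ _)).trans (abs_le.1 (h₀ y)).1)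
      ((neg_le_neg (le_max_right _ _)).trans (abs_le.1 (h₁ y)).1)).trans hmin
  unfold gammaLogRatio at hlower
  linarith

lemma exists_norm_Gamma_le {x : ℝ} (hx : 0 < x) :
    ∃ C : ℝ, 0 < C ∧ ∀ y : ℝ, ‖Complex.Gamma (x + y * I)‖ ≤ C * Real.exp (stirlingLog x y) := by
  obtain ⟨C, hC⟩ := exists_log_norm_Gamma_le hx
  refine ⟨Real.exp C, Real.exp_pos C, fun y => ?_⟩
  rw [← Real.exp_add, ← Real.log_le_iff_le_exp (norm_Gamma_vertical_pos hx y)]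
  exact hC y

/-- Left of `1 / 2` the bound propagates through `1 / Γ z = z / Γ (z + 1)`. -/
lemma exists_norm_inv_Gamma_le (x : ℝ) :
    ∃ C : ℝ, 0 < C ∧ ∀ y : ℝ,
      ‖(Complex.Gamma (x + y * I))⁻¹‖ ≤ C * Real.exp (-stirlingLog x y) := by
  obtain ⟨n, hn⟩ := exists_nat_gt (1 / 2 - x)
  replace hn : 1 / 2 ≤ x + n := by linarith
  induction n generalizing x with
  | zero =>
    have hx : 1 / 2 ≤ x := by simpa using hn
    obtain ⟨C, hC⟩ := exists_le_log_norm_Gamma hx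
    refine ⟨Real.exp C, Real.exp_pos C, fun y => ?_⟩
    have hpos := norm_Gamma_vertical_pos (show 0 < x by linarith) y
    rw [norm_inv, ← Real.exp_log hpos, ← Real.exp_neg, ← Real.exp_add, Real.exp_le_exp]
    linarith [hC y]
  | succ n ih =>
    obtain ⟨C, hC, hbound⟩ := ih (x + 1) (by push_cast at hn; linarith)
    refine ⟨(1 + |x|) * C, by positivity, fun y => ?_⟩
    have hnext := hbound y
    rw [show ((x + 1 : ℝ) + y * I : ℂ) = x + y * I + 1 by push_cast; ring, stirlingLog_add_one,
      neg_add, Real.exp_add, logBracket, Real.exp_neg, Real.exp_log (by positivity)] at hnext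
    rw [Complex.one_div_Gamma_eq_self_mul_one_div_Gamma_add_one, norm_mul]
    calc _ ≤ ((1 + |x|) * (1 + |y|)) * (C * ((1 + |y|)⁻¹ * Real.exp (-stirlingLog x y))) :=
          mul_le_mul (norm_add_mul_I_le x y) hnext (norm_nonneg _) (by positivity)
      _ = _ := by field_simp

/-! ### The polynomial and exponential parts of the Mellin–Barnes integrand -/

lemma logBracket_neg (x : ℝ) : logBracket (-x) = logBracket x := by simp only [logBracket, abs_neg]

lemma logBracket_sub_comm (x y : ℝ) : logBracket (x - y) = logBracket (y - x) := by
  rw [← logBracket_neg, neg_sub]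

lemma logBracket_le_logBracket {x y : ℝ} (h : |x| ≤ |y|) : logBracket x ≤ logBracket y :=
  Real.log_le_log (by positivity) (by linarith)

lemma logBracket_add_le (x y : ℝ) : logBracket (x + y) ≤ logBracket x + logBracket y := by
  unfold logBracket
  rw [← Real.log_mul (by positivity) (by positivity)]
  exact Real.log_le_log (by positivity) (by nlinarith [abs_add_le x y, abs_nonneg x, abs_nonneg y])

lemma abs_logBracket_sub_logBracket_le (x y : ℝ) :
    |logBracket x - logBracket y| ≤ logBracket (x - y) := by
  have hx := logBracket_add_le (x - y) y
  have hy := logBracket_add_le (y - x) x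
  rw [logBracket_sub_comm y x] at hy
  rw [sub_add_cancel] at hx hy
  exact abs_sub_le_iff.2 ⟨by linarith, by linarith⟩

lemma logBracket_add_le_max (x y : ℝ) :
    logBracket (x + y) ≤ max (logBracket x) (logBracket y) + Real.log 2 := by
  wlog hxy : |y| ≤ |x| generalizing x y
  · rw [add_comm x, max_comm]
    exact this y x (le_of_not_ge hxy)
  rw [max_eq_left (logBracket_le_logBracket hxy)]
  unfold logBracket
  rw [← Real.log_mul (by positivity) two_ne_zero]
  exact Real.log_le_log (by positivity) (by linarith [abs_add_le x y])

lemma abs_logBracket_add_sub_max_le {x y : ℝ} (hx : 0 ≤ x) (hy : 0 ≤ y) :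
    |logBracket (x + y) - max (logBracket x) (logBracket y)| ≤ Real.log 2 := by
  have hmax : max (logBracket x) (logBracket y) ≤ logBracket (x + y) := by
    refine max_le (logBracket_le_logBracket ?_) (logBracket_le_logBracket ?_) <;>
      rw [abs_of_nonneg (by assumption), abs_of_nonneg (add_nonneg hx hy)] <;> linarith
  rw [abs_of_nonneg (sub_nonneg.2 hmax)]
  linarith [logBracket_add_le_max x y]

lemma mul_le_mul_add_abs_mul {k x y c : ℝ} (h : |x - y| ≤ c) : k * x ≤ k * y + |k| * c := by
  have hle := (le_abs_self (k * (x - y))).trans_eq (abs_mul k (x - y))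
  linarith [mul_le_mul_of_nonneg_left h (abs_nonneg k)]

/-- The admissible exponents `α i = s₁ - Re μᵢ` and `β i = s₂ + Re μᵢ` of the six Gamma factors in
the numerator of the Mellin–Barnes integrand, with `g = s₁ + s₂` and the exponent `δ`. -/
structure Exponents (α β : Fin 3 → ℝ) (g δ : ℝ) : Prop where
  pos_left : ∀ i, 0 < α i
  pos_right : ∀ i, 0 < β i
  add_eq : ∀ i, α i + β i = g
  le_left : ∀ i j, i ≠ j → δ ≤ α i + α j
  le_right : ∀ i j, i ≠ j → δ ≤ β i + β j
  le_add_half : δ ≤ g + 1 / 2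

lemma Exponents.symm {α β : Fin 3 → ℝ} {g δ : ℝ} (h : Exponents α β g δ) : Exponents β α g δ where
  pos_left := h.pos_right
  pos_right := h.pos_left
  add_eq i := by rw [add_comm, h.add_eq]
  le_left := h.le_right
  le_right := h.le_left
  le_add_half := h.le_add_half

lemma Exponents.comp {α β : Fin 3 → ℝ} {g δ : ℝ} (h : Exponents α β g δ)
    (w : Equiv.Perm (Fin 3)) : Exponents (α ∘ w) (β ∘ w) g δ where
  pos_left _ := h.pos_left _
  pos_right _ := h.pos_right _
  add_eq _ := h.add_eq _
  le_left _ _ hij := h.le_left _ _ (w.injective.ne hij)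
  le_right _ _ hij := h.le_right _ _ (w.injective.ne hij)
  le_add_half := h.le_add_half

/-- The total size of the exponents, which controls all the error terms of size `O(1)`. -/
def exponentSize (α β : Fin 3 → ℝ) (g : ℝ) : ℝ :=
  ∑ i, |α i - 1 / 2| + ∑ i, |β i - 1 / 2| + |1 / 2 - g|

lemma exponentSize_nonneg (α β : Fin 3 → ℝ) (g : ℝ) : 0 ≤ exponentSize α β g := by
  unfold exponentSize; positivity

lemma exponentSize_swap (α β : Fin 3 → ℝ) (g : ℝ) : exponentSize β α g = exponentSize α β g := by
  unfold exponentSize; ring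

lemma exponentSize_comp (α β : Fin 3 → ℝ) (g : ℝ) (w : Equiv.Perm (Fin 3)) :
    exponentSize (α ∘ w) (β ∘ w) g = exponentSize α β g := by
  simp only [exponentSize, Function.comp_apply, Equiv.sum_comp w fun i => |α i - 1 / 2|,
    Equiv.sum_comp w fun i => |β i - 1 / 2|]

/-- The logarithm of the polynomial part of the Mellin–Barnes integrand at imaginary parts `u, v`,
where `τ i = Im μᵢ`. -/
def polyLog (α β τ : Fin 3 → ℝ) (g u v : ℝ) : ℝ :=
  ∑ i, (α i - 1 / 2) * logBracket (u - τ i) + ∑ i, (β i - 1 / 2) * logBracket (v - τ i) +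
    (1 / 2 - g) * logBracket (u - v)

lemma polyLog_swap (α β τ : Fin 3 → ℝ) (g u v : ℝ) : polyLog β α τ g v u = polyLog α β τ g u v := by
  unfold polyLog
  rw [logBracket_sub_comm v u]; ring

lemma polyLog_rev (α β τ : Fin 3 → ℝ) (g u v : ℝ) :
    polyLog (β ∘ Fin.revPerm) (α ∘ Fin.revPerm) (fun i => -τ (Fin.revPerm i)) g (-v) (-u) =
      polyLog α β τ g u v := by
  have hneg (x y : ℝ) : logBracket (-x - -y) = logBracket (x - y) := by
    rw [neg_sub_neg, logBracket_sub_comm]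
  rw [← polyLog_swap]
  simp only [polyLog, hneg, Function.comp_apply,
    Equiv.sum_comp Fin.revPerm fun i => (β i - 1 / 2) * logBracket (v - τ i),
    Equiv.sum_comp Fin.revPerm fun i => (α i - 1 / 2) * logBracket (u - τ i)]

/-- The imaginary parts `u, v` interlace `τ 2 ≤ τ 1 ≤ τ 0`. In this region the Mellin–Barnes
integrand has no exponential decay. -/
structure Interlaces (τ : Fin 3 → ℝ) (u v : ℝ) : Prop where
  le_left : τ 1 ≤ u
  left_le : u ≤ τ 0
  le_right : τ 2 ≤ v
  right_le : v ≤ τ 1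

lemma Interlaces.rev {τ : Fin 3 → ℝ} {u v : ℝ} (h : Interlaces τ u v) :
    Interlaces (fun i => -τ (Fin.revPerm i)) (-v) (-u) :=
  ⟨neg_le_neg h.right_le, neg_le_neg h.le_right, neg_le_neg h.left_le, neg_le_neg h.le_left⟩

/-- Here `X i`, `Y i`, `Z`, `L`, `S` stand for the logarithmic brackets of `u - τ i`, `v - τ i`,
`u - v`, the larger gap `τ 0 - τ 1` and the smaller gap `τ 1 - τ 2`. Up to `O(1)` three of them are
maxima of others, and the claim is then piecewise linear. -/
lemma stationary_linear {α β X Y : Fin 3 → ℝ} {g δ c Z L S : ℝ} (H : Exponents α β g δ)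
    (hX₀ : X 0 ≤ L) (hX₁ : X 1 ≤ L) (hX₂ : |X 2 - max (X 1) S| ≤ c) (hY₀ : |Y 0 - L| ≤ c)
    (hY₁ : Y 1 ≤ S) (hY₂ : Y 2 ≤ S) (hZ : |Z - max (X 1) (Y 1)| ≤ c) (hSL : S ≤ L) :
    ∑ i, (α i - 1 / 2) * X i + ∑ i, (β i - 1 / 2) * Y i + (1 / 2 - g) * Z +
      (X 0 + X 1 - L) + (Y 1 + Y 2 - S) ≤
    exponentSize α β g * c + (2 * g - 1 / 2 - δ) * L + δ * S := by
  obtain rfl : α = fun i => g - β i := funext fun i => eq_sub_of_add_eq (H.add_eq i)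
  have hc : 0 ≤ c := (abs_nonneg _).trans hY₀
  have hα₀ := H.pos_left 0
  have hα₁ := H.pos_left 1
  have hβ₁ := H.pos_right 1
  have hβ₂ := H.pos_right 2
  have hδ := H.le_right 1 2 (by decide)
  have hδg := H.le_add_half
  have eX₂ := mul_le_mul_add_abs_mul (k := g - β 2 - 1 / 2) hX₂
  have eY₀ := mul_le_mul_add_abs_mul (k := β 0 - 1 / 2) hY₀
  have eZ := mul_le_mul_add_abs_mul (k := 1 / 2 - g) hZ
  have nX₀ := mul_nonneg (abs_nonneg (g - β 0 - 1 / 2)) hc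
  have nX₁ := mul_nonneg (abs_nonneg (g - β 1 - 1 / 2)) hc
  have nY₁ := mul_nonneg (abs_nonneg (β 1 - 1 / 2)) hc
  have nY₂ := mul_nonneg (abs_nonneg (β 2 - 1 / 2)) hc
  have pX₀ := mul_le_mul_of_nonneg_left hX₀ (by linarith : 0 ≤ g - β 0 + 1 / 2)
  have pY₂ := mul_le_mul_of_nonneg_left hY₂ (by linarith : 0 ≤ β 2 + 1 / 2)
  have pg := mul_le_mul_of_nonneg_left hSL (by linarith : 0 ≤ g + 1 / 2 - δ)
  have pβ := mul_le_mul_of_nonneg_left hSL (by linarith : 0 ≤ β 1 + β 2 - δ)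
  simp only [exponentSize, Fin.sum_univ_three]
  rcases le_total (X 1) S with h | h
  · rw [max_eq_right h] at eX₂
    have pX₁ := mul_le_mul_of_nonneg_left (le_max_left (X 1) (Y 1))
      (by linarith : 0 ≤ g - β 1 + 1 / 2)
    have pY₁ := mul_le_mul_of_nonneg_left (le_max_right (X 1) (Y 1)) (by linarith : 0 ≤ β 1 + 1 / 2)
    linarith [max_le h hY₁]
  · rw [max_eq_left h] at eX₂
    rw [max_eq_left (hY₁.trans h)] at eZ
    have pY₁ := mul_le_mul_of_nonneg_left hY₁ (by linarith : 0 ≤ β 1 + 1 / 2)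
    rcases le_total 0 (g - β 1 - β 2 + 1 / 2) with hsign | hsign
    · linarith [mul_le_mul_of_nonneg_left hX₁ hsign]
    · linarith [mul_le_mul_of_nonpos_left h hsign]

lemma polyLog_add_le_of_interlaces {α β τ : Fin 3 → ℝ} {g δ u v : ℝ} (H : Exponents α β g δ)
    (h : Interlaces τ u v) (hgap : τ 1 - τ 2 ≤ τ 0 - τ 1) :
    polyLog α β τ g u v +
      (logBracket (u - τ 0) + logBracket (u - τ 1) - logBracket (τ 0 - τ 1)) +
      (logBracket (v - τ 1) + logBracket (v - τ 2) - logBracket (τ 1 - τ 2)) ≤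
    exponentSize α β g * Real.log 2 + (2 * g - 1 / 2 - δ) * logBracket (τ 0 - τ 1) +
      δ * logBracket (τ 1 - τ 2) := by
  obtain ⟨hu, hu', hv, hv'⟩ := h
  have hmono {x y : ℝ} (hx : 0 ≤ x) (hxy : x ≤ y) : logBracket x ≤ logBracket y :=
    logBracket_le_logBracket (abs_le_abs_of_nonneg hx hxy)
  have hX₀ : logBracket (u - τ 0) ≤ logBracket (τ 0 - τ 1) := by
    rw [logBracket_sub_comm]
    exact hmono (by linarith) (by linarith)
  have hY₁ : logBracket (v - τ 1) ≤ logBracket (τ 1 - τ 2) := by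
    rw [logBracket_sub_comm]
    exact hmono (by linarith) (by linarith)
  have hX₂ := abs_logBracket_add_sub_max_le (sub_nonneg.2 hu) (sub_nonneg.2 (hv.trans hv'))
  have hY₀ := abs_logBracket_add_sub_max_le (sub_nonneg.2 (hu.trans hu')) (sub_nonneg.2 hv')
  have hZ := abs_logBracket_add_sub_max_le (sub_nonneg.2 hu) (sub_nonneg.2 hv')
  rw [sub_add_sub_cancel] at hX₂ hY₀ hZ
  rw [logBracket_sub_comm (τ 0) v, max_eq_left (hmono (by linarith) (by linarith))] at hY₀
  rw [logBracket_sub_comm (τ 1) v] at hZ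
  exact stationary_linear (X := fun i => logBracket (u - τ i)) (Y := fun i => logBracket (v - τ i))
    H hX₀ (hmono (by linarith) (by linarith)) hX₂ hY₀ hY₁ (hmono (by linarith) (by linarith)) hZ
    (hmono (by linarith) hgap)

lemma exists_logBracket_sub_le {ι : Type*} {τ : ι → ℝ} {i j : ι} {u : ℝ} (hj : τ j ≤ u)
    (hi : u ≤ τ i) :
    ∃ k, logBracket (u - τ k) ≤ logBracket (τ i - τ j) ∧ logBracket (u - τ k) ≤
      logBracket (u - τ i) + logBracket (u - τ j) - logBracket (τ i - τ j) + Real.log 2 := by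
  have hsum := logBracket_add_le_max (τ i - u) (u - τ j)
  rw [sub_add_sub_cancel, logBracket_sub_comm (τ i) u] at hsum
  have hleft : logBracket (u - τ i) ≤ logBracket (τ i - τ j) := by
    rw [logBracket_sub_comm]
    exact logBracket_le_logBracket (abs_le_abs_of_nonneg (by linarith) (by linarith))
  have hright : logBracket (u - τ j) ≤ logBracket (τ i - τ j) :=
    logBracket_le_logBracket (abs_le_abs_of_nonneg (by linarith) (by linarith))
  rcases le_total (logBracket (u - τ i)) (logBracket (u - τ j)) with h | h
  · rw [max_eq_right h] at hsum
    exact ⟨i, hleft, by linarith⟩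
  · rw [max_eq_left h] at hsum
    exact ⟨j, hright, by linarith⟩

/-- The logarithm of the bound for the polynomial part: the larger of the two adjacent gaps of `τ`
carries the exponent `2 g - 1 / 2 - δ`, the smaller one carries `δ`, and `e` is the loss. -/
def boundLog (τ : Fin 3 → ℝ) (g δ e : ℝ) : ℝ :=
  (2 * g - 1 / 2 - δ + 2 * e) * max (logBracket (τ 0 - τ 1)) (logBracket (τ 1 - τ 2)) +
    δ * min (logBracket (τ 0 - τ 1)) (logBracket (τ 1 - τ 2))

lemma boundLog_rev (τ : Fin 3 → ℝ) (g δ e : ℝ) :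
    boundLog (fun i => -τ (Fin.revPerm i)) g δ e = boundLog τ g δ e := by
  simp only [boundLog, Fin.revPerm_apply, Fin.isValue, Fin.reduceRev, neg_sub_neg]
  rw [max_comm, min_comm]

lemma exists_polyLog_le_of_interlaces_of_gap_le {α β τ : Fin 3 → ℝ} {g δ u v e : ℝ} (he : 0 ≤ e)
    (H : Exponents α β g δ) (h : Interlaces τ u v) (hgap : τ 1 - τ 2 ≤ τ 0 - τ 1) :
    ∃ i j, polyLog α β τ g u v + (1 + e) * logBracket (u - τ i) + (1 + e) * logBracket (v - τ j) ≤
      (exponentSize α β g + 2) * Real.log 2 + boundLog τ g δ e := by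
  have hpoly := polyLog_add_le_of_interlaces H h hgap
  obtain ⟨i, hi, hi'⟩ := exists_logBracket_sub_le h.le_left h.left_le
  obtain ⟨j, hj, hj'⟩ := exists_logBracket_sub_le h.le_right h.right_le
  have hgaps : logBracket (τ 1 - τ 2) ≤ logBracket (τ 0 - τ 1) :=
    logBracket_le_logBracket
      (abs_le_abs_of_nonneg (sub_nonneg.2 (h.le_right.trans h.right_le)) hgap)
  refine ⟨i, j, ?_⟩
  rw [boundLog, max_eq_left hgaps, min_eq_right hgaps]
  linarith [mul_le_mul_of_nonneg_left hi he, mul_le_mul_of_nonneg_left (hj.trans hgaps) he]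

lemma exists_polyLog_le_of_interlaces {α β τ : Fin 3 → ℝ} {g δ u v e : ℝ} (he : 0 ≤ e)
    (H : Exponents α β g δ) (h : Interlaces τ u v) :
    ∃ i j, polyLog α β τ g u v + (1 + e) * logBracket (u - τ i) + (1 + e) * logBracket (v - τ j) ≤
      (exponentSize α β g + 2) * Real.log 2 + boundLog τ g δ e := by
  rcases le_total (τ 1 - τ 2) (τ 0 - τ 1) with hgap | hgap
  · exact exists_polyLog_le_of_interlaces_of_gap_le he H h hgap
  · obtain ⟨i, j, hij⟩ := exists_polyLog_le_of_interlaces_of_gap_le he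
      (H.symm.comp Fin.revPerm) h.rev (by simpa [Fin.rev, neg_add_eq_sub] using hgap)
    refine ⟨Fin.revPerm j, Fin.revPerm i, ?_⟩
    rw [polyLog_rev, boundLog_rev, exponentSize_comp, exponentSize_swap, neg_sub_neg, neg_sub_neg,
      logBracket_sub_comm _ u, logBracket_sub_comm _ v] at hij
    linarith

/-- The decay rate of the exponential part of the Mellin–Barnes integrand, in units of `π / 2`. -/
def expDist (τ : Fin 3 → ℝ) (u v : ℝ) : ℝ := ∑ i, |u - τ i| + ∑ i, |v - τ i| - |u - v|

/-- The minimum of `expDist`. -/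
def gapSum (τ : Fin 3 → ℝ) : ℝ := |τ 0 - τ 1| + |τ 0 - τ 2| + |τ 1 - τ 2|

lemma expDist_swap (τ : Fin 3 → ℝ) (u v : ℝ) : expDist τ v u = expDist τ u v := by
  unfold expDist; rw [abs_sub_comm v u]; ring

lemma exists_mem_Icc_two_mul_abs_sub_eq {a b : ℝ} (hab : a ≤ b) (x : ℝ) :
    ∃ x' ∈ Set.Icc a b, 2 * |x - x'| = |x - a| + |x - b| - (b - a) := by
  rcases le_total x a with hxa | hax
  · refine ⟨a, ⟨le_rfl, hab⟩, ?_⟩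
    rw [abs_of_nonpos (sub_nonpos.2 hxa), abs_of_nonpos (sub_nonpos.2 (hxa.trans hab))]
    ring
  rcases le_total x b with hxb | hbx
  · refine ⟨x, ⟨hax, hxb⟩, ?_⟩
    rw [sub_self, abs_zero, abs_of_nonneg (sub_nonneg.2 hax), abs_of_nonpos (sub_nonpos.2 hxb)]
    ring
  · refine ⟨b, ⟨hab, le_rfl⟩, ?_⟩
    rw [abs_of_nonneg (sub_nonneg.2 hax), abs_of_nonneg (sub_nonneg.2 hbx)]
    ring

lemma exists_interlaces_abs_sub_add_abs_sub_le {τ : Fin 3 → ℝ} (hτ : Antitone τ) {u v : ℝ}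
    (huv : v ≤ u) :
    ∃ u' v', Interlaces τ u' v' ∧ |u - u'| + |v - v'| ≤ expDist τ u v - gapSum τ := by
  have h₀₁ : τ 1 ≤ τ 0 := hτ (by decide)
  have h₁₂ : τ 2 ≤ τ 1 := hτ (by decide)
  obtain ⟨u', hu', hu⟩ := exists_mem_Icc_two_mul_abs_sub_eq h₀₁ u
  obtain ⟨v', hv', hv⟩ := exists_mem_Icc_two_mul_abs_sub_eq h₁₂ v
  refine ⟨u', v', ⟨hu'.1, hu'.2, hv'.1, hv'.2⟩, ?_⟩
  simp only [expDist, gapSum, Fin.sum_univ_three, abs_of_nonneg (sub_nonneg.2 huv),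
    abs_of_nonneg (sub_nonneg.2 h₀₁), abs_of_nonneg (sub_nonneg.2 h₁₂),
    abs_of_nonneg (sub_nonneg.2 (h₁₂.trans h₀₁))]
  linarith [abs_nonneg (u - u'), abs_nonneg (v - v'), le_abs_self (u - τ 2), neg_abs_le (v - τ 0)]

lemma exists_mul_logBracket_le {N : ℝ} (hN : 0 ≤ N) :
    ∃ C : ℝ, ∀ x : ℝ, N * logBracket x ≤ C + π / 2 * |x| := by
  refine ⟨N * Real.log (N + 1), fun x => ?_⟩
  have hlog := Real.log_le_sub_one_of_pos (x := (1 + |x|) / (N + 1)) (by positivity)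
  rw [Real.log_div (by positivity) (by positivity)] at hlog
  have hlinear : N * ((1 + |x|) / (N + 1) - 1) ≤ |x| := by
    rw [div_sub_one (by positivity), mul_div_assoc', div_le_iff₀ (by positivity)]
    nlinarith [abs_nonneg x]
  unfold logBracket
  nlinarith [Real.pi_gt_three, abs_nonneg x, mul_le_mul_of_nonneg_left hlog hN]

lemma polyLog_le_add_logBracket (α β τ : Fin 3 → ℝ) (g : ℝ) {e : ℝ} (he : 0 ≤ e)
    (u v u' v' : ℝ) (i j : Fin 3) :
    polyLog α β τ g u v + (1 + e) * logBracket (u - τ i) + (1 + e) * logBracket (v - τ j) ≤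
      polyLog α β τ g u' v' + (1 + e) * logBracket (u' - τ i) + (1 + e) * logBracket (v' - τ j) +
        (2 * exponentSize α β g + 2 * (1 + e)) * logBracket (|u - u'| + |v - v'|) := by
  set ℓ := logBracket (|u - u'| + |v - v'|)
  have hdist : |(|u - u'| + |v - v'|)| = |u - u'| + |v - v'| := abs_of_nonneg (by positivity)
  have hu (k : Fin 3) : |logBracket (u - τ k) - logBracket (u' - τ k)| ≤ ℓ := by
    refine (abs_logBracket_sub_logBracket_le _ _).trans (logBracket_le_logBracket ?_)
    rw [sub_sub_sub_cancel_right, hdist]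
    exact le_add_of_nonneg_right (abs_nonneg _)
  have hv (k : Fin 3) : |logBracket (v - τ k) - logBracket (v' - τ k)| ≤ ℓ := by
    refine (abs_logBracket_sub_logBracket_le _ _).trans (logBracket_le_logBracket ?_)
    rw [sub_sub_sub_cancel_right, hdist]
    exact le_add_of_nonneg_left (abs_nonneg _)
  have huv : |logBracket (u - v) - logBracket (u' - v')| ≤ ℓ := by
    refine (abs_logBracket_sub_logBracket_le _ _).trans (logBracket_le_logBracket ?_)
    rw [sub_sub_sub_comm, hdist]
    exact abs_sub _ _
  have hℓ₀ : 0 ≤ ℓ := logBracket_nonneg _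
  have hα := Finset.sum_le_sum fun k (_ : k ∈ Finset.univ) =>
    mul_le_mul_add_abs_mul (k := α k - 1 / 2) (hu k)
  have hβ := Finset.sum_le_sum fun k (_ : k ∈ Finset.univ) =>
    mul_le_mul_add_abs_mul (k := β k - 1 / 2) (hv k)
  have hi := mul_le_mul_add_abs_mul (k := 1 + e) (hu i)
  have hj := mul_le_mul_add_abs_mul (k := 1 + e) (hv j)
  rw [Finset.sum_add_distrib, ← Finset.sum_mul] at hα hβ
  rw [abs_of_nonneg (by linarith : 0 ≤ 1 + e)] at hi hj
  have hsize := mul_nonneg (exponentSize_nonneg α β g) hℓ₀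
  unfold exponentSize at hsize ⊢
  unfold polyLog
  linarith [mul_le_mul_add_abs_mul (k := 1 / 2 - g) huv]

/-- The exponential decay away from the interlacing region absorbs the polynomial growth. -/
lemma exists_polyLog_sub_expDist_le {α β : Fin 3 → ℝ} {g δ e : ℝ} (he : 0 ≤ e)
    (H : Exponents α β g δ) :
    ∃ C : ℝ, ∀ τ : Fin 3 → ℝ, Antitone τ → ∀ u v : ℝ,
      ∃ i j, polyLog α β τ g u v - π / 2 * expDist τ u v + (1 + e) * logBracket (u - τ i) +
        (1 + e) * logBracket (v - τ j) ≤ C + boundLog τ g δ e - π / 2 * gapSum τ := by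
  obtain ⟨C, hC⟩ := exists_mul_logBracket_le
    (by linarith [exponentSize_nonneg α β g] : 0 ≤ 2 * exponentSize α β g + 2 * (1 + e))
  refine ⟨(exponentSize α β g + 2) * Real.log 2 + C, fun τ hτ u v => ?_⟩
  suffices hnear : ∃ u' v', |u - u'| + |v - v'| ≤ expDist τ u v - gapSum τ ∧ ∃ i j,
      polyLog α β τ g u' v' + (1 + e) * logBracket (u' - τ i) + (1 + e) * logBracket (v' - τ j) ≤
        (exponentSize α β g + 2) * Real.log 2 + boundLog τ g δ e by
    obtain ⟨u', v', hdist, i, j, hij⟩ := hnear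
    have hdecay := hC (|u - u'| + |v - v'|)
    rw [abs_of_nonneg (by positivity : 0 ≤ |u - u'| + |v - v'|)] at hdecay
    refine ⟨i, j, ?_⟩
    linarith [polyLog_le_add_logBracket α β τ g he u v u' v' i j,
      mul_le_mul_of_nonneg_left hdist Real.pi_div_two_pos.le]
  rcases le_total v u with huv | huv
  · obtain ⟨u', v', h, hdist⟩ := exists_interlaces_abs_sub_add_abs_sub_le hτ huv
    exact ⟨u', v', hdist, exists_polyLog_le_of_interlaces he H h⟩
  · obtain ⟨v', u', h, hdist⟩ := exists_interlaces_abs_sub_add_abs_sub_le hτ huv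
    obtain ⟨j, i, hij⟩ := exists_polyLog_le_of_interlaces he H.symm h
    rw [polyLog_swap, exponentSize_swap] at hij
    exact ⟨u', v', by rwa [add_comm, ← expDist_swap], i, j, by linarith⟩

/-! ### Integrals dominated by the Mellin–Barnes integrand -/

/-- The absolute value of the Mellin–Barnes integrand: six Gamma factors over one, with real parts
`α`, `β`, `g` and imaginary parts `u - τ i`, `v - τ i`, `u - v`. -/
def mbWeight (α β τ : Fin 3 → ℝ) (g u v : ℝ) : ℝ :=
  (∏ i, ‖Complex.Gamma (α i + (u - τ i : ℝ) * I)‖) *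
    (∏ i, ‖Complex.Gamma (β i + (v - τ i : ℝ) * I)‖) * ‖(Complex.Gamma (g + (u - v : ℝ) * I))⁻¹‖

lemma mbWeight_comp (α β τ : Fin 3 → ℝ) (g u v : ℝ) (w : Equiv.Perm (Fin 3)) :
    mbWeight (α ∘ w) (β ∘ w) (τ ∘ w) g u v = mbWeight α β τ g u v := by
  simp only [mbWeight, Function.comp_apply,
    Equiv.prod_comp w fun i => ‖Complex.Gamma (α i + (u - τ i : ℝ) * I)‖,
    Equiv.prod_comp w fun i => ‖Complex.Gamma (β i + (v - τ i : ℝ) * I)‖]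

lemma exists_prod_norm_Gamma_le {ι : Type*} [Fintype ι] {α : ι → ℝ} (hα : ∀ i, 0 < α i) :
    ∃ C : ℝ, 0 < C ∧ ∀ y : ι → ℝ, ∏ i, ‖Complex.Gamma (α i + y i * I)‖ ≤
      C * Real.exp (∑ i, stirlingLog (α i) (y i)) := by
  choose A hA hbound using fun i => exists_norm_Gamma_le (hα i)
  refine ⟨∏ i, A i, Finset.prod_pos fun i _ => hA i, fun y => ?_⟩
  rw [Real.exp_sum, ← Finset.prod_mul_distrib]
  exact Finset.prod_le_prod (fun _ _ => norm_nonneg _) fun i _ => hbound i (y i)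

lemma exists_mbWeight_le_exp {α β : Fin 3 → ℝ} (hα : ∀ i, 0 < α i) (hβ : ∀ i, 0 < β i) (g : ℝ) :
    ∃ C : ℝ, 0 < C ∧ ∀ (τ : Fin 3 → ℝ) (u v : ℝ), mbWeight α β τ g u v ≤
      C * Real.exp (polyLog α β τ g u v - π / 2 * expDist τ u v) := by
  obtain ⟨A, hA, hα⟩ := exists_prod_norm_Gamma_le hα
  obtain ⟨B, hB, hβ⟩ := exists_prod_norm_Gamma_le hβ
  obtain ⟨D, hD, hg⟩ := exists_norm_inv_Gamma_le g
  refine ⟨A * B * D, by positivity, fun τ u v => ?_⟩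
  have hexponent : polyLog α β τ g u v - π / 2 * expDist τ u v =
      ∑ i, stirlingLog (α i) (u - τ i) + ∑ i, stirlingLog (β i) (v - τ i) +
        -stirlingLog g (u - v) := by
    simp only [polyLog, expDist, stirlingLog, Finset.sum_sub_distrib, ← Finset.mul_sum]
    ring
  calc mbWeight α β τ g u v
      ≤ (A * Real.exp (∑ i, stirlingLog (α i) (u - τ i))) *
          (B * Real.exp (∑ i, stirlingLog (β i) (v - τ i))) *
          (D * Real.exp (-stirlingLog g (u - v))) := by
        unfold mbWeight
        gcongr
        · exact hα fun i => u - τ i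
        · exact hβ fun i => v - τ i
        · exact hg _
    _ = _ := by
        rw [hexponent, Real.exp_add, Real.exp_add]
        ring

/-- An integrable weight, more convenient than an exponential since its translates absorb powers of
the bracket. -/
def decayWeight (e x : ℝ) : ℝ := Real.exp (-((1 + e) * logBracket x))

lemma integrable_decayWeight {e : ℝ} (he : 0 < e) : Integrable (decayWeight e) := by
  have hpow : decayWeight e = fun x => (1 + ‖x‖) ^ (-(1 + e)) := by
    funext x
    rw [decayWeight, logBracket, Real.rpow_def_of_pos (by positivity), Real.norm_eq_abs]
    ring_nf
  rw [hpow]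
  exact integrable_one_add_norm (by simpa using he)

/-- The sum of the translates of `decayWeight e` to the points `τ i`. -/
def decaySum (e : ℝ) (τ : Fin 3 → ℝ) (x : ℝ) : ℝ := ∑ i, decayWeight e (x - τ i)

lemma decayWeight_le_decaySum (e : ℝ) (τ : Fin 3 → ℝ) (x : ℝ) (i : Fin 3) :
    decayWeight e (x - τ i) ≤ decaySum e τ x :=
  Finset.single_le_sum (f := fun i => decayWeight e (x - τ i)) (fun _ _ => (Real.exp_pos _).le)
    (Finset.mem_univ i)

lemma decaySum_comp (e : ℝ) (τ : Fin 3 → ℝ) (w : Equiv.Perm (Fin 3)) (x : ℝ) :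
    decaySum e (τ ∘ w) x = decaySum e τ x :=
  Equiv.sum_comp w fun i => decayWeight e (x - τ i)

lemma integrable_decaySum {e : ℝ} (he : 0 < e) (τ : Fin 3 → ℝ) : Integrable (decaySum e τ) :=
  integrable_finsetSum _ fun i _ => (integrable_decayWeight he).comp_sub_right (τ i)

lemma integral_decaySum {e : ℝ} (he : 0 < e) (τ : Fin 3 → ℝ) :
    ∫ x, decaySum e τ x = 3 * ∫ x, decayWeight e x := by
  simp only [decaySum]
  rw [integral_finsetSum _ fun i _ => (integrable_decayWeight he).comp_sub_right (τ i)]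
  simp only [integral_sub_right_eq_self, Finset.sum_const, Finset.card_univ, Fintype.card_fin,
    nsmul_eq_mul, Nat.cast_ofNat]

lemma gapSum_comp (τ : Fin 3 → ℝ) (w : Equiv.Perm (Fin 3)) : gapSum (τ ∘ w) = gapSum τ := by
  have htwice (τ : Fin 3 → ℝ) : 2 * gapSum τ = ∑ i, ∑ j, |τ i - τ j| := by
    simp only [gapSum, Fin.sum_univ_three, sub_self, abs_zero]
    rw [abs_sub_comm (τ 1) (τ 0), abs_sub_comm (τ 2) (τ 0), abs_sub_comm (τ 2) (τ 1)]
    ring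
  have hperm : ∑ i, ∑ j, |(τ ∘ w) i - (τ ∘ w) j| = ∑ i, ∑ j, |τ i - τ j| :=
    (Finset.sum_congr rfl fun i _ => Equiv.sum_comp w fun j => |τ (w i) - τ j|).trans
      (Equiv.sum_comp w fun i => ∑ j, |τ i - τ j|)
  linarith [htwice τ, htwice (τ ∘ w)]

lemma exists_perm_antitone {n : ℕ} {R : Type*} [LinearOrder R] (τ : Fin n → R) :
    ∃ w : Equiv.Perm (Fin n), Antitone (τ ∘ w) :=
  ⟨Tuple.sort (OrderDual.toDual ∘ τ), Tuple.monotone_sort (OrderDual.toDual ∘ τ)⟩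

lemma exists_mbWeight_le_decaySum_of_antitone {α β : Fin 3 → ℝ} {g δ e : ℝ} (he : 0 ≤ e)
    (H : Exponents α β g δ) :
    ∃ C : ℝ, 0 < C ∧ ∀ τ : Fin 3 → ℝ, Antitone τ → ∀ u v : ℝ, mbWeight α β τ g u v ≤
      C * Real.exp (boundLog τ g δ e - π / 2 * gapSum τ) * (decaySum e τ u * decaySum e τ v) := by
  obtain ⟨C, hC⟩ := exists_polyLog_sub_expDist_le he H
  obtain ⟨A, hA, hweight⟩ := exists_mbWeight_le_exp H.pos_left H.pos_right g
  refine ⟨A * Real.exp C, by positivity, fun τ hτ u v => (hweight τ u v).trans ?_⟩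
  obtain ⟨i, j, hij⟩ := hC τ hτ u v
  calc A * Real.exp (polyLog α β τ g u v - π / 2 * expDist τ u v)
      ≤ A * (Real.exp C * Real.exp (boundLog τ g δ e - π / 2 * gapSum τ) *
          (decayWeight e (u - τ i) * decayWeight e (v - τ j))) := by
        rw [decayWeight, decayWeight, ← Real.exp_add, ← Real.exp_add, ← Real.exp_add]
        gcongr
        linarith
    _ ≤ A * (Real.exp C * Real.exp (boundLog τ g δ e - π / 2 * gapSum τ) *
          (decaySum e τ u * decaySum e τ v)) := by
        have hu := decayWeight_le_decaySum e τ u i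
        have hv := decayWeight_le_decaySum e τ v j
        have hu₀ : 0 ≤ decayWeight e (u - τ i) := (Real.exp_pos _).le
        have hv₀ : 0 ≤ decayWeight e (v - τ j) := (Real.exp_pos _).le
        have hu₁ := hu₀.trans hu
        gcongr
    _ = _ := by ring

lemma exists_mbWeight_le_decaySum {α β : Fin 3 → ℝ} {g δ e : ℝ} (he : 0 ≤ e)
    (H : Exponents α β g δ) :
    ∃ C : ℝ, 0 < C ∧ ∀ τ : Fin 3 → ℝ, ∃ w : Equiv.Perm (Fin 3), Antitone (τ ∘ w) ∧ ∀ u v : ℝ,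
      mbWeight α β τ g u v ≤ C * Real.exp (boundLog (τ ∘ w) g δ e - π / 2 * gapSum τ) *
        (decaySum e τ u * decaySum e τ v) := by
  choose C hC hbound using fun w : Equiv.Perm (Fin 3) =>
    exists_mbWeight_le_decaySum_of_antitone he (H.comp w)
  refine ⟨∑ w, C w, Finset.sum_pos (fun w _ => hC w) Finset.univ_nonempty, fun τ => ?_⟩
  obtain ⟨w, hw⟩ := exists_perm_antitone τ
  refine ⟨w, hw, fun u v => ?_⟩
  have hle := hbound w (τ ∘ w) hw u v
  rw [mbWeight_comp, gapSum_comp, decaySum_comp, decaySum_comp] at hle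
  have hsum : 0 ≤ decaySum e τ u * decaySum e τ v :=
    mul_nonneg (Finset.sum_nonneg fun _ _ => (Real.exp_pos _).le)
      (Finset.sum_nonneg fun _ _ => (Real.exp_pos _).le)
  refine hle.trans ?_
  gcongr
  exact Finset.single_le_sum (fun w _ => (hC w).le) (Finset.mem_univ w)

lemma exists_norm_integral_le_of_norm_le_mbWeight {α β : Fin 3 → ℝ} {g δ e : ℝ} (he : 0 < e)
    (H : Exponents α β g δ) :
    ∃ C : ℝ, 0 ≤ C ∧ ∀ τ : Fin 3 → ℝ, ∃ w : Equiv.Perm (Fin 3), Antitone (τ ∘ w) ∧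
      ∀ f : ℝ × ℝ → ℂ, (∀ p, ‖f p‖ ≤ mbWeight α β τ g p.1 p.2) →
        ‖∫ p, f p‖ ≤ C * Real.exp (boundLog (τ ∘ w) g δ e - π / 2 * gapSum τ) := by
  obtain ⟨C, hC, hbound⟩ := exists_mbWeight_le_decaySum he.le H
  refine ⟨C * (3 * ∫ x, decayWeight e x) ^ 2, by positivity, fun τ => ?_⟩
  obtain ⟨w, hw, hweight⟩ := hbound τ
  refine ⟨w, hw, fun f hf => ?_⟩
  have hint := integrable_decaySum he τ
  set K := C * Real.exp (boundLog (τ ∘ w) g δ e - π / 2 * gapSum τ) with hK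
  calc ‖∫ p, f p‖ ≤ ∫ p : ℝ × ℝ, K * (decaySum e τ p.1 * decaySum e τ p.2) :=
        norm_integral_le_of_norm_le ((hint.mul_prod hint).const_mul K)
          (Eventually.of_forall fun p => (hf p).trans (hweight p.1 p.2))
    _ = K * (3 * ∫ x, decayWeight e x) ^ 2 := by
        rw [integral_const_mul, Measure.volume_eq_prod, integral_prod_mul, integral_decaySum he, sq]
    _ = _ := by rw [hK]; ring

/-! ### The polynomial factors -/

lemma one_add_abs_le_two_mul_norm (x : ℝ) : 1 + |x| ≤ 2 * ‖1 + I * (x : ℂ)‖ := by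
  have hre : 1 ≤ ‖1 + I * (x : ℂ)‖ := by simpa using Complex.abs_re_le_norm (1 + I * (x : ℂ))
  have him : |x| ≤ ‖1 + I * (x : ℂ)‖ := by simpa using Complex.abs_im_le_norm (1 + I * (x : ℂ))
  linarith

lemma norm_one_add_I_mul_le (x : ℝ) : ‖1 + I * (x : ℂ)‖ ≤ 1 + |x| := by
  simpa using norm_add_le (1 : ℂ) (I * (x : ℂ))

lemma norm_one_add_I_mul_pos (x : ℝ) : 0 < ‖1 + I * (x : ℂ)‖ := by
  linarith [one_add_abs_le_two_mul_norm x, abs_nonneg x]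

lemma abs_log_norm_sub_logBracket_le {x y k : ℝ} (hk : 1 ≤ k) (hxy : |x| ≤ k * |y|)
    (hyx : |y| ≤ k * |x|) :
    |Real.log ‖1 + I * (x : ℂ)‖ - logBracket y| ≤ Real.log (2 * k) := by
  have hpos := norm_one_add_I_mul_pos x
  have hlower := one_add_abs_le_two_mul_norm x
  have hupper := norm_one_add_I_mul_le x
  rw [abs_sub_le_iff, sub_le_iff_le_add', sub_le_iff_le_add', logBracket,
    ← Real.log_mul (by positivity) (by positivity), ← Real.log_mul (by positivity) (by positivity)]
  exact ⟨Real.log_le_log hpos (by nlinarith [abs_nonneg y]),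
    Real.log_le_log (by positivity) (by nlinarith)⟩

lemma Mpoly_eq_exp (a b c : ℝ) (μ : Fin 3 → ℂ) : Mpoly a b c μ =
    Real.exp (a * Real.log ‖1 + I * ((μ 0 - μ 1).im : ℂ)‖ +
      b * Real.log ‖1 + I * ((μ 0 - μ 2).im : ℂ)‖ +
      c * Real.log ‖1 + I * ((μ 1 - μ 2).im : ℂ)‖) := by
  rw [Mpoly, Real.rpow_def_of_pos (norm_one_add_I_mul_pos _),
    Real.rpow_def_of_pos (norm_one_add_I_mul_pos _),
    Real.rpow_def_of_pos (norm_one_add_I_mul_pos _), ← Real.exp_add, ← Real.exp_add]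
  ring_nf

lemma Mpoly_pos (a b c : ℝ) (μ : Fin 3 → ℂ) : 0 < Mpoly a b c μ := by
  rw [Mpoly_eq_exp]
  exact Real.exp_pos _

lemma Mpoly_comp_le_Msym (ε κ δ : ℝ) (μ : Fin 3 → ℂ) (w : Equiv.Perm (Fin 3)) :
    Mpoly ((κ - δ) / 2 + ε) ((κ - δ) / 2 + ε) (δ + ε) (μ ∘ w) ≤ Msym ε κ δ μ :=
  Finset.single_le_sum (f := fun w : Equiv.Perm (Fin 3) =>
    Mpoly ((κ - δ) / 2 + ε) ((κ - δ) / 2 + ε) (δ + ε) (μ ∘ w))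
    (fun _ _ => (Mpoly_pos _ _ _ _).le) (Finset.mem_univ w)

lemma Msym_pos (ε κ δ : ℝ) (μ : Fin 3 → ℂ) : 0 < Msym ε κ δ μ :=
  Finset.sum_pos (fun _ _ => Mpoly_pos _ _ _ _) Finset.univ_nonempty

lemma exp_le_Mpoly {ν : Fin 3 → ℂ} (a c : ℝ) (hle : |(ν 0 - ν 1).im| ≤ |(ν 0 - ν 2).im|)
    (hge : |(ν 0 - ν 2).im| ≤ 2 * |(ν 0 - ν 1).im|) :
    Real.exp (2 * a * logBracket ((ν 0 - ν 1).im / 2) + c * logBracket ((ν 1 - ν 2).im / 2)) ≤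
      Real.exp ((2 * |a| + |c|) * Real.log (2 * 4)) * Mpoly a a c ν := by
  have hcompare {x y : ℝ} (hyx : |y| ≤ |x|) (hxy : |x| ≤ 2 * |y|) :
      |logBracket (y / 2) - Real.log ‖1 + I * (x : ℂ)‖| ≤ Real.log (2 * 4) := by
    rw [abs_sub_comm]
    have hhalf : |y / 2| = |y| / 2 := by rw [abs_div, abs_two]
    exact abs_log_norm_sub_logBracket_le (by norm_num) (by linarith) (by linarith [abs_nonneg x])
  have hself {x : ℝ} := hcompare (le_refl |x|) (by linarith [abs_nonneg x])
  rw [Mpoly_eq_exp, ← Real.exp_add, Real.exp_le_exp]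
  linarith [mul_le_mul_add_abs_mul (k := a) (hself (x := (ν 0 - ν 1).im)),
    mul_le_mul_add_abs_mul (k := a) (hcompare hle hge),
    mul_le_mul_add_abs_mul (k := c) (hself (x := (ν 1 - ν 2).im))]

lemma boundLog_le {g δ₀ δ e κ ε : ℝ} (hκ : 2 * g - 1 / 2 - δ₀ + 2 * e ≤ κ - δ + 2 * ε)
    (hδ : δ₀ ≤ δ + ε) (τ : Fin 3 → ℝ) :
    boundLog τ g δ₀ e ≤
      2 * ((κ - δ) / 2 + ε) * max (logBracket (τ 0 - τ 1)) (logBracket (τ 1 - τ 2)) +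
        (δ + ε) * min (logBracket (τ 0 - τ 1)) (logBracket (τ 1 - τ 2)) := by
  have hmax := mul_le_mul_of_nonneg_right hκ
    (le_max_of_le_left (b := logBracket (τ 0 - τ 1)) (c := logBracket (τ 1 - τ 2))
      (logBracket_nonneg _))
  have hmin := mul_le_mul_of_nonneg_right hδ
    (le_min (logBracket_nonneg (τ 0 - τ 1)) (logBracket_nonneg (τ 1 - τ 2)))
  unfold boundLog
  linarith

lemma exp_boundLog_le_of_antitone {g δ₀ δ e κ ε : ℝ}
    (hκ : 2 * g - 1 / 2 - δ₀ + 2 * e ≤ κ - δ + 2 * ε) (hδ : δ₀ ≤ δ + ε) {ν : Fin 3 → ℂ}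
    (hν : Antitone fun i => (ν i).im / 2) :
    Real.exp (boundLog (fun i => (ν i).im / 2) g δ₀ e) ≤
      Real.exp ((2 * |(κ - δ) / 2 + ε| + |δ + ε|) * Real.log (2 * 4)) * Msym ε κ δ ν := by
  refine (Real.exp_le_exp.2 (boundLog_le hκ hδ _)).trans ?_
  simp only [← sub_div, ← Complex.sub_im]
  have h₀₁ : 0 ≤ (ν 0 - ν 1).im := by
    rw [Complex.sub_im]; linarith [hν (show (0 : Fin 3) ≤ 1 by decide)]
  have h₁₂ : 0 ≤ (ν 1 - ν 2).im := by
    rw [Complex.sub_im]; linarith [hν (show (1 : Fin 3) ≤ 2 by decide)]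
  have h₀₂ : (ν 0 - ν 2).im = (ν 0 - ν 1).im + (ν 1 - ν 2).im := by
    simp only [Complex.sub_im]; ring
  have hneg (i j : Fin 3) : (ν i - ν j).im = -(ν j - ν i).im := by
    rw [← Complex.neg_im, neg_sub]
  -- The two indices across the smaller gap must occupy the last two places.
  rcases le_total ((ν 1 - ν 2).im) ((ν 0 - ν 1).im) with hgap | hgap
  · have hmono : logBracket ((ν 1 - ν 2).im / 2) ≤ logBracket ((ν 0 - ν 1).im / 2) :=
      logBracket_le_logBracket (by
        rw [abs_of_nonneg (by linarith), abs_of_nonneg (by linarith)]; linarith)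
    rw [max_eq_left hmono, min_eq_right hmono]
    refine (exp_le_Mpoly _ _ ?_ ?_).trans
      (mul_le_mul_of_nonneg_left (Mpoly_comp_le_Msym ε κ δ ν 1) (Real.exp_pos _).le)
    all_goals
      rw [h₀₂, abs_of_nonneg (add_nonneg h₀₁ h₁₂), abs_of_nonneg h₀₁]
      linarith
  · have hmono : logBracket ((ν 0 - ν 1).im / 2) ≤ logBracket ((ν 1 - ν 2).im / 2) :=
      logBracket_le_logBracket (by
        rw [abs_of_nonneg (by linarith), abs_of_nonneg (by linarith)]; linarith)
    have hswap := exp_le_Mpoly (ν := ν ∘ Equiv.swap 0 2) ((κ - δ) / 2 + ε) (δ + ε)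
    simp only [Function.comp_apply, Equiv.swap_apply_left, Equiv.swap_apply_right,
      Equiv.swap_apply_of_ne_of_ne (one_ne_zero : (1 : Fin 3) ≠ 0) (by decide : (1 : Fin 3) ≠ 2),
      hneg 2, hneg 1 0, neg_div, logBracket_neg, abs_neg, h₀₂] at hswap
    rw [max_eq_right hmono, min_eq_left hmono]
    refine (hswap ?_ ?_).trans
      (mul_le_mul_of_nonneg_left (Mpoly_comp_le_Msym ε κ δ ν _) (Real.exp_pos _).le)
    all_goals
      rw [abs_of_nonneg (add_nonneg h₀₁ h₁₂), abs_of_nonneg h₁₂]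
      linarith

lemma Msym_comp (ε κ δ : ℝ) (μ : Fin 3 → ℂ) (w : Equiv.Perm (Fin 3)) :
    Msym ε κ δ (μ ∘ w) = Msym ε κ δ μ :=
  Equiv.sum_comp (Equiv.mulLeft w) fun w' : Equiv.Perm (Fin 3) =>
    Mpoly ((κ - δ) / 2 + ε) ((κ - δ) / 2 + ε) (δ + ε) (μ ∘ w')

lemma exists_exp_boundLog_le_Msym {g δ₀ δ e κ ε : ℝ}
    (hκ : 2 * g - 1 / 2 - δ₀ + 2 * e ≤ κ - δ + 2 * ε) (hδ : δ₀ ≤ δ + ε) :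
    ∃ C : ℝ, 0 < C ∧ ∀ (μ : Fin 3 → ℂ) (w : Equiv.Perm (Fin 3)),
      Antitone ((fun i => (μ i).im / 2) ∘ w) →
      Real.exp (boundLog ((fun i => (μ i).im / 2) ∘ w) g δ₀ e) ≤ C * Msym ε κ δ μ :=
  ⟨_, Real.exp_pos _, fun μ w hw => by
    rw [← Msym_comp ε κ δ μ w]
    exact exp_boundLog_le_of_antitone hκ hδ (ν := μ ∘ w) hw⟩

/-- The normalizing factor `1 / (Γ((1 + μ₁ - μ₂) / 2) Γ((1 + μ₂ - μ₃) / 2) Γ((1 + μ₁ - μ₃) / 2))` of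
the Jacquet-Whittaker function; it is entire in `μ`. -/
def gammaFactor (μ : Fin 3 → ℂ) : ℂ :=
  (Complex.Gamma ((1 + μ 0 - μ 1) / 2))⁻¹ * (Complex.Gamma ((1 + μ 1 - μ 2) / 2))⁻¹ *
    (Complex.Gamma ((1 + μ 0 - μ 2) / 2))⁻¹

lemma exists_norm_inv_Gamma_half_le (x : ℝ) : ∃ C : ℝ, 0 < C ∧ ∀ z : ℂ, z.re = x →
    ‖(Complex.Gamma ((1 + z) / 2))⁻¹‖ ≤
      C * ((‖1 + I * (z.im : ℂ)‖ ^ (x / 2))⁻¹ * Real.exp (π / 2 * |z.im / 2|)) := by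
  obtain ⟨C, hC, hΓ⟩ := exists_norm_inv_Gamma_le ((1 + x) / 2)
  refine ⟨C * Real.exp (|x / 2| * Real.log (2 * 2)), by positivity, fun z hz => ?_⟩
  have hz' : (1 + z) / 2 = (((1 + x) / 2 : ℝ) : ℂ) + (z.im / 2 : ℝ) * I := by
    conv_lhs => rw [← Complex.re_add_im z, hz]
    push_cast
    ring
  have hhalf : |z.im / 2| = |z.im| / 2 := by rw [abs_div, abs_two]
  have hlog := abs_log_norm_sub_logBracket_le (x := z.im) (y := z.im / 2) (k := 2) (by norm_num)
    (by linarith) (by linarith [abs_nonneg z.im])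
  rw [hz', mul_assoc]
  refine (hΓ _).trans (mul_le_mul_of_nonneg_left ?_ hC.le)
  rw [Real.rpow_def_of_pos (norm_one_add_I_mul_pos _), stirlingLog, ← Real.exp_neg,
    ← Real.exp_add, ← Real.exp_add, Real.exp_le_exp]
  linarith [mul_le_mul_add_abs_mul (k := x / 2) hlog]

lemma exists_norm_gammaFactor_le (η : Fin 3 → ℝ) : ∃ C : ℝ, 0 < C ∧ ∀ μ : Fin 3 → ℂ,
    (∀ i, (μ i).re = η i) → ‖gammaFactor μ‖ ≤
      C * ((LambdaPoly μ)⁻¹ * Real.exp (π / 2 * gapSum fun i => (μ i).im / 2)) := by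
  obtain ⟨C₀₁, hC₀₁, h₀₁⟩ := exists_norm_inv_Gamma_half_le (η 0 - η 1)
  obtain ⟨C₁₂, hC₁₂, h₁₂⟩ := exists_norm_inv_Gamma_half_le (η 1 - η 2)
  obtain ⟨C₀₂, hC₀₂, h₀₂⟩ := exists_norm_inv_Gamma_half_le (η 0 - η 2)
  refine ⟨C₀₁ * C₁₂ * C₀₂, by positivity, fun μ hμ => ?_⟩
  have hre (i j : Fin 3) : (μ i - μ j).re = η i - η j := by rw [Complex.sub_re, hμ, hμ]
  have hprod := mul_le_mul (mul_le_mul (h₀₁ (μ 0 - μ 1) (hre 0 1)) (h₁₂ (μ 1 - μ 2) (hre 1 2))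
    (norm_nonneg _) (by positivity)) (h₀₂ (μ 0 - μ 2) (hre 0 2)) (norm_nonneg _) (by positivity)
  simp only [gammaFactor, norm_mul, add_sub_assoc]
  refine hprod.trans_eq ?_
  simp only [LambdaPoly, Mpoly, gapSum, hre, ← sub_div, ← Complex.sub_im, mul_add, Real.exp_add]
  field_simp

/-! ### The Mellin–Barnes integral -/

/-- Lebesgue measure on the positive half line. -/
abbrev posMeas : Measure ℝ := volume.restrict (Set.Ioi 0)

lemma ae_posMeas_pos : ∀ᵐ v ∂posMeas, 0 < v := ae_restrict_mem measurableSet_Ioi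

lemma integrable_rpow_mul_exp {a r : ℝ} (ha : 0 < a) (hr : 0 < r) :
    Integrable (fun t : ℝ => t ^ (a - 1) * Real.exp (-(r * t))) posMeas := by
  simpa using! integrableOn_rpow_mul_exp_neg_mul_rpow (by linarith : -1 < a - 1) one_pos hr

lemma integral_cpow_mul_exp {a : ℂ} {r : ℝ} (ha : 0 < a.re) (hr : 0 < r) :
    ∫ t : ℝ, (t : ℂ) ^ (a - 1) * Complex.exp (-(r * t)) ∂posMeas =
      (r : ℂ) ^ (-a) * Complex.Gamma a := by
  rw [Complex.integral_cpow_mul_exp_neg_mul_Ioi ha hr, one_div, Complex.inv_cpow,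
    ← Complex.cpow_neg]
  rw [Complex.arg_ofReal_of_nonneg hr.le]
  exact Real.pi_pos.ne

lemma continuous_Gamma_vertical {x : ℝ} (hx : 0 < x) :
    Continuous fun y : ℝ => Complex.Gamma (x + y * I) :=
  continuous_iff_continuousAt.2 fun y =>
    (Complex.continuousAt_Gamma _ fun m h => by
      have hre : x = -m := by simpa using congrArg Complex.re h
      linarith [m.cast_nonneg (α := ℝ)]).comp
        (f := fun y : ℝ => (x + y * I : ℂ)) (by fun_prop)

lemma exists_norm_Gamma_le_decayWeight {x : ℝ} (hx : 0 < x) :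
    ∃ C : ℝ, 0 < C ∧ ∀ y : ℝ, ‖Complex.Gamma (x + y * I)‖ ≤ C * decayWeight 1 y := by
  obtain ⟨C, hC, hΓ⟩ := exists_norm_Gamma_le hx
  obtain ⟨D, hD⟩ := exists_mul_logBracket_le (N := x + 2) (by positivity)
  refine ⟨C * Real.exp D, by positivity, fun y => (hΓ y).trans ?_⟩
  rw [mul_assoc, stirlingLog, decayWeight, ← Real.exp_add]
  refine mul_le_mul_of_nonneg_left (Real.exp_le_exp.2 ?_) hC.le
  linarith [hD y, logBracket_nonneg y]

lemma exists_norm_Gamma_vertical_le {x : ℝ} (hx : 0 < x) :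
    ∃ C : ℝ, ∀ y : ℝ, ‖Complex.Gamma (x + y * I)‖ ≤ C := by
  obtain ⟨C, hC, hΓ⟩ := exists_norm_Gamma_le_decayWeight hx
  refine ⟨C, fun y => (hΓ y).trans (mul_le_of_le_one_right hC.le ?_)⟩
  rw [decayWeight, Real.exp_le_one_iff]
  linarith [logBracket_nonneg y]

lemma integrable_Gamma_vertical {x : ℝ} (hx : 0 < x) :
    Integrable fun y : ℝ => Complex.Gamma (x + y * I) := by
  obtain ⟨C, -, hΓ⟩ := exists_norm_Gamma_le_decayWeight hx
  exact ((integrable_decayWeight one_pos).const_mul C).mono'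
    (continuous_Gamma_vertical hx).aestronglyMeasurable (Eventually.of_forall hΓ)

lemma exp_neg_eq_mellinInv {σ X : ℝ} (hσ : 0 < σ) (hX : 0 < X) :
    (Real.exp (-X) : ℂ) = (1 / (2 * π) : ℝ) *
      ∫ y : ℝ, (X : ℂ) ^ (-(σ + y * I)) * Complex.Gamma (σ + y * I) := by
  have hmellin {s : ℂ} (hs : 0 < s.re) :
      mellin (fun x : ℝ => (Real.exp (-x) : ℂ)) s = Complex.Gamma s := by
    rw [Complex.Gamma_eq_integral hs, Complex.GammaIntegral_eq_mellin]
  have hconv : MellinConvergent (fun x : ℝ => (Real.exp (-x) : ℂ)) σ :=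
    (Complex.GammaIntegral_convergent (s := σ) (by simpa)).congr_fun
      (fun x _ => by simp [mul_comm]) measurableSet_Ioi
  have hvert : Complex.VerticalIntegrable (mellin fun x : ℝ => (Real.exp (-x) : ℂ)) σ :=
    (integrable_Gamma_vertical hσ).congr (Eventually.of_forall fun y => (hmellin (by simpa)).symm)
  rw [← mellinInv_mellin_eq σ (fun x : ℝ => (Real.exp (-x) : ℂ)) hX hconv hvert (by fun_prop),
    mellinInv, Complex.real_smul]
  congr 1
  refine integral_congr_ae (Eventually.of_forall fun y => ?_)
  simp only [smul_eq_mul]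
  rw [hmellin (by simpa)]

/-- The Bessel-type integral `∫ m ^ (z - 1) exp (-A m - B / m) dm` over the half line. -/
def besselInt (z : ℂ) (A B : ℝ) : ℂ :=
  ∫ m : ℝ, (m : ℂ) ^ (z - 1) * (Real.exp (-(A * m + B / m)) : ℂ) ∂posMeas

section BesselMellinBarnes

/-- The integrand of `besselInt z A B` after expanding `exp (-B / m)` by Mellin inversion along the
line `Re = σ`. -/
def besselKernel (z : ℂ) (A B σ m y : ℝ) : ℂ :=
  (m : ℂ) ^ (z + (σ + y * I) - 1) * Complex.exp (-(A * m)) *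
    (Complex.Gamma (σ + y * I) * (B : ℂ) ^ (-(σ + y * I)))

variable {z : ℂ} {A B σ : ℝ}

lemma besselInt_eq_integral_besselKernel (hB : 0 < B) (hσ : 0 < σ) :
    besselInt z A B = (1 / (2 * π) : ℝ) * ∫ m, (∫ y, besselKernel z A B σ m y) ∂posMeas := by
  rw [← integral_const_mul]
  refine integral_congr_ae ?_
  filter_upwards [ae_posMeas_pos] with m hm
  have hm₀ : (m : ℂ) ≠ 0 := Complex.ofReal_ne_zero.2 hm.ne'
  rw [neg_add, Real.exp_add, Complex.ofReal_mul, exp_neg_eq_mellinInv hσ (div_pos hB hm),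
    mul_left_comm _ (_ : ℂ) (∫ _, _), mul_left_comm, ← integral_const_mul, ← integral_const_mul]
  congr 1
  refine integral_congr_ae (Eventually.of_forall fun y => ?_)
  have hpow : (m : ℂ) ^ (σ + y * I) ≠ 0 := by simp [Complex.cpow_eq_zero_iff, hm₀]
  simp only [besselKernel]
  rw [Complex.ofReal_div, Complex.div_cpow_ofReal_nonneg hB.le hm.le, add_sub_right_comm,
    Complex.cpow_add _ _ hm₀, Complex.cpow_neg (m : ℂ) (_ + _)]
  push_cast
  field_simp

lemma integrable_besselKernel (hA : 0 < A) (hB : 0 < B) (hσ : 0 < σ) (hσz : 0 < σ + z.re) :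
    Integrable (Function.uncurry (besselKernel z A B σ)) (posMeas.prod volume) := by
  refine ((integrable_rpow_mul_exp hσz hA).mul_prod
    ((integrable_Gamma_vertical hσ).norm.mul_const (B ^ (-σ)))).mono' ?_ ?_
  · have hΓ : Measurable fun p : ℝ × ℝ => Complex.Gamma (σ + p.2 * I) :=
      (continuous_Gamma_vertical hσ).measurable.comp measurable_snd
    exact Measurable.aestronglyMeasurable
      (Measurable.mul (by fun_prop) (Measurable.mul hΓ (by fun_prop)))
  · have hpos : ∀ᵐ p : ℝ × ℝ ∂(posMeas.prod volume), 0 < p.1 :=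
      Measure.quasiMeasurePreserving_fst.ae ae_posMeas_pos
    filter_upwards [hpos] with p hp
    simp only [Function.uncurry, besselKernel, norm_mul]
    rw [Complex.norm_cpow_eq_rpow_re_of_pos hp, Complex.norm_cpow_eq_rpow_re_of_pos hB,
      Complex.norm_exp, add_comm σ]
    simp

lemma besselInt_eq_mellinBarnes (hA : 0 < A) (hB : 0 < B) (hσ : 0 < σ) (hσz : 0 < σ + z.re) :
    besselInt z A B = (1 / (2 * π) : ℝ) * ∫ y : ℝ, Complex.Gamma (σ + y * I) *
      Complex.Gamma (z + (σ + y * I)) * (A : ℂ) ^ (-(z + (σ + y * I))) *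
      (B : ℂ) ^ (-(σ + y * I)) := by
  rw [besselInt_eq_integral_besselKernel hB hσ,
    integral_integral_swap (integrable_besselKernel hA hB hσ hσz)]
  congr 1
  refine integral_congr_ae (Eventually.of_forall fun y => ?_)
  simp only [besselKernel]
  rw [integral_mul_const, integral_cpow_mul_exp (by simpa [add_comm] using hσz) hA]
  ring

end BesselMellinBarnes

section Beta

/-- Integrating over `t` gives the beta integrand `v ^ (p - 1) (1 + v) ^ (-(p + q))` times
`Γ(p + q)`; integrating over `v` first gives `Γ(p)` times the integrand of `Γ(q)`. -/
def betaKernel (p q : ℂ) (v t : ℝ) : ℂ :=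
  (v : ℂ) ^ (p - 1) * ((t : ℂ) ^ (p + q - 1) * Complex.exp (-(((1 + v : ℝ) : ℂ) * t)))

variable {p q : ℂ}

lemma measurable_betaKernel : Measurable (Function.uncurry (betaKernel p q)) := by
  unfold Function.uncurry betaKernel
  fun_prop

lemma norm_betaKernel {v t : ℝ} (hv : 0 < v) (ht : 0 < t) : ‖betaKernel p q v t‖ =
    v ^ (p.re - 1) * Real.exp (-(t * v)) * (t ^ (p.re + q.re - 1) * Real.exp (-t)) := by
  have hre : (-(((1 + v : ℝ) : ℂ) * t)).re = -(t * v) + -t := by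
    rw [← Complex.ofReal_mul, Complex.neg_re, Complex.ofReal_re]
    ring
  rw [betaKernel, norm_mul, norm_mul, Complex.norm_cpow_eq_rpow_re_of_pos hv,
    Complex.norm_cpow_eq_rpow_re_of_pos ht, Complex.norm_exp, hre, Real.exp_add]
  simp only [Complex.sub_re, Complex.add_re, Complex.one_re]
  ring

lemma integrable_betaKernel (hp : 0 < p.re) (hq : 0 < q.re) :
    Integrable (Function.uncurry (betaKernel p q)) (posMeas.prod posMeas) := by
  rw [integrable_prod_iff' measurable_betaKernel.aestronglyMeasurable]
  constructor
  · filter_upwards [ae_posMeas_pos] with t ht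
    refine ((integrable_rpow_mul_exp hp ht).mul_const
      (t ^ (p.re + q.re - 1) * Real.exp (-t))).mono' (measurable_betaKernel.comp
        measurable_prodMk_right).aestronglyMeasurable ?_
    filter_upwards [ae_posMeas_pos] with v hv
    exact (norm_betaKernel hv ht).le
  · refine ((integrable_rpow_mul_exp hq one_pos).const_mul (Real.Gamma p.re)).congr ?_
    filter_upwards [ae_posMeas_pos] with t ht
    have hnorm : ∫ v, ‖betaKernel p q v t‖ ∂posMeas = ∫ v, v ^ (p.re - 1) * Real.exp (-(t * v)) *
        (t ^ (p.re + q.re - 1) * Real.exp (-t)) ∂posMeas :=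
      integral_congr_ae (by
        filter_upwards [ae_posMeas_pos] with v hv using norm_betaKernel hv ht)
    have hpow : t ^ p.re ≠ 0 := (Real.rpow_pos_of_pos ht _).ne'
    simp only [Function.uncurry]
    rw [hnorm, integral_mul_const, Real.integral_rpow_mul_exp_neg_mul_Ioi hp ht, add_sub_assoc,
      Real.rpow_add ht, one_div, Real.inv_rpow ht.le]
    field_simp

lemma integral_betaKernel_left (hp : 0 < p.re) (hq : 0 < q.re) {v : ℝ} (hv : 0 < v) :
    ∫ t, betaKernel p q v t ∂posMeas =
      Complex.Gamma (p + q) * ((v : ℂ) ^ (p - 1) * ((1 + v : ℝ) : ℂ) ^ (-(p + q))) := by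
  simp only [betaKernel]
  rw [integral_const_mul, integral_cpow_mul_exp (by rw [Complex.add_re]; positivity)
    (by positivity : 0 < 1 + v)]
  ring

lemma integral_betaKernel_right (hp : 0 < p.re) {t : ℝ} (ht : 0 < t) :
    ∫ v, betaKernel p q v t ∂posMeas =
      Complex.Gamma p * (Complex.exp (-t) * (t : ℂ) ^ (q - 1)) := by
  have hsplit (v : ℝ) : betaKernel p q v t = (v : ℂ) ^ (p - 1) * Complex.exp (-(t * v)) *
      ((t : ℂ) ^ (p + q - 1) * Complex.exp (-t)) := by
    rw [betaKernel, show -(((1 + v : ℝ) : ℂ) * t) = -(t * v) + -t by push_cast; ring,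
      Complex.exp_add]
    ring
  have ht₀ : (t : ℂ) ≠ 0 := Complex.ofReal_ne_zero.2 ht.ne'
  have hpow : (t : ℂ) ^ p ≠ 0 := by simp [Complex.cpow_eq_zero_iff, ht₀]
  simp only [hsplit]
  rw [integral_mul_const, integral_cpow_mul_exp hp ht, add_sub_assoc, Complex.cpow_add _ _ ht₀,
    Complex.cpow_neg]
  field_simp

lemma integral_beta (hp : 0 < p.re) (hq : 0 < q.re) :
    ∫ v : ℝ, (v : ℂ) ^ (p - 1) * ((1 + v : ℝ) : ℂ) ^ (-(p + q)) ∂posMeas =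
      Complex.Gamma p * Complex.Gamma q * (Complex.Gamma (p + q))⁻¹ := by
  have hΓ : Complex.Gamma (p + q) ≠ 0 :=
    Complex.Gamma_ne_zero_of_re_pos (by rw [Complex.add_re]; positivity)
  have hleft : ∫ v, ∫ t, betaKernel p q v t ∂posMeas ∂posMeas = Complex.Gamma (p + q) *
      ∫ v : ℝ, (v : ℂ) ^ (p - 1) * ((1 + v : ℝ) : ℂ) ^ (-(p + q)) ∂posMeas := by
    rw [← integral_const_mul]
    refine integral_congr_ae ?_
    filter_upwards [ae_posMeas_pos] with v hv using integral_betaKernel_left hp hq hv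
  have hright : ∫ t, ∫ v, betaKernel p q v t ∂posMeas ∂posMeas =
      Complex.Gamma p * Complex.Gamma q := by
    rw [Complex.Gamma_eq_integral hq, Complex.GammaIntegral, ← integral_const_mul]
    refine integral_congr_ae ?_
    filter_upwards [ae_posMeas_pos] with t ht
    rw [integral_betaKernel_right hp ht]
    push_cast
    rfl
  rw [eq_mul_inv_iff_mul_eq₀ hΓ, mul_comm, ← hleft, ← hright]
  exact integral_integral_swap (integrable_betaKernel hp hq)

lemma integrable_beta {p q : ℝ} (hp : 0 < p) (hq : 0 < q) :
    Integrable (fun v : ℝ => v ^ (p - 1) * (1 + v) ^ (-(p + q))) posMeas := by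
  have hΓ : Complex.Gamma (p + q) ≠ 0 :=
    Complex.Gamma_ne_zero_of_re_pos (by rw [Complex.add_re]; simpa using by positivity)
  have hint := (integrable_betaKernel (p := p) (q := q) (by simpa) (by simpa)).integral_prod_left
  refine (hint.const_mul (Complex.Gamma (p + q))⁻¹).norm.congr ?_
  filter_upwards [ae_posMeas_pos] with v hv
  simp only [Function.uncurry]
  rw [integral_betaKernel_left (by simpa) (by simpa) hv, inv_mul_cancel_left₀ hΓ, norm_mul,
    Complex.norm_cpow_eq_rpow_re_of_pos hv, Complex.norm_cpow_eq_rpow_re_of_pos (by linarith)]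
  simp

end Beta

/-- Lebesgue measure on the positive octant. -/
abbrev octMeas : Measure (ℝ × ℝ × ℝ) := posMeas.prod (posMeas.prod posMeas)

lemma ae_octMeas_pos : ∀ᵐ p ∂octMeas, 0 < p.1 ∧ 0 < p.2.1 ∧ 0 < p.2.2 := by
  have hquadrant : ∀ᵐ q : ℝ × ℝ ∂(posMeas.prod posMeas), 0 < q.1 ∧ 0 < q.2 :=
    (Measure.quasiMeasurePreserving_fst.ae ae_posMeas_pos).and
      (Measure.quasiMeasurePreserving_snd.ae ae_posMeas_pos)
  exact (Measure.quasiMeasurePreserving_fst.ae ae_posMeas_pos).and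
    (Measure.quasiMeasurePreserving_snd.ae hquadrant)

/-- The exponential factor of the integrand of `tripleInt`, in the variables `p = (v, m, w)`. For
fixed `v` it is the product of the exponential factors of two integrals `besselInt`. -/
def tripleKernel (y p : ℝ × ℝ × ℝ) : ℝ :=
  Real.exp (-(1 * p.2.1 + y.2.1 * (1 + p.1) / p.2.1)) *
    Real.exp (-(y.1 * (1 + p.1) * p.2.2 + y.2.2 / p.1 / p.2.2))

lemma tripleKernel_nonneg (y p : ℝ × ℝ × ℝ) : 0 ≤ tripleKernel y p :=
  mul_nonneg (Real.exp_pos _).le (Real.exp_pos _).le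

lemma measurable_tripleKernel : Measurable (Function.uncurry tripleKernel) := by
  unfold tripleKernel Function.uncurry
  fun_prop

/-- The triple integral `∫ v ^ (x - 1) (m w) ^ (z - 1) tripleKernel y (v, m, w)` over the positive
octant; up to elementary factors it is the Jacquet-Whittaker function when `y` stands for
`(y₁², π² y₂², π²)`. -/
def tripleInt (y : ℝ × ℝ × ℝ) (x z : ℂ) : ℂ :=
  ∫ p : ℝ × ℝ × ℝ, (p.1 : ℂ) ^ (x - 1) * ((p.2.1 : ℂ) ^ (z - 1) * (p.2.2 : ℂ) ^ (z - 1)) *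
    (tripleKernel y p : ℂ) ∂octMeas

lemma exists_exp_neg_le_rpow {N : ℝ} (hN : 0 ≤ N) :
    ∃ C : ℝ, 0 < C ∧ ∀ X : ℝ, 0 < X → Real.exp (-X) ≤ C * X ^ (-N) := by
  refine ⟨(N + 1) ^ N, by positivity, fun X hX => ?_⟩
  have hlog := mul_le_mul_of_nonneg_left
    (Real.log_le_sub_one_of_pos (by positivity : 0 < X / (N + 1))) hN
  have hlinear : N * (X / (N + 1) - 1) ≤ X := by
    rw [div_sub_one (by positivity), mul_div_assoc', div_le_iff₀ (by positivity)]
    nlinarith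
  rw [Real.log_div hX.ne' (by positivity)] at hlog
  rw [Real.rpow_def_of_pos hX, Real.rpow_def_of_pos (by positivity : 0 < N + 1),
    ← Real.exp_add, Real.exp_le_exp]
  linarith

section TripleInt

variable {y : ℝ × ℝ × ℝ}

lemma exists_tripleKernel_le (hy₁ : 0 < y.1) (hy₂ : 0 < y.2.1) (hy₃ : 0 < y.2.2) {s t : ℝ}
    (hs : 0 ≤ s) (ht : 0 ≤ t) : ∃ C : ℝ, ∀ p : ℝ × ℝ × ℝ, 0 < p.1 → 0 < p.2.1 → 0 < p.2.2 →
      tripleKernel y p ≤ C * ((p.1 ^ s * (1 + p.1) ^ (-t)) *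
        ((p.2.1 ^ t * Real.exp (-(1 * p.2.1))) * (p.2.2 ^ s * Real.exp (-(y.1 * p.2.2))))) := by
  obtain ⟨C, _, hs'⟩ := exists_exp_neg_le_rpow hs
  obtain ⟨D, hD, ht'⟩ := exists_exp_neg_le_rpow ht
  refine ⟨C * y.2.2 ^ (-s) * (D * y.2.1 ^ (-t)), fun p hv hm hw => ?_⟩
  have hv' : 0 < 1 + p.1 := by linarith
  have hm_exp := ht' (y.2.1 * (1 + p.1) / p.2.1) (by positivity)
  have hw_exp := hs' (y.2.2 / p.1 / p.2.2) (by positivity)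
  rw [Real.div_rpow (by positivity) hm.le, Real.mul_rpow hy₂.le hv'.le, Real.rpow_neg hm.le,
    div_inv_eq_mul] at hm_exp
  rw [Real.div_rpow (by positivity) hw.le, Real.div_rpow hy₃.le hv.le, Real.rpow_neg hv.le,
    Real.rpow_neg hw.le, div_inv_eq_mul, div_inv_eq_mul] at hw_exp
  have hexp : Real.exp (-(y.1 * (1 + p.1) * p.2.2)) ≤ Real.exp (-(y.1 * p.2.2)) :=
    Real.exp_le_exp.2 (by nlinarith [mul_pos (mul_pos hy₁ hv) hw])
  rw [tripleKernel, neg_add, neg_add, Real.exp_add, Real.exp_add]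
  calc _ ≤ Real.exp (-(1 * p.2.1)) * (D * (y.2.1 ^ (-t) * (1 + p.1) ^ (-t) * p.2.1 ^ t)) *
        (Real.exp (-(y.1 * p.2.2)) * (C * (y.2.2 ^ (-s) * p.1 ^ s * p.2.2 ^ s))) := by gcongr
    _ = _ := by ring

lemma integrable_rpow_mul_tripleKernel (hy₁ : 0 < y.1) (hy₂ : 0 < y.2.1) (hy₃ : 0 < y.2.2)
    (x z : ℝ) : Integrable (fun p : ℝ × ℝ × ℝ => p.1 ^ (x - 1) * (p.2.1 ^ (z - 1) *
      p.2.2 ^ (z - 1)) * tripleKernel y p) octMeas := by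
  obtain ⟨s, hs, hxs, hzs⟩ : ∃ s : ℝ, 0 < s ∧ 0 < x + s ∧ 0 < z + s :=
    ⟨|x| + |z| + 1, by positivity, by linarith [neg_abs_le x, abs_nonneg z],
      by linarith [neg_abs_le z, abs_nonneg x]⟩
  obtain ⟨C, hC⟩ := exists_tripleKernel_le hy₁ hy₂ hy₃ hs.le (by positivity : 0 ≤ x + s + s)
  refine (((integrable_beta hxs hs).mul_prod
    ((integrable_rpow_mul_exp (by linarith : 0 < z + (x + s + s)) one_pos).mul_prod
      (integrable_rpow_mul_exp hzs hy₁))).const_mul C).mono' ?_ ?_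
  · exact Measurable.aestronglyMeasurable (Measurable.mul (by fun_prop)
      (measurable_tripleKernel.comp measurable_prodMk_left))
  filter_upwards [ae_octMeas_pos] with p ⟨hv, hm, hw⟩
  have hkernel := tripleKernel_nonneg y p
  rw [Real.norm_of_nonneg (by positivity), add_sub_right_comm, add_sub_right_comm,
    add_sub_right_comm, Real.rpow_add hv, Real.rpow_add hm, Real.rpow_add hw]
  refine (mul_le_mul_of_nonneg_left (hC p hv hm hw) (by positivity)).trans_eq ?_
  ring

lemma integrable_tripleInt (hy₁ : 0 < y.1) (hy₂ : 0 < y.2.1) (hy₃ : 0 < y.2.2) (x z : ℂ) :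
    Integrable (fun p : ℝ × ℝ × ℝ => (p.1 : ℂ) ^ (x - 1) * ((p.2.1 : ℂ) ^ (z - 1) *
      (p.2.2 : ℂ) ^ (z - 1)) * (tripleKernel y p : ℂ)) octMeas := by
  refine (integrable_rpow_mul_tripleKernel hy₁ hy₂ hy₃ x.re z.re).mono' ?_ ?_
  · have hkernel : Measurable (tripleKernel y) :=
      measurable_tripleKernel.comp measurable_prodMk_left
    exact Measurable.aestronglyMeasurable (Measurable.mul (by fun_prop) hkernel.complex_ofReal)
  filter_upwards [ae_octMeas_pos] with p ⟨hv, hm, hw⟩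
  rw [norm_mul, norm_mul, norm_mul, Complex.norm_cpow_eq_rpow_re_of_pos hv,
    Complex.norm_cpow_eq_rpow_re_of_pos hm, Complex.norm_cpow_eq_rpow_re_of_pos hw,
    Complex.norm_real, Real.norm_of_nonneg (tripleKernel_nonneg y p)]
  simp only [Complex.sub_re, Complex.one_re, le_refl]

lemma stronglyMeasurable_tripleInt (x z : ℂ) :
    StronglyMeasurable fun y : ℝ × ℝ × ℝ => tripleInt y x z := by
  refine StronglyMeasurable.integral_prod_right' (f := fun q : (ℝ × ℝ × ℝ) × (ℝ × ℝ × ℝ) =>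
    (q.2.1 : ℂ) ^ (x - 1) * ((q.2.2.1 : ℂ) ^ (z - 1) * (q.2.2.2 : ℂ) ^ (z - 1)) *
    (tripleKernel q.1 q.2 : ℂ)) ?_
  exact (Measurable.mul (by fun_prop) measurable_tripleKernel.complex_ofReal).stronglyMeasurable

lemma tripleInt_eq_integral_besselInt (hy₁ : 0 < y.1) (hy₂ : 0 < y.2.1) (hy₃ : 0 < y.2.2)
    (x z : ℂ) : tripleInt y x z = ∫ v : ℝ, (v : ℂ) ^ (x - 1) *
      (besselInt z 1 (y.2.1 * (1 + v)) * besselInt z (y.1 * (1 + v)) (y.2.2 / v)) ∂posMeas := by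
  rw [tripleInt, integral_prod _ (integrable_tripleInt hy₁ hy₂ hy₃ x z)]
  refine integral_congr_ae (Eventually.of_forall fun v => ?_)
  simp only [besselInt]
  rw [← integral_prod_mul, ← integral_const_mul]
  refine integral_congr_ae (Eventually.of_forall fun q => ?_)
  simp only [tripleKernel]
  push_cast
  ring

end TripleInt

/-- The factor of the Mellin–Barnes integrand of `tripleInt` (along the lines `Re = σ` and
`Re = σ'`) that does not depend on the variable `v` of `tripleKernel`. -/
def mbCoeff (y : ℝ × ℝ × ℝ) (z : ℂ) (σ σ' : ℝ) (p : ℝ × ℝ) : ℂ :=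
  ((y.2.1 : ℂ) ^ (-(σ' + p.2 * I)) * (y.1 : ℂ) ^ (-(z + (σ + p.1 * I))) *
    (y.2.2 : ℂ) ^ (-(σ + p.1 * I))) * (Complex.Gamma (σ + p.1 * I) *
      Complex.Gamma (z + (σ + p.1 * I)) * (Complex.Gamma (σ' + p.2 * I) *
      Complex.Gamma (z + (σ' + p.2 * I))))

/-- The factor of the Mellin–Barnes integrand of `tripleInt` that depends on the variable `v`; it is
a beta integrand. -/
def mbKernel (x z : ℂ) (σ σ' v : ℝ) (p : ℝ × ℝ) : ℂ :=
  (v : ℂ) ^ (x + (σ + p.1 * I) - 1) *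
    ((1 + v : ℝ) : ℂ) ^ (-(x + (σ + p.1 * I) + (z - x + (σ' + p.2 * I))))

section MellinBarnes

variable {y : ℝ × ℝ × ℝ} {x z : ℂ} {σ σ' : ℝ}

lemma besselInt_mul_besselInt (hy₁ : 0 < y.1) (hy₂ : 0 < y.2.1) (hy₃ : 0 < y.2.2) {v : ℝ}
    (hσ : 0 < σ) (hσ' : 0 < σ') (hσz : 0 < σ + z.re) (hσ'z : 0 < σ' + z.re) (hv : 0 < v) :
    (v : ℂ) ^ (x - 1) *
      (besselInt z 1 (y.2.1 * (1 + v)) * besselInt z (y.1 * (1 + v)) (y.2.2 / v)) =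
    ((1 / (2 * π) : ℝ) * (1 / (2 * π) : ℝ)) *
      ∫ p : ℝ × ℝ, mbKernel x z σ σ' v p * mbCoeff y z σ σ' p := by
  have hv' : 0 < 1 + v := by linarith
  have hv₀ : (v : ℂ) ≠ 0 := Complex.ofReal_ne_zero.2 hv.ne'
  have hv₀' : ((1 + v : ℝ) : ℂ) ≠ 0 := Complex.ofReal_ne_zero.2 hv'.ne'
  rw [besselInt_eq_mellinBarnes one_pos (by positivity) hσ' hσ'z,
    besselInt_eq_mellinBarnes (by positivity) (by positivity) hσ hσz, mul_mul_mul_comm,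
    mul_left_comm, mul_comm (∫ _, _) (∫ _, _), ← integral_prod_mul, ← integral_const_mul]
  congr 1
  refine integral_congr_ae (Eventually.of_forall fun p => ?_)
  simp only [mbKernel, mbCoeff]
  rw [Complex.ofReal_one, Complex.one_cpow, Complex.ofReal_mul y.1,
    Complex.mul_cpow_ofReal_nonneg hy₁.le hv'.le, Complex.ofReal_mul y.2.1,
    Complex.mul_cpow_ofReal_nonneg hy₂.le hv'.le, Complex.ofReal_div,
    Complex.div_cpow_ofReal_nonneg hy₃.le hv.le, add_sub_right_comm x,
    show -(x + (σ + p.1 * I) + (z - x + (σ' + p.2 * I))) =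
      -(z + (σ + p.1 * I)) + -(σ' + p.2 * I) by ring,
    Complex.cpow_add _ _ hv₀, Complex.cpow_add _ _ hv₀', Complex.cpow_neg (v : ℂ),
    div_inv_eq_mul]
  ring

lemma add_vertical_eq (z : ℂ) (σ t : ℝ) :
    z + (σ + t * I) = ((σ + z.re : ℝ) : ℂ) + ((t + z.im : ℝ) : ℂ) * I := by
  conv_lhs => rw [← Complex.re_add_im z]
  push_cast
  ring

lemma measurable_mbCoeff (hσ : 0 < σ) (hσ' : 0 < σ') (hσz : 0 < σ + z.re)
    (hσ'z : 0 < σ' + z.re) : Measurable (mbCoeff y z σ σ') := by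
  have hΓ {τ : ℝ} (hτ : 0 < τ) {f : ℝ × ℝ → ℝ} (hf : Measurable f) :
      Measurable fun p => Complex.Gamma (τ + f p * I) :=
    (continuous_Gamma_vertical hτ).measurable.comp hf
  unfold mbCoeff
  simp only [add_vertical_eq z]
  exact Measurable.mul (by fun_prop) (Measurable.mul
    (Measurable.mul (hΓ hσ (by fun_prop)) (hΓ hσz (by fun_prop)))
    (Measurable.mul (hΓ hσ' (by fun_prop)) (hΓ hσ'z (by fun_prop))))

lemma integrable_mbCoeff (hy₁ : 0 < y.1) (hy₂ : 0 < y.2.1) (hy₃ : 0 < y.2.2) (hσ : 0 < σ)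
    (hσ' : 0 < σ') (hσz : 0 < σ + z.re) (hσ'z : 0 < σ' + z.re) :
    Integrable (mbCoeff y z σ σ') := by
  obtain ⟨A, hA⟩ := exists_norm_Gamma_vertical_le hσz
  obtain ⟨B, hB⟩ := exists_norm_Gamma_vertical_le hσ'z
  refine (((integrable_Gamma_vertical hσ).norm.mul_prod
    (integrable_Gamma_vertical hσ').norm).const_mul
      ((y.2.1 ^ (-σ') * y.1 ^ (-(z.re + σ)) * y.2.2 ^ (-σ)) * (A * B))).mono'
    (measurable_mbCoeff hσ hσ' hσz hσ'z).aestronglyMeasurable (Eventually.of_forall fun q => ?_)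
  have hA' := hA (q.1 + z.im)
  have hB' := hB (q.2 + z.im)
  rw [← add_vertical_eq] at hA' hB'
  have hA₀ := (norm_nonneg _).trans hA'
  have hre (τ t : ℝ) : (-(τ + t * I) : ℂ).re = -τ := by simp
  have hre' : (-(z + (σ + q.1 * I))).re = -(z.re + σ) := by simp
  simp only [mbCoeff, norm_mul]
  rw [Complex.norm_cpow_eq_rpow_re_of_pos hy₁, Complex.norm_cpow_eq_rpow_re_of_pos hy₂,
    Complex.norm_cpow_eq_rpow_re_of_pos hy₃, hre, hre, hre', mul_assoc (_ * _ * _) (A * B)]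
  refine mul_le_mul_of_nonneg_left ?_ (by positivity)
  calc _ ≤ ‖Complex.Gamma (σ + q.1 * I)‖ * A * (‖Complex.Gamma (σ' + q.2 * I)‖ * B) := by gcongr
    _ = _ := by ring

lemma integrable_mbKernel_mul_mbCoeff (hy₁ : 0 < y.1) (hy₂ : 0 < y.2.1) (hy₃ : 0 < y.2.2)
    (hσ : 0 < σ) (hσ' : 0 < σ') (hσz : 0 < σ + z.re) (hσ'z : 0 < σ' + z.re)
    (hσx : 0 < σ + x.re) (hσ'x : 0 < σ' + (z.re - x.re)) :
    Integrable (Function.uncurry fun v p => mbKernel x z σ σ' v p * mbCoeff y z σ σ' p)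
      (posMeas.prod (volume : Measure (ℝ × ℝ))) := by
  refine ((integrable_beta hσx hσ'x).mul_prod
    (integrable_mbCoeff hy₁ hy₂ hy₃ hσ hσ' hσz hσ'z).norm).mono' ?_ ?_
  · refine Measurable.aestronglyMeasurable (Measurable.mul ?_
      ((measurable_mbCoeff hσ hσ' hσz hσ'z).comp measurable_snd))
    unfold mbKernel
    fun_prop
  · have hpos : ∀ᵐ q : ℝ × ℝ × ℝ ∂(posMeas.prod volume), 0 < q.1 :=
      Measure.quasiMeasurePreserving_fst.ae ae_posMeas_pos
    filter_upwards [hpos] with q hv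
    have hre : (x + (σ + q.2.1 * I) - 1).re = σ + x.re - 1 := by
      simp
      ring
    have hre' : (-(x + (σ + q.2.1 * I) + (z - x + (σ' + q.2.2 * I)))).re =
        -(σ + x.re + (σ' + (z.re - x.re))) := by
      simp
      ring
    simp only [mbKernel, Function.uncurry, norm_mul]
    rw [Complex.norm_cpow_eq_rpow_re_of_pos hv,
      Complex.norm_cpow_eq_rpow_re_of_pos (by linarith : 0 < 1 + q.1), hre, hre']

lemma tripleInt_eq_mellinBarnes (hy₁ : 0 < y.1) (hy₂ : 0 < y.2.1) (hy₃ : 0 < y.2.2)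
    (hσ : 0 < σ) (hσ' : 0 < σ') (hσz : 0 < σ + z.re) (hσ'z : 0 < σ' + z.re)
    (hσx : 0 < σ + x.re) (hσ'x : 0 < σ' + (z.re - x.re)) :
    tripleInt y x z = ((1 / (2 * π) : ℝ) * (1 / (2 * π) : ℝ)) * ∫ p : ℝ × ℝ,
      Complex.Gamma (x + (σ + p.1 * I)) * Complex.Gamma (z - x + (σ' + p.2 * I)) *
      (Complex.Gamma (z + (σ + p.1 * I) + (σ' + p.2 * I)))⁻¹ * mbCoeff y z σ σ' p := by
  have hexpand : tripleInt y x z = ((1 / (2 * π) : ℝ) * (1 / (2 * π) : ℝ)) *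
      ∫ v, (∫ p : ℝ × ℝ, mbKernel x z σ σ' v p * mbCoeff y z σ σ' p) ∂posMeas := by
    rw [tripleInt_eq_integral_besselInt hy₁ hy₂ hy₃, ← integral_const_mul]
    refine integral_congr_ae ?_
    filter_upwards [ae_posMeas_pos] with v hv
    exact besselInt_mul_besselInt hy₁ hy₂ hy₃ hσ hσ' hσz hσ'z hv
  rw [hexpand, integral_integral_swap
    (integrable_mbKernel_mul_mbCoeff hy₁ hy₂ hy₃ hσ hσ' hσz hσ'z hσx hσ'x)]
  congr 1
  refine integral_congr_ae (Eventually.of_forall fun p => ?_)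
  simp only [mbKernel]
  rw [integral_mul_const, integral_beta (by simp; linarith) (by simp; linarith),
    show x + (σ + p.1 * I) + (z - x + (σ' + p.2 * I)) = z + (σ + p.1 * I) + (σ' + p.2 * I) by ring]

end MellinBarnes

section ExponentialFamily

lemma exp_add_abs_add_abs_le (x u v : ℝ) :
    Real.exp (x + |u| + |v|) ≤
      Real.exp (x + u + v) + Real.exp (x + u - v) +
        (Real.exp (x - u + v) + Real.exp (x - u - v)) := by
  have hexp_abs (t : ℝ) : Real.exp |t| ≤ Real.exp t + Real.exp (-t) := by
    rcases abs_cases t with ⟨ht, -⟩ | ⟨ht, -⟩ <;> rw [ht]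
    · linarith [Real.exp_pos (-t)]
    · linarith [Real.exp_pos t]
  calc Real.exp (x + |u| + |v|) = Real.exp x * (Real.exp |u| * Real.exp |v|) := by
        rw [← Real.exp_add, ← Real.exp_add, add_assoc]
    _ ≤ Real.exp x * ((Real.exp u + Real.exp (-u)) * (Real.exp v + Real.exp (-v))) := by
        gcongr <;> exact hexp_abs _
    _ = _ := by simp only [sub_eq_add_neg, Real.exp_add]; ring

lemma norm_smul_fst_add_smul_snd_le (a b : ℝ) :
    ‖(a : ℂ) • ContinuousLinearMap.fst ℂ ℂ ℂ + (b : ℂ) • ContinuousLinearMap.snd ℂ ℂ ℂ‖ ≤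
      |a| + |b| := by
  refine (norm_add_le _ _).trans (add_le_add ?_ ?_) <;>
    rw [norm_smul, Complex.norm_real, Real.norm_eq_abs]
  · exact mul_le_of_le_one_right (abs_nonneg a) (ContinuousLinearMap.norm_fst_le ℂ ℂ ℂ)
  · exact mul_le_of_le_one_right (abs_nonneg b) (ContinuousLinearMap.norm_snd_le ℂ ℂ ℂ)

lemma exp_mul_abs_add_abs_le_of_norm_sub_le {z z₀ : ℂ × ℂ} (hz : ‖z - z₀‖ ≤ 1) (A B : ℝ) :
    Real.exp (z.1.re * A + z.2.re * B) * (|A| + |B|) ≤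
      Real.exp ((z₀.1.re + 2) * A + (z₀.2.re + 2) * B) +
        Real.exp ((z₀.1.re + 2) * A + (z₀.2.re - 2) * B) +
        (Real.exp ((z₀.1.re - 2) * A + (z₀.2.re + 2) * B) +
          Real.exp ((z₀.1.re - 2) * A + (z₀.2.re - 2) * B)) := by
  have mul_le_mul_add_abs {w w₀ : ℂ} (hw : ‖w - w₀‖ ≤ 1) (x : ℝ) :
      w.re * x ≤ w₀.re * x + |x| := by
    have hre : |w.re - w₀.re| ≤ 1 := by
      simpa only [Complex.sub_re] using (Complex.abs_re_le_norm (w - w₀)).trans hw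
    have hdiff : (w.re - w₀.re) * x ≤ 1 * |x| :=
      (le_abs_self _).trans (by rw [abs_mul]; gcongr)
    linarith
  have hA := mul_le_mul_add_abs ((norm_fst_le (z - z₀)).trans hz) A
  have hB := mul_le_mul_add_abs ((norm_snd_le (z - z₀)).trans hz) B
  calc Real.exp (z.1.re * A + z.2.re * B) * (|A| + |B|)
      ≤ Real.exp (z₀.1.re * A + z₀.2.re * B + (|A| + |B|)) * Real.exp (|A| + |B|) := by
        refine mul_le_mul (Real.exp_le_exp.2 (by linarith)) ?_ (by positivity) (by positivity)
        linarith [Real.add_one_le_exp (|A| + |B|)]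
    _ = Real.exp (z₀.1.re * A + z₀.2.re * B + |2 * A| + |2 * B|) := by
        rw [← Real.exp_add, abs_mul, abs_mul, abs_two]
        ring_nf
    _ ≤ _ := (exp_add_abs_add_abs_le _ _ _).trans_eq (by ring_nf)

variable {Ω : Type*} [MeasurableSpace Ω] {ν : Measure Ω} {A B k : Ω → ℝ}

lemma norm_cexp_mul_add_mul {c : ℝ} (hc : 0 ≤ c) (z : ℂ × ℂ) (a b : ℝ) :
    ‖Complex.exp (z.1 * a + z.2 * b) * (c : ℂ)‖ = Real.exp (z.1.re * a + z.2.re * b) * c := by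
  rw [norm_mul, Complex.norm_exp, Complex.norm_real, Real.norm_of_nonneg hc, Complex.add_re,
    Complex.re_mul_ofReal, Complex.re_mul_ofReal]

lemma differentiable_integral_cexp_mul (hA : Measurable A) (hB : Measurable B) (hk : Measurable k)
    (hk_nonneg : ∀ ω, 0 ≤ k ω)
    (hint : ∀ a b : ℝ, Integrable (fun ω => Real.exp (a * A ω + b * B ω) * k ω) ν) :
    Differentiable ℂ fun z : ℂ × ℂ =>
      ∫ ω, Complex.exp (z.1 * A ω + z.2 * B ω) * (k ω : ℂ) ∂ν := by
  intro z₀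
  have hmeas (z : ℂ × ℂ) :
      AEStronglyMeasurable (fun ω => Complex.exp (z.1 * A ω + z.2 * B ω) * (k ω : ℂ)) ν := by
    fun_prop
  refine (hasFDerivAt_integral_of_dominated_of_fderiv_le
    (F' := fun z ω => (Complex.exp (z.1 * A ω + z.2 * B ω) * (k ω : ℂ)) •
      ((A ω : ℂ) • ContinuousLinearMap.fst ℂ ℂ ℂ + (B ω : ℂ) • ContinuousLinearMap.snd ℂ ℂ ℂ))
    (bound := fun ω => (Real.exp ((z₀.1.re + 2) * A ω + (z₀.2.re + 2) * B ω) +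
      Real.exp ((z₀.1.re + 2) * A ω + (z₀.2.re - 2) * B ω) +
      (Real.exp ((z₀.1.re - 2) * A ω + (z₀.2.re + 2) * B ω) +
        Real.exp ((z₀.1.re - 2) * A ω + (z₀.2.re - 2) * B ω))) * k ω)
    (Metric.ball_mem_nhds z₀ one_pos) (.of_forall hmeas) ?integrable ?measurable
    (.of_forall fun ω z hz => ?bound) ?bound_integrable
    (.of_forall fun ω z _ => ?derivative)).differentiableAt
  case integrable =>
    exact (hint z₀.1.re z₀.2.re).mono' (hmeas z₀)
      (.of_forall fun ω => (norm_cexp_mul_add_mul (hk_nonneg ω) z₀ _ _).le)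
  case measurable =>
    exact (hmeas z₀).smul ((hA.complex_ofReal.aestronglyMeasurable.smul_const _).add
      (hB.complex_ofReal.aestronglyMeasurable.smul_const _))
  case bound =>
    rw [norm_smul, norm_cexp_mul_add_mul (hk_nonneg ω), mul_right_comm]
    refine mul_le_mul_of_nonneg_right ((mul_le_mul_of_nonneg_left
      (norm_smul_fst_add_smul_snd_le _ _) (Real.exp_pos _).le).trans ?_) (hk_nonneg ω)
    exact exp_mul_abs_add_abs_le_of_norm_sub_le (mem_ball_iff_norm.1 hz).le _ _
  case bound_integrable =>
    simp only [add_mul _ _ (k _)]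
    exact ((hint _ _).add (hint _ _)).add ((hint _ _).add (hint _ _))
  case derivative =>
    have hlinear : HasFDerivAt (fun z : ℂ × ℂ => z.1 * (A ω : ℂ) + z.2 * (B ω : ℂ))
        ((A ω : ℂ) • ContinuousLinearMap.fst ℂ ℂ ℂ + (B ω : ℂ) • ContinuousLinearMap.snd ℂ ℂ ℂ)
        z := (hasFDerivAt_fst.mul_const (A ω : ℂ)).add (hasFDerivAt_snd.mul_const (B ω : ℂ))
    have hderiv := hlinear.cexp.mul_const (k ω : ℂ)
    rwa [smul_smul, mul_comm] at hderiv

end ExponentialFamily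

lemma differentiable_tripleInt {y : ℝ × ℝ × ℝ} (hy₁ : 0 < y.1) (hy₂ : 0 < y.2.1)
    (hy₃ : 0 < y.2.2) : Differentiable ℂ fun q : ℂ × ℂ => tripleInt y q.1 q.2 := by
  have hkernel : Measurable (tripleKernel y) := measurable_tripleKernel.comp measurable_prodMk_left
  have hdiff := differentiable_integral_cexp_mul (ν := octMeas) (A := fun p => Real.log p.1)
    (B := fun p => Real.log p.2.1 + Real.log p.2.2)
    (k := fun p => Real.exp (-(Real.log p.1 + (Real.log p.2.1 + Real.log p.2.2))) *
      tripleKernel y p) (by fun_prop) (by fun_prop) (by fun_prop)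
    (fun p => mul_nonneg (Real.exp_pos _).le (tripleKernel_nonneg y p)) fun a b => ?_
  · convert hdiff using 2 with q
    refine integral_congr_ae ?_
    filter_upwards [ae_octMeas_pos] with p ⟨hv, hm, hw⟩
    rw [Complex.cpow_def_of_ne_zero (Complex.ofReal_ne_zero.2 hv.ne'),
      Complex.cpow_def_of_ne_zero (Complex.ofReal_ne_zero.2 hm.ne'),
      Complex.cpow_def_of_ne_zero (Complex.ofReal_ne_zero.2 hw.ne'), ← Complex.ofReal_log hv.le,
      ← Complex.ofReal_log hm.le, ← Complex.ofReal_log hw.le, Complex.ofReal_mul,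
      Complex.ofReal_exp, ← Complex.exp_add, ← Complex.exp_add, ← mul_assoc, ← Complex.exp_add]
    congr 2
    push_cast
    ring
  · refine (integrable_rpow_mul_tripleKernel hy₁ hy₂ hy₃ a b).congr ?_
    filter_upwards [ae_octMeas_pos] with p ⟨hv, hm, hw⟩
    rw [Real.rpow_def_of_pos hv, Real.rpow_def_of_pos hm, Real.rpow_def_of_pos hw,
      ← Real.exp_add, ← Real.exp_add, ← mul_assoc, ← Real.exp_add]
    congr 2
    ring

/-! ### Gaussian integrals on the unipotent group -/

section Gaussian

/-- A Gaussian multiplied by the additive character of frequency `ξ`. -/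
def charGaussian (P ξ t : ℝ) : ℂ := Complex.exp (-(P : ℂ) * t ^ 2 + (2 * π * ξ * I) * t)

lemma integrable_charGaussian {P : ℝ} (hP : 0 < P) (ξ : ℝ) :
    Integrable (charGaussian P ξ) := by
  unfold charGaussian
  simpa only [add_zero] using
    integrable_cexp_quadratic' (b := -(P : ℂ)) (by simpa) (2 * π * ξ * I) 0

lemma integral_charGaussian {P : ℝ} (hP : 0 < P) (ξ : ℝ) :
    ∫ t : ℝ, charGaussian P ξ t =
      (√(π / P) * Real.exp (-(π ^ 2 * ξ ^ 2 / P)) : ℝ) := by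
  have hquadratic := integral_cexp_quadratic (b := -(P : ℂ)) (by simpa) (2 * π * ξ * I) 0
  simp only [add_zero] at hquadratic
  simp only [charGaussian]
  rw [hquadratic, neg_neg, Complex.ofReal_mul, Real.sqrt_eq_rpow,
    Complex.ofReal_cpow (by positivity)]
  have hP_ne : (P : ℂ) ≠ 0 := Complex.ofReal_ne_zero.2 hP.ne'
  congr 1
  · push_cast; rfl
  · push_cast
    congr 1
    rw [mul_pow, Complex.I_sq]
    field_simp
    ring

lemma norm_charGaussian (P ξ t : ℝ) : ‖charGaussian P ξ t‖ = Real.exp (-P * t ^ 2) := by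
  rw [charGaussian, Complex.norm_exp]
  congr 1
  have hsplit : (-(P : ℂ) * t ^ 2 + (2 * π * ξ * I) * t) =
      ((-P * t ^ 2 : ℝ) : ℂ) + ((2 * π * ξ * t : ℝ) : ℂ) * I := by push_cast; ring
  rw [hsplit, Complex.add_re, Complex.ofReal_re, Complex.re_ofReal_mul, Complex.I_re, mul_zero,
    add_zero]

lemma integral_norm_charGaussian (P ξ : ℝ) : ∫ t, ‖charGaussian P ξ t‖ = √(π / P) := by
  simp only [norm_charGaussian]
  exact integral_gaussian P

/-- A Gaussian centred at `s`, normalized to have mass `√π`. -/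
def normalizedGaussian (R s t : ℝ) : ℂ := (√R * Real.exp (-R * (t - s) ^ 2) : ℝ)

lemma integral_norm_normalizedGaussian {R : ℝ} (hR : 0 < R) (s : ℝ) :
    ∫ t, ‖normalizedGaussian R s t‖ = √π := by
  have hnorm (t : ℝ) : ‖normalizedGaussian R s t‖ = √R * Real.exp (-R * (t - s) ^ 2) :=
    (Complex.norm_real _).trans (Real.norm_of_nonneg (by positivity))
  simp only [hnorm]
  rw [integral_const_mul, integral_sub_right_eq_self (fun t => Real.exp (-R * t ^ 2)),
    integral_gaussian, ← Real.sqrt_mul hR.le, mul_div_cancel₀ π hR.ne']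

lemma integrable_normalizedGaussian {R : ℝ} (hR : 0 < R) (s : ℝ) :
    Integrable (normalizedGaussian R s) :=
  (((integrable_exp_neg_mul_sq hR).comp_sub_right s).const_mul _).ofReal

lemma integral_normalizedGaussian {R : ℝ} (hR : 0 < R) (s : ℝ) :
    ∫ t, normalizedGaussian R s t = (√π : ℝ) := by
  unfold normalizedGaussian
  rw [integral_complex_ofReal, integral_const_mul,
    integral_sub_right_eq_self (fun t => Real.exp (-R * t ^ 2)), integral_gaussian,
    ← Real.sqrt_mul hR.le, mul_div_cancel₀ π hR.ne']

end Gaussian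

section ConstantFibers

variable {α β : Type*} [MeasurableSpace α] [MeasurableSpace β] {ν : Measure α} {ν' : Measure β}
  [SFinite ν'] {g : α → ℂ} {K : α × β → ℂ} {c : ℂ} {c' : ℝ}

lemma integrable_prod_of_fiber (hK : Measurable K) (hg : Integrable g ν)
    (hfiber : ∀ a, Integrable (fun b => K (a, b)) ν') (hnorm : ∀ a, ∫ b, ‖K (a, b)‖ ∂ν' = c') :
    Integrable (fun q => g q.1 * K q) (ν.prod ν') := by
  have hmeas : AEStronglyMeasurable (fun q => g q.1 * K q) (ν.prod ν') :=
    hg.1.comp_fst.mul hK.aestronglyMeasurable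
  refine (integrable_prod_iff hmeas).2 ⟨.of_forall fun a => (hfiber a).const_mul (g a),
    (hg.norm.mul_const c').congr (.of_forall fun a => ?_)⟩
  simp only [norm_mul]
  rw [integral_const_mul, hnorm]

lemma integral_norm_prod_of_fiber [SFinite ν] (hint : Integrable (fun q => g q.1 * K q) (ν.prod ν'))
    (hnorm : ∀ a, ∫ b, ‖K (a, b)‖ ∂ν' = c') :
    ∫ q, ‖g q.1 * K q‖ ∂(ν.prod ν') = (∫ a, ‖g a‖ ∂ν) * c' := by
  rw [integral_prod _ hint.norm, ← integral_mul_const]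
  simp only [norm_mul, integral_const_mul, hnorm]

lemma integral_prod_of_fiber [SFinite ν] (hint : Integrable (fun q => g q.1 * K q) (ν.prod ν'))
    (hfiber : ∀ a, ∫ b, K (a, b) ∂ν' = c) :
    ∫ q, g q.1 * K q ∂(ν.prod ν') = (∫ a, g a ∂ν) * c := by
  rw [integral_prod _ hint, ← integral_mul_const]
  simp only [integral_const_mul, hfiber]

end ConstantFibers

section ShearedGaussian

/-- A sheared Gaussian in two variables, normalized to have mass `√π` in the second variable, and
twisted by a character in the first. -/
def shearedGaussian (Q c ξ R : ℝ) (q : ℝ × ℝ) : ℂ :=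
  charGaussian Q ξ q.1 * normalizedGaussian R (c * q.1) q.2

/-- The function of `(x₁, x₂, x₃)` to which the integral over the unipotent group is reduced: a
Gaussian in `x₁` times a sheared Gaussian in `(x₂, x₃)` whose shear and width depend on `x₁`. -/
def unipGaussian (P Q k ξ : ℝ) (R : ℝ → ℝ) (x : ℝ × ℝ × ℝ) : ℂ :=
  charGaussian P ξ x.1 * shearedGaussian Q (k * x.1) ξ (R x.1) x.2

section

variable {Q R : ℝ} (c ξ : ℝ)

lemma integrable_shearedGaussian (hQ : 0 < Q) (hR : 0 < R) :
    Integrable (shearedGaussian Q c ξ R) :=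
  integrable_prod_of_fiber (K := fun q => normalizedGaussian R (c * q.1) q.2)
    (by unfold normalizedGaussian; fun_prop) (integrable_charGaussian hQ ξ)
    (fun s => integrable_normalizedGaussian hR (c * s))
    (fun s => integral_norm_normalizedGaussian hR (c * s))

lemma integral_shearedGaussian (hQ : 0 < Q) (hR : 0 < R) :
    ∫ q, shearedGaussian Q c ξ R q =
      (√(π / Q) * Real.exp (-(π ^ 2 * ξ ^ 2 / Q)) : ℝ) * (√π : ℝ) :=
  (integral_prod_of_fiber (K := fun q => normalizedGaussian R (c * q.1) q.2)
    (integrable_shearedGaussian c ξ hQ hR) fun s =>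
      integral_normalizedGaussian hR (c * s)).trans
    (by rw [integral_charGaussian hQ])

lemma integral_norm_shearedGaussian (hQ : 0 < Q) (hR : 0 < R) :
    ∫ q, ‖shearedGaussian Q c ξ R q‖ = √(π / Q) * √π :=
  (integral_norm_prod_of_fiber (K := fun q => normalizedGaussian R (c * q.1) q.2)
    (integrable_shearedGaussian c ξ hQ hR) fun s =>
      integral_norm_normalizedGaussian hR (c * s)).trans (by rw [integral_norm_charGaussian])

end

variable {P Q : ℝ} (k ξ : ℝ) {R : ℝ → ℝ}

lemma integrable_unipGaussian (hP : 0 < P) (hQ : 0 < Q) (hR : ∀ t, 0 < R t)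
    (hRm : Measurable R) : Integrable (unipGaussian P Q k ξ R) :=
  integrable_prod_of_fiber (K := fun x => shearedGaussian Q (k * x.1) ξ (R x.1) x.2)
    (by unfold shearedGaussian charGaussian normalizedGaussian; fun_prop)
    (integrable_charGaussian hP ξ)
    (fun t => integrable_shearedGaussian (k * t) ξ hQ (hR t))
    (fun t => integral_norm_shearedGaussian (k * t) ξ hQ (hR t))

lemma integral_unipGaussian (hP : 0 < P) (hQ : 0 < Q) (hR : ∀ t, 0 < R t) (hRm : Measurable R) :
    ∫ x, unipGaussian P Q k ξ R x =
      ((√(π / P) * Real.exp (-(π ^ 2 * ξ ^ 2 / P))) *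
        ((√(π / Q) * Real.exp (-(π ^ 2 * ξ ^ 2 / Q))) * √π) : ℝ) :=
  (integral_prod_of_fiber (K := fun x => shearedGaussian Q (k * x.1) ξ (R x.1) x.2)
    (integrable_unipGaussian k ξ hP hQ hR hRm) fun t =>
      integral_shearedGaussian (k * t) ξ hQ (hR t)).trans
    (by rw [integral_charGaussian hP, ← Complex.ofReal_mul, ← Complex.ofReal_mul])

lemma integral_norm_unipGaussian (hP : 0 < P) (hQ : 0 < Q) (hR : ∀ t, 0 < R t)
    (hRm : Measurable R) :
    ∫ x, ‖unipGaussian P Q k ξ R x‖ = √(π / P) * (√(π / Q) * √π) :=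
  (integral_norm_prod_of_fiber (K := fun x => shearedGaussian Q (k * x.1) ξ (R x.1) x.2)
    (integrable_unipGaussian k ξ hP hQ hR hRm) fun t =>
      integral_norm_shearedGaussian (k * t) ξ hQ (hR t)).trans (by rw [integral_norm_charGaussian])

end ShearedGaussian

/-! ### Jacquet's integral and its continuation -/

lemma ofReal_cpow_eq_exp {r : ℝ} (hr : 0 < r) (s : ℂ) :
    (r : ℂ) ^ s = Complex.exp ((Real.log r : ℂ) * s) := by
  rw [Complex.cpow_def_of_ne_zero (Complex.ofReal_ne_zero.2 hr.ne'), Complex.ofReal_log hr.le]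

lemma integral_cpow_mul_linear_cpow {a b : ℂ} (ha : 0 < a.re) (hb : 0 < b.re) {c d : ℝ}
    (hc : 0 < c) (hd : 0 < d) :
    ∫ v : ℝ, (v : ℂ) ^ (a - 1) * ((v * c + d : ℝ) : ℂ) ^ (-(a + b)) ∂posMeas =
      (c : ℂ) ^ (-a) * (d : ℂ) ^ (-b) *
        (Complex.Gamma a * Complex.Gamma b * (Complex.Gamma (a + b))⁻¹) := by
  have hr : 0 < c / d := by positivity
  have hintegrand : ∀ᵐ v : ℝ ∂posMeas,
      (v : ℂ) ^ (a - 1) * ((v * c + d : ℝ) : ℂ) ^ (-(a + b)) =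
      (c : ℂ) ^ (-a) * (d : ℂ) ^ (-b) * ((c / d : ℝ) : ℂ) *
        (((c / d * v : ℝ) : ℂ) ^ (a - 1) * ((1 + c / d * v : ℝ) : ℂ) ^ (-(a + b))) := by
    filter_upwards [ae_posMeas_pos] with v hv
    rw [show v * c + d = d * (1 + c / d * v) by field_simp; ring]
    have hratio : ((c / d : ℝ) : ℂ) = Complex.exp ((Real.log (c / d) : ℂ) * 1) := by
      rw [← ofReal_cpow_eq_exp hr, Complex.cpow_one]
    rw [hratio]
    repeat rw [ofReal_cpow_eq_exp (by positivity)]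
    simp only [← Complex.exp_add]
    rw [Real.log_mul hd.ne' (by positivity), Real.log_mul hr.ne' hv.ne',
      Real.log_div hc.ne' hd.ne']
    congr 1
    push_cast
    ring
  rw [integral_congr_ae hintegrand, integral_const_mul, integral_comp_mul_left_Ioi
    (fun u : ℝ => (u : ℂ) ^ (a - 1) * ((1 + u : ℝ) : ℂ) ^ (-(a + b))) 0 hr, mul_zero,
    integral_beta ha hb, Complex.real_smul, Complex.ofReal_inv, mul_assoc,
    mul_inv_cancel_left₀ (Complex.ofReal_ne_zero.2 hr.ne')]

section Iwasawa

/-- The squared norm of the last row of `w_l x y`. -/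
def rowNormSq (y : ℝ × ℝ) (x : ℝ × ℝ × ℝ) : ℝ :=
  y.1 ^ 2 * y.2 ^ 2 + x.2.1 ^ 2 * y.1 ^ 2 + x.2.2 ^ 2

/-- The squared norm of the exterior product of the last two rows of `w_l x y`, divided by
`y₁ ^ 2`. -/
def minorNormSq (y : ℝ × ℝ) (x : ℝ × ℝ × ℝ) : ℝ :=
  y.1 ^ 2 * y.2 ^ 2 + y.2 ^ 2 * x.1 ^ 2 + (x.1 * x.2.1 - x.2.2) ^ 2

variable {y : ℝ × ℝ}

lemma rowNormSq_pos (hy₁ : 0 < y.1) (hy₂ : 0 < y.2) (x : ℝ × ℝ × ℝ) : 0 < rowNormSq y x := by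
  unfold rowNormSq; positivity

lemma minorNormSq_pos (hy₁ : 0 < y.1) (hy₂ : 0 < y.2) (x : ℝ × ℝ × ℝ) : 0 < minorNormSq y x := by
  unfold minorNormSq; positivity

lemma iwasawaY_longWeyl_mul (hy₁ : 0 < y.1) (hy₂ : 0 < y.2) (x : ℝ × ℝ × ℝ) :
    iwasawaY (longWeyl * unip x * torus y) =
      (y.1 * √(minorNormSq y x) / rowNormSq y x, y.2 * √(rowNormSq y x) / minorNormSq y x) := by
  have _ := rowNormSq_pos hy₁ hy₂ x
  have _ := minorNormSq_pos hy₁ hy₂ x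
  have hm₁ : ((longWeyl * unip x * torus y) * (longWeyl * unip x * torus y).transpose) 2 2 =
      rowNormSq y x := by
    simp [longWeyl, unip, torus, Matrix.mul_apply, Fin.sum_univ_three, rowNormSq]; ring
  have hm₂ : ((longWeyl * unip x * torus y) * (longWeyl * unip x * torus y).transpose) 1 1 *
      ((longWeyl * unip x * torus y) * (longWeyl * unip x * torus y).transpose) 2 2 -
      ((longWeyl * unip x * torus y) * (longWeyl * unip x * torus y).transpose) 1 2 *
      ((longWeyl * unip x * torus y) * (longWeyl * unip x * torus y).transpose) 2 1 =
      y.1 ^ 2 * minorNormSq y x := by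
    simp [longWeyl, unip, torus, Matrix.mul_apply, Fin.sum_univ_three, minorNormSq]; ring
  have hm₃ : ((longWeyl * unip x * torus y) * (longWeyl * unip x * torus y).transpose).det =
      (y.1 ^ 2 * y.2) ^ 2 := by
    rw [Matrix.det_mul, Matrix.det_transpose]
    simp [longWeyl, unip, torus, Matrix.det_fin_three]; ring
  simp only [iwasawaY]
  rw [hm₂, hm₃, hm₁, Real.sqrt_mul (by positivity), Real.sqrt_sq hy₁.le,
    Real.sqrt_mul (by positivity), Real.sqrt_sq (by positivity), mul_assoc (y.1 ^ 2),
    mul_div_mul_left _ _ (by positivity)]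

lemma powerFn_longWeyl_mul (hy₁ : 0 < y.1) (hy₂ : 0 < y.2) (x : ℝ × ℝ × ℝ) {μ : Fin 3 → ℂ}
    (hμ : μ 0 + μ 1 + μ 2 = 0) :
    powerFn (rho + μ) (longWeyl * unip x * torus y) =
      (y.1 : ℂ) ^ (1 - μ 2) * (y.2 : ℂ) ^ (1 + μ 0) *
        (((minorNormSq y x : ℝ) : ℂ) ^ (-((1 + μ 0 - μ 1) / 2)) *
          ((rowNormSq y x : ℝ) : ℂ) ^ (-((1 + μ 1 - μ 2) / 2))) := by
  have hrow := rowNormSq_pos hy₁ hy₂ x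
  have hminor := minorNormSq_pos hy₁ hy₂ x
  have hsum : μ 0 + μ 1 = -μ 2 := by linear_combination hμ
  simp only [powerFn, iwasawaY_longWeyl_mul hy₁ hy₂]
  repeat rw [ofReal_cpow_eq_exp (by positivity)]
  rw [Real.log_div (by positivity) hrow.ne', Real.log_div (by positivity) hminor.ne',
    Real.log_mul hy₁.ne' (by positivity), Real.log_mul hy₂.ne' (by positivity),
    Real.log_sqrt hminor.le, Real.log_sqrt hrow.le]
  simp only [← Complex.exp_add, Pi.add_apply, show rho 0 = 1 from rfl, show rho 1 = 0 from rfl,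
    zero_add]
  congr 1
  push_cast
  linear_combination (Real.log y.1 - Real.log (rowNormSq y x) / 2 : ℂ) * hsum

end Iwasawa

section JacquetKernel

lemma integrable_octant {A x z : ℝ} (hA : 0 < A) (hx : 0 < x) (hxz : x < z) :
    Integrable (fun p : ℝ × ℝ × ℝ => p.1 ^ (x - 1) * ((p.2.1 ^ (z - 1) * Real.exp (-(1 * p.2.1))) *
      (p.2.2 ^ (z - 1) * Real.exp (-(A * (1 + p.1) * p.2.2))))) octMeas := by
  have hz : 0 < z := hx.trans hxz
  have hmeas : Measurable (fun p : ℝ × ℝ × ℝ => p.1 ^ (x - 1) *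
      ((p.2.1 ^ (z - 1) * Real.exp (-(1 * p.2.1))) *
      (p.2.2 ^ (z - 1) * Real.exp (-(A * (1 + p.1) * p.2.2))))) := by fun_prop
  have hgamma {r : ℝ} (hr : 0 < r) :
      ∫ t : ℝ, ‖t ^ (z - 1) * Real.exp (-(r * t))‖ ∂posMeas = r ^ (-z) * Real.Gamma z := by
    rw [Real.rpow_neg hr.le, ← Real.inv_rpow hr.le, ← one_div,
      ← Real.integral_rpow_mul_exp_neg_mul_Ioi hz hr]
    refine integral_congr_ae ?_
    filter_upwards [ae_posMeas_pos] with t ht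
    exact Real.norm_of_nonneg (by positivity)
  rw [integrable_prod_iff hmeas.aestronglyMeasurable]
  constructor
  · filter_upwards [ae_posMeas_pos] with v hv
    exact ((integrable_rpow_mul_exp hz one_pos).mul_prod
      (integrable_rpow_mul_exp hz (by positivity : 0 < A * (1 + v)))).const_mul _
  · refine ((integrable_beta hx (sub_pos.2 hxz)).const_mul
      (Real.Gamma z * (A ^ (-z) * Real.Gamma z))).congr ?_
    filter_upwards [ae_posMeas_pos] with v hv
    have hnorm (q : ℝ × ℝ) : ‖v ^ (x - 1) * (q.1 ^ (z - 1) * Real.exp (-(1 * q.1)) *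
        (q.2 ^ (z - 1) * Real.exp (-(A * (1 + v) * q.2))))‖ =
        v ^ (x - 1) * (‖q.1 ^ (z - 1) * Real.exp (-(1 * q.1))‖ *
          ‖q.2 ^ (z - 1) * Real.exp (-(A * (1 + v) * q.2))‖) := by
      rw [norm_mul, norm_mul (_ * _), Real.norm_of_nonneg (by positivity)]
    simp only [hnorm]
    rw [integral_const_mul, integral_prod_mul (fun m : ℝ => ‖m ^ (z - 1) * Real.exp (-(1 * m))‖)
        (fun w : ℝ => ‖w ^ (z - 1) * Real.exp (-(A * (1 + v) * w))‖),
      hgamma one_pos, hgamma (by positivity), Real.one_rpow,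
      Real.mul_rpow hA.le (by positivity), show -(x + (z - x)) = -z by ring]
    ring

/-- The quadratic form that appears when the square in `x₃` is completed:
`v * minorNormSq y x + rowNormSq y x` is
`(1 + v) * (x₃ - v / (1 + v) * x₁ * x₂) ^ 2 + shearForm y v x₁ * (y₂ ^ 2 + x₂ ^ 2 / (1 + v))`. -/
def shearForm (y : ℝ × ℝ) (v t : ℝ) : ℝ := y.1 ^ 2 * (1 + v) + v * t ^ 2

lemma shearForm_pos {y : ℝ × ℝ} (hy₁ : 0 < y.1) {v : ℝ} (hv : 0 < v) (t : ℝ) :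
    0 < shearForm y v t := by
  unfold shearForm; positivity

/-- The power function in the integrand of `jacquetKernel`. -/
def jacquetWeight (a b : ℂ) (p : ℝ × ℝ × ℝ) : ℂ :=
  (p.1 : ℂ) ^ (a - 1) * ((p.2.1 : ℂ) ^ (a + b - 1) * (p.2.2 : ℂ) ^ (a + b - 1 / 2 - 1))

/-- The exponential factor of `jacquetKernel`. -/
def jacquetExp (y : ℝ × ℝ) (p x : ℝ × ℝ × ℝ) : ℝ :=
  shearForm y p.1 x.1 ^ (-(1 / 2) : ℝ) *
    Real.exp (-((p.1 * minorNormSq y x + rowNormSq y x) / (y.2 ^ 2 * shearForm y p.1 x.1) *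
      p.2.1)) *
    Real.exp (-(shearForm y p.1 x.1 * p.2.2))

/-- The kernel connecting Jacquet's integral with `tripleInt`: integrating over `p = (v, m, w)`
gives the power function `minorNormSq ^ (-a) * rowNormSq ^ (-b)` times a character, while the
integral over `x` is Gaussian. -/
def jacquetKernel (y : ℝ × ℝ) (a b : ℂ) (ξ : ℝ) (p x : ℝ × ℝ × ℝ) : ℂ :=
  jacquetWeight a b p * (jacquetExp y p x : ℂ) * Complex.exp (2 * π * ξ * I * (x.1 + x.2.1))

lemma measurable_jacquetKernel (y : ℝ × ℝ) (a b : ℂ) (ξ : ℝ) :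
    Measurable (Function.uncurry (jacquetKernel y a b ξ)) := by
  unfold Function.uncurry jacquetKernel jacquetWeight jacquetExp minorNormSq rowNormSq shearForm
  fun_prop

lemma unipGaussian_eq (P Q k ξ : ℝ) (R : ℝ → ℝ) (x : ℝ × ℝ × ℝ) :
    unipGaussian P Q k ξ R x = ((√(R x.1) * Real.exp (-P * x.1 ^ 2 + -Q * x.2.1 ^ 2 +
      -R x.1 * (x.2.2 - k * x.1 * x.2.1) ^ 2) : ℝ) : ℂ) *
      Complex.exp (2 * π * ξ * I * (x.1 + x.2.1)) := by
  simp only [unipGaussian, shearedGaussian, charGaussian, normalizedGaussian, Complex.ofReal_mul,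
    Complex.ofReal_exp, Complex.ofReal_add]
  rw [mul_add, mul_assoc (√(R x.1) : ℂ), ← Complex.exp_add, mul_left_comm _ (√(R x.1) : ℂ),
    mul_left_comm _ (√(R x.1) : ℂ), ← Complex.exp_add, ← Complex.exp_add]
  push_cast
  ring_nf

variable {y : ℝ × ℝ} {a b : ℂ} {p : ℝ × ℝ × ℝ}

/-- The Gaussian in `x` to which `jacquetKernel y a b ξ p` is proportional. -/
def jacquetGaussian (y : ℝ × ℝ) (ξ : ℝ) (p : ℝ × ℝ × ℝ) : ℝ × ℝ × ℝ → ℂ :=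
  unipGaussian (p.2.2 * p.1) (p.2.1 / (y.2 ^ 2 * (1 + p.1))) (p.1 / (1 + p.1)) ξ
    fun t => p.2.1 * (1 + p.1) / (y.2 ^ 2 * shearForm y p.1 t)

/-- The value of `jacquetExp` divided by the modulus of `jacquetGaussian`. -/
def jacquetConst (y : ℝ × ℝ) (p : ℝ × ℝ × ℝ) : ℝ :=
  y.2 / √(p.2.1 * (1 + p.1)) * (Real.exp (-(1 * p.2.1)) * Real.exp (-(y.1 ^ 2 * (1 + p.1) * p.2.2)))

lemma jacquetExp_eq (hy₁ : 0 < y.1) (hy₂ : 0 < y.2) (hv : 0 < p.1) (hm : 0 < p.2.1)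
    (x : ℝ × ℝ × ℝ) :
    jacquetExp y p x = jacquetConst y p * (√(p.2.1 * (1 + p.1) / (y.2 ^ 2 * shearForm y p.1 x.1)) *
      Real.exp (-(p.2.2 * p.1) * x.1 ^ 2 + -(p.2.1 / (y.2 ^ 2 * (1 + p.1))) * x.2.1 ^ 2 +
        -(p.2.1 * (1 + p.1) / (y.2 ^ 2 * shearForm y p.1 x.1)) *
          (x.2.2 - p.1 / (1 + p.1) * x.1 * x.2.1) ^ 2)) := by
  have hn := shearForm_pos hy₁ hv x.1
  have hroot : shearForm y p.1 x.1 ^ (-(1 / 2) : ℝ) = y.2 / √(p.2.1 * (1 + p.1)) *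
      √(p.2.1 * (1 + p.1) / (y.2 ^ 2 * shearForm y p.1 x.1)) := by
    rw [Real.sqrt_div (by positivity), Real.sqrt_mul (by positivity) (shearForm y p.1 x.1),
      Real.sqrt_sq hy₂.le, Real.rpow_neg hn.le, ← Real.sqrt_eq_rpow]
    have hsqrt : √(p.2.1 * (1 + p.1)) ≠ 0 := (Real.sqrt_pos.2 (by positivity)).ne'
    field_simp
  have hexponent :
      -((p.1 * minorNormSq y x + rowNormSq y x) / (y.2 ^ 2 * shearForm y p.1 x.1) * p.2.1) +
        -(shearForm y p.1 x.1 * p.2.2) =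
      -(1 * p.2.1) + -(y.1 ^ 2 * (1 + p.1) * p.2.2) +
        (-(p.2.2 * p.1) * x.1 ^ 2 + -(p.2.1 / (y.2 ^ 2 * (1 + p.1))) * x.2.1 ^ 2 +
        -(p.2.1 * (1 + p.1) / (y.2 ^ 2 * shearForm y p.1 x.1)) *
          (x.2.2 - p.1 / (1 + p.1) * x.1 * x.2.1) ^ 2) := by
    have hn_ne := hn.ne'
    unfold minorNormSq rowNormSq
    unfold shearForm at hn_ne ⊢
    field_simp
    ring
  rw [jacquetExp, jacquetConst, mul_assoc, ← Real.exp_add, hexponent, hroot, Real.exp_add _ (_ + _),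
    Real.exp_add _ (-(_ * _ * _))]
  ring

lemma jacquetKernel_eq (hy₁ : 0 < y.1) (hy₂ : 0 < y.2) (ξ : ℝ) (hv : 0 < p.1) (hm : 0 < p.2.1) :
    jacquetKernel y a b ξ p =
      fun x => jacquetWeight a b p * (jacquetConst y p : ℂ) * jacquetGaussian y ξ p x := by
  funext x
  rw [jacquetKernel, jacquetGaussian, unipGaussian_eq, jacquetExp_eq hy₁ hy₂ hv hm,
    Complex.ofReal_mul (jacquetConst y p)]
  ring

lemma sqrt_gaussian_const_eq {y₂ v m w : ℝ} (hy₂ : 0 < y₂) (hv : 0 < v) (hm : 0 < m) (hw : 0 < w) :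
    y₂ / √(m * (1 + v)) * (√(π / (w * v)) * (√(π / (m / (y₂ ^ 2 * (1 + v)))) * √π)) =
    π * √π * y₂ ^ 2 * (v ^ (-(1 / 2) : ℝ) * (m ^ (-1 : ℝ) * w ^ (-(1 / 2) : ℝ))) := by
  have hv₁ : 0 < 1 + v := by positivity
  rw [show π / (m / (y₂ ^ 2 * (1 + v))) = π * (y₂ ^ 2 * (1 + v)) / m by field_simp,
    Real.sqrt_div (by positivity), Real.sqrt_div (by positivity), Real.sqrt_mul (by positivity),
    Real.sqrt_mul (by positivity), Real.sqrt_mul (by positivity), Real.sqrt_mul (by positivity),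
    Real.sqrt_sq hy₂.le, Real.rpow_neg hv.le, Real.rpow_neg hw.le, Real.rpow_neg hm.le,
    Real.rpow_one, ← Real.sqrt_eq_rpow, ← Real.sqrt_eq_rpow]
  have hv_ne : √v ≠ 0 := (Real.sqrt_pos.2 hv).ne'
  have hw_ne : √w ≠ 0 := (Real.sqrt_pos.2 hw).ne'
  have hm_ne : √m ≠ 0 := (Real.sqrt_pos.2 hm).ne'
  have hv₁_ne : √(1 + v) ≠ 0 := (Real.sqrt_pos.2 hv₁).ne'
  field_simp
  rw [Real.sq_sqrt hm.le, Real.sq_sqrt Real.pi_pos.le, mul_comm]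

/-- The Gaussian integrals over `x` lower the exponents of `v`, `m`, `w` by `1/2`, `1`, `1/2`. -/
lemma jacquetWeight_mul_rpow (hv : 0 < p.1) (hm : 0 < p.2.1) (hw : 0 < p.2.2) :
    jacquetWeight a b p *
      ((p.1 ^ (-(1 / 2) : ℝ) * (p.2.1 ^ (-1 : ℝ) * p.2.2 ^ (-(1 / 2) : ℝ)) : ℝ) : ℂ) =
    (p.1 : ℂ) ^ (a - 1 / 2 - 1) *
      ((p.2.1 : ℂ) ^ (a + b - 1 - 1) * (p.2.2 : ℂ) ^ (a + b - 1 - 1)) := by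
  rw [jacquetWeight, Complex.ofReal_mul, Complex.ofReal_mul, Complex.ofReal_cpow hv.le,
    Complex.ofReal_cpow hm.le, Complex.ofReal_cpow hw.le]
  repeat rw [ofReal_cpow_eq_exp (by assumption)]
  simp only [← Complex.exp_add]
  congr 1
  push_cast
  ring

lemma jacquetGaussian_width_pos (hy₁ : 0 < y.1) (hy₂ : 0 < y.2) (hv : 0 < p.1) (hm : 0 < p.2.1)
    (t : ℝ) : 0 < p.2.1 * (1 + p.1) / (y.2 ^ 2 * shearForm y p.1 t) := by
  have _ := shearForm_pos hy₁ hv t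
  positivity

lemma measurable_jacquetGaussian_width (y : ℝ × ℝ) (p : ℝ × ℝ × ℝ) :
    Measurable fun t => p.2.1 * (1 + p.1) / (y.2 ^ 2 * shearForm y p.1 t) := by
  unfold shearForm
  fun_prop

lemma integrable_jacquetKernel_right (hy₁ : 0 < y.1) (hy₂ : 0 < y.2) (ξ : ℝ) (hv : 0 < p.1)
    (hm : 0 < p.2.1) (hw : 0 < p.2.2) : Integrable (jacquetKernel y a b ξ p) := by
  rw [jacquetKernel_eq hy₁ hy₂ ξ hv hm]
  exact (integrable_unipGaussian (p.1 / (1 + p.1)) ξ (by positivity) (by positivity)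
    (jacquetGaussian_width_pos hy₁ hy₂ hv hm) (measurable_jacquetGaussian_width y p)).const_mul _

lemma integral_jacquetKernel (hy₁ : 0 < y.1) (hy₂ : 0 < y.2) (ξ : ℝ) (hv : 0 < p.1)
    (hm : 0 < p.2.1) (hw : 0 < p.2.2) :
    ∫ x, jacquetKernel y a b ξ p x = (π * √π * y.2 ^ 2 : ℝ) *
      ((p.1 : ℂ) ^ (a - 1 / 2 - 1) *
        ((p.2.1 : ℂ) ^ (a + b - 1 - 1) * (p.2.2 : ℂ) ^ (a + b - 1 - 1)) *
        (tripleKernel (y.1 ^ 2, π ^ 2 * ξ ^ 2 * y.2 ^ 2, π ^ 2 * ξ ^ 2) p : ℂ)) := by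
  have hleft : π ^ 2 * ξ ^ 2 / (p.2.2 * p.1) = π ^ 2 * ξ ^ 2 / p.1 / p.2.2 := by field_simp
  have hright : π ^ 2 * ξ ^ 2 / (p.2.1 / (y.2 ^ 2 * (1 + p.1))) =
      π ^ 2 * ξ ^ 2 * y.2 ^ 2 * (1 + p.1) / p.2.1 := by field_simp
  have hconst := congrArg (fun r : ℝ => (r : ℂ)) (sqrt_gaussian_const_eq hy₂ hv hm hw)
  rw [jacquetKernel_eq hy₁ hy₂ ξ hv hm, integral_const_mul, jacquetGaussian,
    integral_unipGaussian (p.1 / (1 + p.1)) ξ (by positivity) (by positivity)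
      (jacquetGaussian_width_pos hy₁ hy₂ hv hm) (measurable_jacquetGaussian_width y p),
    ← jacquetWeight_mul_rpow hv hm hw, hleft, hright, jacquetConst, tripleKernel,
    neg_add (1 * p.2.1), neg_add (y.1 ^ 2 * (1 + p.1) * p.2.2), Real.exp_add, Real.exp_add]
  simp only [Complex.ofReal_mul] at hconst ⊢
  linear_combination (jacquetWeight a b p * ((Real.exp (-(1 * p.2.1)) : ℂ) *
    (Real.exp (-(y.1 ^ 2 * (1 + p.1) * p.2.2)) : ℂ)) *
    ((Real.exp (-(π ^ 2 * ξ ^ 2 / p.1 / p.2.2)) : ℂ) *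
    (Real.exp (-(π ^ 2 * ξ ^ 2 * y.2 ^ 2 * (1 + p.1) / p.2.1)) : ℂ))) * hconst

lemma integral_norm_jacquetKernel (hy₁ : 0 < y.1) (hy₂ : 0 < y.2) (ξ : ℝ) (hv : 0 < p.1)
    (hm : 0 < p.2.1) (hw : 0 < p.2.2) :
    ∫ x, ‖jacquetKernel y a b ξ p x‖ = π * √π * y.2 ^ 2 *
      (p.1 ^ (a.re - 1 / 2 - 1) *
        ((p.2.1 ^ (a.re + b.re - 1 - 1) * Real.exp (-(1 * p.2.1))) *
        (p.2.2 ^ (a.re + b.re - 1 - 1) * Real.exp (-(y.1 ^ 2 * (1 + p.1) * p.2.2))))) := by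
  have hweight := congrArg norm (jacquetWeight_mul_rpow (a := a) (b := b) hv hm hw)
  simp only [norm_mul, Complex.norm_real, Complex.norm_cpow_eq_rpow_re_of_pos hv,
    Complex.norm_cpow_eq_rpow_re_of_pos hm, Complex.norm_cpow_eq_rpow_re_of_pos hw,
    Complex.sub_re, Complex.add_re, Complex.one_re, Complex.div_ofNat_re] at hweight
  rw [Real.norm_of_nonneg (by positivity), Real.norm_of_nonneg (by positivity),
    Real.norm_of_nonneg (by positivity)] at hweight
  rw [jacquetKernel_eq hy₁ hy₂ ξ hv hm]
  simp only [norm_mul (_ * (jacquetConst y p : ℂ)), jacquetGaussian]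
  rw [integral_const_mul, integral_norm_unipGaussian (p.1 / (1 + p.1)) ξ (by positivity)
      (by positivity) (jacquetGaussian_width_pos hy₁ hy₂ hv hm)
      (measurable_jacquetGaussian_width y p), norm_mul, Complex.norm_real,
    Real.norm_of_nonneg (by unfold jacquetConst; positivity), jacquetConst]
  linear_combination ‖jacquetWeight a b p‖ * (Real.exp (-(1 * p.2.1)) *
    Real.exp (-(y.1 ^ 2 * (1 + p.1) * p.2.2))) * sqrt_gaussian_const_eq hy₂ hv hm hw +
    π * √π * y.2 ^ 2 * Real.exp (-(1 * p.2.1)) *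
    Real.exp (-(y.1 ^ 2 * (1 + p.1) * p.2.2)) * hweight

lemma integrable_jacquetKernel (hy₁ : 0 < y.1) (hy₂ : 0 < y.2) (ha : 1 / 2 < a.re)
    (hb : 1 / 2 < b.re) (ξ : ℝ) :
    Integrable (Function.uncurry (jacquetKernel y a b ξ))
      (octMeas.prod (volume : Measure (ℝ × ℝ × ℝ))) := by
  rw [integrable_prod_iff (measurable_jacquetKernel y a b ξ).aestronglyMeasurable]
  constructor
  · filter_upwards [ae_octMeas_pos] with p ⟨hv, hm, hw⟩
    exact integrable_jacquetKernel_right hy₁ hy₂ ξ hv hm hw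
  · refine ((integrable_octant (A := y.1 ^ 2) (x := a.re - 1 / 2) (z := a.re + b.re - 1)
      (by positivity) (by linarith) (by linarith)).const_mul (π * √π * y.2 ^ 2)).congr ?_
    filter_upwards [ae_octMeas_pos] with p ⟨hv, hm, hw⟩
    exact (integral_norm_jacquetKernel hy₁ hy₂ ξ hv hm hw).symm

lemma integral_jacquetKernel_quadrant (hy₁ : 0 < y.1) (hy₂ : 0 < y.2)
    (hab : 1 / 2 < (a + b).re) (x : ℝ × ℝ × ℝ) {v : ℝ} (hv : 0 < v) :
    ∫ q : ℝ × ℝ, jacquetKernel y a b 0 (v, q) x ∂(posMeas.prod posMeas) =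
      ((y.2 ^ 2 : ℝ) : ℂ) ^ (a + b) * (Complex.Gamma (a + b) * Complex.Gamma (a + b - 1 / 2)) *
      ((v : ℂ) ^ (a - 1) *
        ((v * minorNormSq y x + rowNormSq y x : ℝ) : ℂ) ^ (-(a + b))) := by
  have hn := shearForm_pos hy₁ hv x.1
  set n := shearForm y v x.1 with hn_def
  have hD : 0 < v * minorNormSq y x + rowNormSq y x := by
    have hrow := rowNormSq_pos hy₁ hy₂ x
    have hminor := minorNormSq_pos hy₁ hy₂ x
    exact add_pos (mul_pos hv hminor) hrow
  set D := v * minorNormSq y x + rowNormSq y x with hD_def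
  have hseparate (q : ℝ × ℝ) : jacquetKernel y a b 0 (v, q) x =
      ((v : ℂ) ^ (a - 1) * ((n ^ (-(1 / 2) : ℝ) : ℝ) : ℂ)) *
        (((q.1 : ℂ) ^ (a + b - 1) * Complex.exp (-(((D / (y.2 ^ 2 * n) : ℝ) : ℂ) * q.1))) *
        ((q.2 : ℂ) ^ (a + b - 1 / 2 - 1) * Complex.exp (-((n : ℂ) * q.2)))) := by
    simp only [jacquetKernel, jacquetWeight, jacquetExp, ← hn_def, ← hD_def, Complex.ofReal_zero,
      mul_zero, zero_mul, Complex.exp_zero, mul_one, Complex.ofReal_mul, Complex.ofReal_exp,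
      Complex.ofReal_neg]
    ring
  have hpow : ((n ^ (-(1 / 2) : ℝ) : ℝ) : ℂ) * (((D / (y.2 ^ 2 * n) : ℝ) : ℂ) ^ (-(a + b)) *
      (n : ℂ) ^ (-(a + b - 1 / 2))) = ((y.2 ^ 2 : ℝ) : ℂ) ^ (a + b) * (D : ℂ) ^ (-(a + b)) := by
    rw [Complex.ofReal_cpow hn.le]
    repeat rw [ofReal_cpow_eq_exp (by positivity)]
    simp only [← Complex.exp_add]
    rw [Real.log_div hD.ne' (by positivity), Real.log_mul (by positivity) hn.ne']
    congr 1
    push_cast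
    ring
  simp only [hseparate]
  rw [integral_const_mul, integral_prod_mul (fun m : ℝ => (m : ℂ) ^ (a + b - 1) *
    Complex.exp (-(((D / (y.2 ^ 2 * n) : ℝ) : ℂ) * m))) (fun w : ℝ =>
      (w : ℂ) ^ (a + b - 1 / 2 - 1) * Complex.exp (-((n : ℂ) * w))),
    integral_cpow_mul_exp (by linarith) (by positivity),
    integral_cpow_mul_exp (by simpa using hab) hn]
  linear_combination ((v : ℂ) ^ (a - 1) * Complex.Gamma (a + b) * Complex.Gamma (a + b - 1 / 2)) *
    hpow

lemma integral_jacquetKernel_octant (hy₁ : 0 < y.1) (hy₂ : 0 < y.2) (ha : 1 / 2 < a.re)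
    (hb : 1 / 2 < b.re) (x : ℝ × ℝ × ℝ)
    (hint : Integrable (fun p => jacquetKernel y a b 0 p x) octMeas) :
    ∫ p, jacquetKernel y a b 0 p x ∂octMeas = ((y.2 ^ 2 : ℝ) : ℂ) ^ (a + b) *
      (((minorNormSq y x : ℝ) : ℂ) ^ (-a) * ((rowNormSq y x : ℝ) : ℂ) ^ (-b)) *
      (Complex.Gamma a * Complex.Gamma b * Complex.Gamma (a + b - 1 / 2)) := by
  have hab : 1 / 2 < (a + b).re := by rw [Complex.add_re]; linarith
  have hΓ : Complex.Gamma (a + b) ≠ 0 := Complex.Gamma_ne_zero_of_re_pos (by linarith)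
  have hinner : ∀ᵐ v ∂posMeas, _ := ae_posMeas_pos.mono fun v hv =>
    integral_jacquetKernel_quadrant (a := a) (b := b) hy₁ hy₂ hab x hv
  rw [integral_prod _ hint, integral_congr_ae hinner, integral_const_mul,
    integral_cpow_mul_linear_cpow (by linarith) (by linarith) (minorNormSq_pos hy₁ hy₂ x)
      (rowNormSq_pos hy₁ hy₂ x)]
  field_simp

end JacquetKernel

/-- The entire function of `μ` that continues Jacquet's integral. -/
def whittakerFormula (y : ℝ × ℝ) (μ : Fin 3 → ℂ) : ℂ :=
  (π * √π : ℝ) * (y.1 : ℂ) ^ (1 - μ 2) * (y.2 : ℂ) ^ (1 + μ 2) *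
    gammaFactor μ * tripleInt (y.1 ^ 2, π ^ 2 * y.2 ^ 2, π ^ 2)
      ((μ 0 - μ 1) / 2) ((μ 0 - μ 2) / 2)

section JacquetIntegral

variable {y : ℝ × ℝ} {a b : ℂ}

lemma jacquetKernel_one_eq (y : ℝ × ℝ) (a b : ℂ) (p x : ℝ × ℝ × ℝ) :
    jacquetKernel y a b 1 p x = jacquetKernel y a b 0 p x * psi (1, 1) x := by
  rw [jacquetKernel, jacquetKernel, psi, Complex.ofReal_zero, mul_zero, zero_mul, zero_mul,
    Complex.exp_zero, mul_one]
  congr 2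
  push_cast
  ring

lemma integral_powers_mul_psi (hy₁ : 0 < y.1) (hy₂ : 0 < y.2) (ha : 1 / 2 < a.re)
    (hb : 1 / 2 < b.re) :
    ((y.2 ^ 2 : ℝ) : ℂ) ^ (a + b) *
      (Complex.Gamma a * Complex.Gamma b * Complex.Gamma (a + b - 1 / 2)) *
      ∫ x : ℝ × ℝ × ℝ, ((minorNormSq y x : ℝ) : ℂ) ^ (-a) * ((rowNormSq y x : ℝ) : ℂ) ^ (-b) *
        psi (1, 1) x =
    (π * √π * y.2 ^ 2 : ℝ) *
      tripleInt (y.1 ^ 2, π ^ 2 * y.2 ^ 2, π ^ 2) (a - 1 / 2) (a + b - 1) := by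
  have hinner : ∀ᵐ x : ℝ × ℝ × ℝ, ((y.2 ^ 2 : ℝ) : ℂ) ^ (a + b) *
      (Complex.Gamma a * Complex.Gamma b * Complex.Gamma (a + b - 1 / 2)) *
      (((minorNormSq y x : ℝ) : ℂ) ^ (-a) * ((rowNormSq y x : ℝ) : ℂ) ^ (-b) * psi (1, 1) x) =
      ∫ p, jacquetKernel y a b 1 p x ∂octMeas := by
    filter_upwards [(integrable_jacquetKernel hy₁ hy₂ ha hb 0).prod_left_ae] with x hx
    simp only [jacquetKernel_one_eq]
    rw [integral_mul_const, integral_jacquetKernel_octant hy₁ hy₂ ha hb x hx]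
    ring
  rw [← integral_const_mul, integral_congr_ae hinner, ← integral_integral_swap
    (f := jacquetKernel y a b 1) (integrable_jacquetKernel hy₁ hy₂ ha hb 1), tripleInt,
    ← integral_const_mul]
  refine integral_congr_ae ?_
  filter_upwards [ae_octMeas_pos] with p ⟨hv, hm, hw⟩
  rw [integral_jacquetKernel hy₁ hy₂ 1 hv hm hw, one_pow, mul_one]

lemma jacquetIntegral_torus {μ : Fin 3 → ℂ} (hy₁ : 0 < y.1) (hy₂ : 0 < y.2)
    (hμ : μ 0 + μ 1 + μ 2 = 0) :
    jacquetIntegral (torus y) μ (1, 1) = (y.1 : ℂ) ^ (1 - μ 2) * (y.2 : ℂ) ^ (1 + μ 0) *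
      ∫ x : ℝ × ℝ × ℝ, ((minorNormSq y x : ℝ) : ℂ) ^ (-((1 + μ 0 - μ 1) / 2)) *
        ((rowNormSq y x : ℝ) : ℂ) ^ (-((1 + μ 1 - μ 2) / 2)) * psi (1, 1) x := by
  rw [← integral_const_mul, jacquetIntegral]
  simp only [powerFn_longWeyl_mul hy₁ hy₂ _ hμ]
  simp only [mul_assoc]

lemma sq_cpow_eq {r : ℝ} (hr : 0 < r) (s t : ℂ) :
    ((r ^ 2 : ℝ) : ℂ) ^ (1 + (s - t) / 2) =
      (r : ℂ) ^ 2 * ((r : ℂ) ^ (1 + s) * ((r : ℂ) ^ (1 + t))⁻¹) := by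
  rw [← Complex.cpow_ofNat, ← Complex.cpow_neg]
  repeat rw [ofReal_cpow_eq_exp (by positivity)]
  rw [Real.log_pow, ← Complex.exp_add, ← Complex.exp_add]
  congr 1
  push_cast
  ring

lemma jacquetIntegral_eq {μ : Fin 3 → ℂ} (hy₁ : 0 < y.1) (hy₂ : 0 < y.2)
    (hμ : μ 0 + μ 1 + μ 2 = 0) (h₀₁ : (μ 1).re < (μ 0).re) (h₁₂ : (μ 2).re < (μ 1).re) :
    jacquetIntegral (torus y) μ (1, 1) = whittakerFormula y μ := by
  have hhalf {s t : ℂ} (hst : t.re < s.re) : 1 / 2 < ((1 + s - t) / 2).re := by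
    rw [Complex.div_ofNat_re, Complex.sub_re, Complex.add_re, Complex.one_re]
    linarith
  have hΓ {s t : ℂ} (hst : t.re < s.re) : Complex.Gamma ((1 + s - t) / 2) ≠ 0 :=
    Complex.Gamma_ne_zero_of_re_pos (one_half_pos.trans (hhalf hst))
  have hpowers := integral_powers_mul_psi hy₁ hy₂ (hhalf h₀₁) (hhalf h₁₂)
  rw [show (1 + μ 0 - μ 1) / 2 + (1 + μ 1 - μ 2) / 2 = 1 + (μ 0 - μ 2) / 2 by ring,
    show (1 + μ 0 - μ 1) / 2 - 1 / 2 = (μ 0 - μ 1) / 2 by ring,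
    show 1 + (μ 0 - μ 2) / 2 - 1 / 2 = (1 + μ 0 - μ 2) / 2 by ring, add_sub_cancel_left,
    sq_cpow_eq hy₂, Complex.ofReal_mul _ (y.2 ^ 2), Complex.ofReal_pow] at hpowers
  have hy₂_ne : (y.2 : ℂ) ≠ 0 := Complex.ofReal_ne_zero.2 hy₂.ne'
  have hΓ₀₁ := hΓ h₀₁
  have hΓ₁₂ := hΓ h₁₂
  have hΓ₀₂ := hΓ (h₁₂.trans h₀₁)
  rw [jacquetIntegral_torus hy₁ hy₂ hμ, whittakerFormula, gammaFactor]
  have hpow_ne : (y.2 : ℂ) ^ (1 + μ 2) ≠ 0 := by simp [Complex.cpow_eq_zero_iff, hy₂_ne]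
  field_simp at hpowers ⊢
  linear_combination (y.1 : ℂ) ^ (1 - μ 2) * hpowers

end JacquetIntegral

lemma eq_of_eq_on_chamber {F G : ℂ × ℂ → ℂ} (hF : Differentiable ℂ F) (hG : Differentiable ℂ G)
    (h : ∀ a b : ℂ, b.re < a.re → (-a - b).re < b.re → F (a, b) = G (a, b)) : F = G := by
  funext ⟨a, b⟩
  let line : ℂ → ℂ × ℂ := fun t => (1 + t * (a - 1), t * b)
  have hline : Differentiable ℂ line := by fun_prop
  have hanalytic {H : ℂ × ℂ → ℂ} (hH : Differentiable ℂ H) :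
      AnalyticOnNhd ℂ (H ∘ line) Set.univ :=
    (hH.comp hline).differentiableOn.analyticOnNhd isOpen_univ
  have hfst : Tendsto (fun t => (line t).1.re) (𝓝 0) (𝓝 1) := by
    have hcont : Continuous fun t => (line t).1.re := by fun_prop
    simpa [line] using hcont.tendsto 0
  have hsnd : Tendsto (fun t => (line t).2.re) (𝓝 0) (𝓝 0) := by
    have hcont : Continuous fun t => (line t).2.re := by fun_prop
    simpa [line] using hcont.tendsto 0
  have heq_near : F ∘ line =ᶠ[𝓝 0] G ∘ line := by
    filter_upwards [hfst.eventually_const_lt (show (1 / 2 : ℝ) < 1 by norm_num),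
      hsnd.eventually_lt_const (show (0 : ℝ) < 1 / 4 by norm_num),
      hsnd.eventually_const_lt (show (-(1 / 4) : ℝ) < 0 by norm_num)] with t ht₁ ht₂ ht₃
    refine h (line t).1 (line t).2 (by linarith) ?_
    rw [Complex.sub_re, Complex.neg_re]
    linarith
  simpa [line] using
    congrFun ((hanalytic hF).eq_of_eventuallyEq (hanalytic hG) heq_near) 1

section Continuation

variable {y : ℝ × ℝ}

lemma differentiable_whittakerFormula (hy₁ : 0 < y.1) (hy₂ : 0 < y.2) :
    Differentiable ℂ fun q : ℂ × ℂ => whittakerFormula y ![q.1, q.2, -q.1 - q.2] := by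
  have htriple : Differentiable ℂ fun q : ℂ × ℂ =>
      tripleInt (y.1 ^ 2, π ^ 2 * y.2 ^ 2, π ^ 2) ((q.1 - q.2) / 2) ((q.1 - (-q.1 - q.2)) / 2) :=
    (differentiable_tripleInt (y := (y.1 ^ 2, π ^ 2 * y.2 ^ 2, π ^ 2)) (by positivity)
      (by positivity) (by positivity)).comp
      (f := fun q : ℂ × ℂ => ((q.1 - q.2) / 2, (q.1 - (-q.1 - q.2)) / 2)) (by fun_prop)
  have hΓ {f : ℂ × ℂ → ℂ} (hf : Differentiable ℂ f) :
      Differentiable ℂ fun q => (Complex.Gamma (f q))⁻¹ :=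
    Complex.differentiable_one_div_Gamma.comp hf
  have hpow {r : ℝ} (hr : 0 < r) {f : ℂ × ℂ → ℂ} (hf : Differentiable ℂ f) :
      Differentiable ℂ fun q => (r : ℂ) ^ f q :=
    hf.const_cpow (Or.inl (Complex.ofReal_ne_zero.2 hr.ne'))
  simp only [whittakerFormula, gammaFactor, Matrix.cons_val_zero, Matrix.cons_val_one,
    Matrix.cons_val]
  refine ((((differentiable_const _).mul (hpow hy₁ ?_)).mul (hpow hy₂ ?_)).mul
    (((hΓ ?_).mul (hΓ ?_)).mul (hΓ ?_))).mul htriple <;> fun_prop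

lemma isJacquetContinuation_whittakerFormula (hy₁ : 0 < y.1) (hy₂ : 0 < y.2) :
    IsJacquetContinuation (torus y) (1, 1)
      fun q => whittakerFormula y ![q.1, q.2, -q.1 - q.2] :=
  ⟨differentiable_whittakerFormula hy₁ hy₂, fun a b hab hb =>
    (jacquetIntegral_eq hy₁ hy₂ (by simp) (by simpa using hab) (by simpa using hb)).symm⟩

lemma whittaker_eq_whittakerFormula {μ : Fin 3 → ℂ} (hy₁ : 0 < y.1) (hy₂ : 0 < y.2)
    (hμ : μ 0 + μ 1 + μ 2 = 0) : whittaker (torus y) μ (1, 1) = whittakerFormula y μ := by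
  have hformula := isJacquetContinuation_whittakerFormula hy₁ hy₂
  have hexists : ∃ F, IsJacquetContinuation (torus y) (1, 1) F := ⟨_, hformula⟩
  have hμ_eq : ![μ 0, μ 1, -μ 0 - μ 1] = μ := by
    rw [show -μ 0 - μ 1 = μ 2 by linear_combination -hμ]
    exact (List.ofFn_inj.1 rfl)
  rw [whittaker, dif_pos hexists, eq_of_eq_on_chamber hexists.choose_spec.1 hformula.1
    fun a b hab hb => (hexists.choose_spec.2 a b hab hb).trans (hformula.2 a b hab hb).symm]
  simp only [hμ_eq]

end Continuation

/-! ### Pointwise bounds for the Jacquet-Whittaker function -/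

lemma norm_Gamma_eq_of_im_eq_or {z : ℂ} {a b : ℝ} (hre : z.re = a) (him : z.im = b ∨ z.im = -b) :
    ‖Complex.Gamma z‖ = ‖Complex.Gamma (a + (b : ℝ) * I)‖ := by
  rcases him with him | him
  · congr 2
    apply Complex.ext <;> simp [hre, him]
  · rw [← Complex.norm_conj, ← Complex.Gamma_conj]
    congr 2
    apply Complex.ext <;> simp [hre, him]

lemma integral_prod_comp_sub_sub {E : Type*} [NormedAddCommGroup E] [NormedSpace ℝ E]
    (f : ℝ × ℝ → E) (s t : ℝ) : ∫ p : ℝ × ℝ, f (p.1 - s, t - p.2) = ∫ p, f p :=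
  MeasurePreserving.integral_comp'
    (f := (MeasurableEquiv.subRight s).prodCongr (MeasurableEquiv.subLeft t))
    ((measurePreserving_sub_right volume s).prod (Measure.measurePreserving_sub_left volume t)) f

section TripleInt

variable {α β τ : Fin 3 → ℝ} {g δ e : ℝ} {x z : ℂ} {y : ℝ × ℝ × ℝ}

lemma norm_mbCoeff (hy₁ : 0 < y.1) (hy₂ : 0 < y.2.1) (hy₃ : 0 < y.2.2) (z : ℂ) (σ σ' : ℝ)
    (p : ℝ × ℝ) :
    ‖mbCoeff y z σ σ' p‖ = y.2.1 ^ (-σ') * y.1 ^ (-(σ + z.re)) * y.2.2 ^ (-σ) *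
      (‖Complex.Gamma (σ + p.1 * I)‖ * ‖Complex.Gamma (z + (σ + p.1 * I))‖ *
        (‖Complex.Gamma (σ' + p.2 * I)‖ * ‖Complex.Gamma (z + (σ' + p.2 * I))‖)) := by
  simp only [mbCoeff, norm_mul]
  rw [Complex.norm_cpow_eq_rpow_re_of_pos hy₁, Complex.norm_cpow_eq_rpow_re_of_pos hy₂,
    Complex.norm_cpow_eq_rpow_re_of_pos hy₃]
  simp [add_comm]

/-- Reflecting the second contour makes the six Gamma factors of the Mellin–Barnes integrand
symmetric in the indices. -/
lemma norm_mellinBarnes_integrand_eq (hadd : ∀ i, α i + β i = g) (hxre : x.re = α 1 - α 0)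
    (hxim : x.im = τ 0 - τ 1) (hzre : z.re = α 2 - α 0) (hzim : z.im = τ 0 - τ 2) (hy₁ : 0 < y.1)
    (hy₂ : 0 < y.2.1) (hy₃ : 0 < y.2.2) (p : ℝ × ℝ) :
    ‖Complex.Gamma (x + (α 0 + (p.1 - τ 0 : ℝ) * I)) *
      Complex.Gamma (z - x + (β 2 + (τ 2 - p.2 : ℝ) * I)) *
      (Complex.Gamma (z + (α 0 + (p.1 - τ 0 : ℝ) * I) + (β 2 + (τ 2 - p.2 : ℝ) * I)))⁻¹ *
      mbCoeff y z (α 0) (β 2) (p.1 - τ 0, τ 2 - p.2)‖ =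
    y.2.1 ^ (-β 2) * y.1 ^ (-α 2) * y.2.2 ^ (-α 0) * mbWeight α β τ g p.1 p.2 := by
  have h₀ := hadd 0
  have h₁ := hadd 1
  have h₂ := hadd 2
  rw [norm_mul, norm_mul, norm_mul, norm_inv, norm_mbCoeff hy₁ hy₂ hy₃]
  dsimp only
  rw [norm_Gamma_eq_of_im_eq_or (a := α 1) (b := p.1 - τ 1)
      (z := x + (α 0 + (p.1 - τ 0 : ℝ) * I)) (by simp [hxre]) (by simp [hxim]),
    norm_Gamma_eq_of_im_eq_or (a := β 1) (b := p.2 - τ 1)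
      (z := z - x + (β 2 + (τ 2 - p.2 : ℝ) * I)) (by simp [hxre, hzre]; linarith)
      (by simp [hxim, hzim]),
    norm_Gamma_eq_of_im_eq_or (a := g) (b := p.1 - p.2)
      (z := z + (α 0 + (p.1 - τ 0 : ℝ) * I) + (β 2 + (τ 2 - p.2 : ℝ) * I))
      (by simp [hzre]; linarith) (by simp [hzim]),
    norm_Gamma_eq_of_im_eq_or (a := α 2) (b := p.1 - τ 2)
      (z := z + (α 0 + (p.1 - τ 0 : ℝ) * I)) (by simp [hzre]) (by simp [hzim]),
    norm_Gamma_eq_of_im_eq_or (a := β 2) (b := p.2 - τ 2)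
      (z := β 2 + (τ 2 - p.2 : ℝ) * I) (by simp) (by simp),
    norm_Gamma_eq_of_im_eq_or (a := β 0) (b := p.2 - τ 0)
      (z := z + (β 2 + (τ 2 - p.2 : ℝ) * I)) (by simp [hzre]; linarith) (by simp [hzim]),
    hzre, add_sub_cancel, mbWeight, Fin.prod_univ_three, Fin.prod_univ_three, norm_inv]
  ring

lemma exists_norm_tripleInt_le (he : 0 < e) (H : Exponents α β g δ) :
    ∃ C : ℝ, 0 ≤ C ∧ ∀ τ : Fin 3 → ℝ, ∃ w : Equiv.Perm (Fin 3), Antitone (τ ∘ w) ∧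
      ∀ x z : ℂ, x.re = α 1 - α 0 → x.im = τ 0 - τ 1 → z.re = α 2 - α 0 → z.im = τ 0 - τ 2 →
      ∀ y : ℝ × ℝ × ℝ, 0 < y.1 → 0 < y.2.1 → 0 < y.2.2 → ‖tripleInt y x z‖ ≤
        C * (y.2.1 ^ (-β 2) * y.1 ^ (-α 2) * y.2.2 ^ (-α 0)) *
          Real.exp (boundLog (τ ∘ w) g δ e - π / 2 * gapSum τ) := by
  obtain ⟨C, hC, hbound⟩ := exists_norm_integral_le_of_norm_le_mbWeight he H
  refine ⟨1 / (2 * π) * (1 / (2 * π)) * C, by positivity, fun τ => ?_⟩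
  obtain ⟨w, hw, hintegral⟩ := hbound τ
  refine ⟨w, hw, fun x z hxre hxim hzre hzim y hy₁ hy₂ hy₃ => ?_⟩
  have h₁ := H.pos_left 1
  have h₂ := H.pos_left 2
  have h₀' := H.pos_right 0
  have h₁' := H.pos_right 1
  have hadd₀ := H.add_eq 0
  have hadd₁ := H.add_eq 1
  have hadd₂ := H.add_eq 2
  rw [tripleInt_eq_mellinBarnes hy₁ hy₂ hy₃ (H.pos_left 0) (H.pos_right 2) (by linarith)
    (by linarith) (by linarith) (by linarith), ← integral_prod_comp_sub_sub _ (τ 0) (τ 2)]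
  set f : ℝ × ℝ → ℂ := fun p => Complex.Gamma (x + (α 0 + (p.1 - τ 0 : ℝ) * I)) *
      Complex.Gamma (z - x + (β 2 + (τ 2 - p.2 : ℝ) * I)) *
      (Complex.Gamma (z + (α 0 + (p.1 - τ 0 : ℝ) * I) + (β 2 + (τ 2 - p.2 : ℝ) * I)))⁻¹ *
      mbCoeff y z (α 0) (β 2) (p.1 - τ 0, τ 2 - p.2)
  set D := y.2.1 ^ (-β 2) * y.1 ^ (-α 2) * y.2.2 ^ (-α 0)
  have hD : 0 < D := by positivity
  have hf (p : ℝ × ℝ) : ‖(D : ℂ)⁻¹ * f p‖ = mbWeight α β τ g p.1 p.2 := by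
    rw [norm_mul, norm_mellinBarnes_integrand_eq H.add_eq hxre hxim hzre hzim hy₁ hy₂ hy₃,
      norm_inv, Complex.norm_real, Real.norm_of_nonneg hD.le, inv_mul_cancel_left₀ hD.ne']
  have hle := hintegral _ fun p => (hf p).le
  rw [integral_const_mul, norm_mul, norm_inv, Complex.norm_real, Real.norm_of_nonneg hD.le,
    inv_mul_le_iff₀ hD] at hle
  rw [norm_mul, ← Complex.ofReal_mul, Complex.norm_real, Real.norm_of_nonneg (by positivity)]
  exact (mul_le_mul_of_nonneg_left hle (by positivity)).trans_eq (by ring)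

end TripleInt

lemma rpow_mul_tripleInt_powers {y₁ y₂ : ℝ} (hy₁ : 0 < y₁) (hy₂ : 0 < y₂) (σ₁ σ₂ a b : ℝ) :
    y₁ ^ (1 - b) * y₂ ^ (1 + b) * ((π ^ 2 * y₂ ^ 2) ^ (-((σ₂ + b) / 2)) *
      (y₁ ^ 2) ^ (-((σ₁ - b) / 2)) * (π ^ 2) ^ (-((σ₁ - a) / 2))) =
    π ^ (a - b - σ₁ - σ₂) * (y₁ ^ (1 - σ₁) * y₂ ^ (1 - σ₂)) := by
  have hπ := Real.pi_pos
  rw [Real.mul_rpow (by positivity) (by positivity), ← Real.rpow_natCast_mul hπ.le,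
    ← Real.rpow_natCast_mul hπ.le, ← Real.rpow_natCast_mul hy₁.le, ← Real.rpow_natCast_mul hy₂.le,
    Nat.cast_ofNat, show a - b - σ₁ - σ₂ = 2 * -((σ₂ + b) / 2) + 2 * -((σ₁ - a) / 2) by ring,
    show 1 - σ₁ = 1 - b + 2 * -((σ₁ - b) / 2) by ring,
    show 1 - σ₂ = 1 + b + 2 * -((σ₂ + b) / 2) by ring, Real.rpow_add hπ,
    Real.rpow_add hy₁ (1 - b), Real.rpow_add hy₂ (1 + b)]
  ring

section WhittakerFormula

variable {η : Fin 3 → ℝ}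

lemma exists_norm_whittakerFormula_le {σ₁ σ₂ δ e : ℝ} (he : 0 < e)
    (H : Exponents (fun i => (σ₁ - η i) / 2) (fun i => (σ₂ + η i) / 2) ((σ₁ + σ₂) / 2) δ) :
    ∃ C : ℝ, 0 ≤ C ∧ ∀ μ : Fin 3 → ℂ, (∀ i, (μ i).re = η i) → ∃ w : Equiv.Perm (Fin 3),
      Antitone ((fun i => (μ i).im / 2) ∘ w) ∧ ∀ y : ℝ × ℝ, 0 < y.1 → 0 < y.2 →
      ‖whittakerFormula y μ‖ ≤ C * (y.1 ^ (1 - σ₁) * y.2 ^ (1 - σ₂)) *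
        (Real.exp (boundLog ((fun i => (μ i).im / 2) ∘ w) ((σ₁ + σ₂) / 2) δ e) /
          LambdaPoly μ) := by
  obtain ⟨C, hC, htriple⟩ := exists_norm_tripleInt_le he H
  obtain ⟨K, hK, hgamma⟩ := exists_norm_gammaFactor_le η
  refine ⟨π * √π * K * C * π ^ (η 0 - η 2 - σ₁ - σ₂), by positivity, fun μ hμ => ?_⟩
  set τ : Fin 3 → ℝ := fun i => (μ i).im / 2
  obtain ⟨w, hw, hbound⟩ := htriple τ
  refine ⟨w, hw, fun y hy₁ hy₂ => ?_⟩
  have htriple_le := hbound ((μ 0 - μ 1) / 2) ((μ 0 - μ 2) / 2) (by simp [hμ]; ring)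
    (by simp [τ]; ring) (by simp [hμ]; ring) (by simp [τ]; ring)
    (y.1 ^ 2, π ^ 2 * y.2 ^ 2, π ^ 2) (by positivity) (by positivity) (by positivity)
  rw [whittakerFormula, norm_mul, norm_mul, norm_mul, norm_mul, Complex.norm_real,
    Complex.norm_cpow_eq_rpow_re_of_pos hy₁, Complex.norm_cpow_eq_rpow_re_of_pos hy₂,
    Complex.sub_re, Complex.add_re, Complex.one_re, hμ, Real.norm_of_nonneg (by positivity)]
  have _ : 0 < LambdaPoly μ := Mpoly_pos _ _ _ _
  grw [hgamma μ hμ, htriple_le]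
  refine le_of_eq ?_
  have hpow := rpow_mul_tripleInt_powers hy₁ hy₂ σ₁ σ₂ (η 0) (η 2)
  have hexp : Real.exp (π / 2 * gapSum τ) *
      Real.exp (boundLog (τ ∘ w) ((σ₁ + σ₂) / 2) δ e - π / 2 * gapSum τ) =
      Real.exp (boundLog (τ ∘ w) ((σ₁ + σ₂) / 2) δ e) := by
    rw [← Real.exp_add, add_sub_cancel]
  rw [← hexp, div_eq_mul_inv _ (LambdaPoly μ)]
  linear_combination (π * √π * K * C * (LambdaPoly μ)⁻¹ * (Real.exp (π / 2 * gapSum τ) *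
    Real.exp (boundLog (τ ∘ w) ((σ₁ + σ₂) / 2) δ e - π / 2 * gapSum τ))) * hpow

lemma deltaExp_le (s₁ s₂ : ℝ) (μ : Fin 3 → ℂ) (i : Fin 3) :
    deltaExp s₁ s₂ μ ≤ (2 * s₁ + (μ i).re) / 2 ∧ deltaExp s₁ s₂ μ ≤ (s₁ - (μ i).re) / 2 ∧
      deltaExp s₁ s₂ μ ≤ (2 * s₂ - (μ i).re) / 2 ∧ deltaExp s₁ s₂ μ ≤ (s₂ + (μ i).re) / 2 := by
  have h := Finset.inf'_le (fun i : Fin 3 =>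
    min (min ((2 * s₁ + (μ i).re) / 2) ((s₁ - (μ i).re) / 2))
      (min ((2 * s₂ - (μ i).re) / 2) ((s₂ + (μ i).re) / 2))) (Finset.mem_univ i)
  simpa only [deltaExp, le_min_iff, and_assoc] using h

lemma deltaExp_congr {s₁ s₂ : ℝ} {μ ν : Fin 3 → ℂ} (h : ∀ i, (μ i).re = (ν i).re) :
    deltaExp s₁ s₂ μ = deltaExp s₁ s₂ ν := by
  simp only [deltaExp, h]

lemma exponents_of_abs_le {s₁ s₂ e θ₁ θ₂ : ℝ} {μ : Fin 3 → ℂ} (hμ : μ 0 + μ 1 + μ 2 = 0)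
    (h₁ : ∀ i, e < s₁ - (μ i).re) (h₂ : ∀ i, e < s₂ + (μ i).re) (hθ₁ : |θ₁| ≤ e) (hθ₂ : |θ₂| ≤ e) :
    Exponents (fun i => (s₁ + θ₁ - (μ i).re) / 2) (fun i => (s₂ + θ₂ + (μ i).re) / 2)
      ((s₁ + θ₁ + (s₂ + θ₂)) / 2) (deltaExp s₁ s₂ μ - e) := by
  have hsum : (μ 0).re + (μ 1).re + (μ 2).re = 0 := by simpa using congrArg Complex.re hμ
  have _ : 0 ≤ e := (abs_nonneg _).trans hθ₁
  obtain ⟨hθ₁', -⟩ := abs_le.1 hθ₁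
  obtain ⟨hθ₂', -⟩ := abs_le.1 hθ₂
  have hδ := deltaExp_le s₁ s₂ μ
  obtain ⟨hleft₀, _, hright₀, -⟩ := hδ 0
  obtain ⟨hleft₁, -, hright₁, -⟩ := hδ 1
  obtain ⟨hleft₂, -, hright₂, -⟩ := hδ 2
  constructor
  case pos_left => exact fun i => by linarith [h₁ i]
  case pos_right => exact fun i => by linarith [h₂ i]
  case add_eq => exact fun i => by ring
  case le_left | le_right =>
    intro i j hij
    fin_cases i <;> fin_cases j <;> simp at hij ⊢ <;> linarith
  case le_add_half => linarith [h₁ 0, h₂ 0]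

lemma exists_norm_whittakerFormula_le_Msym {s₁ s₂ e ε θ₁ θ₂ : ℝ} (he : 0 < e) (heε : 4 * e ≤ ε)
    (hη : η 0 + η 1 + η 2 = 0) (h₁ : ∀ i, e < s₁ - η i) (h₂ : ∀ i, e < s₂ + η i)
    (hθ₁ : |θ₁| ≤ e) (hθ₂ : |θ₂| ≤ e) :
    ∃ C : ℝ, 0 ≤ C ∧ ∀ μ : Fin 3 → ℂ, (∀ i, (μ i).re = η i) → ∀ y : ℝ × ℝ, 0 < y.1 → 0 < y.2 →
      ‖whittakerFormula y μ‖ ≤ C * (y.1 ^ (1 - (s₁ + θ₁)) * y.2 ^ (1 - (s₂ + θ₂))) *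
        (Msym ε (s₁ + s₂ - 1 / 2) (deltaExp s₁ s₂ μ) μ / LambdaPoly μ) := by
  set δ := deltaExp s₁ s₂ (fun i => (η i : ℂ))
  have H : Exponents (fun i => (s₁ + θ₁ - η i) / 2) (fun i => (s₂ + θ₂ + η i) / 2)
      ((s₁ + θ₁ + (s₂ + θ₂)) / 2) (δ - e) :=
    exponents_of_abs_le (μ := fun i => (η i : ℂ)) (by exact_mod_cast hη) h₁ h₂ hθ₁ hθ₂
  obtain ⟨A, hA, hformula⟩ := exists_norm_whittakerFormula_le he H
  obtain ⟨B, hB, hMsym⟩ := exists_exp_boundLog_le_Msym (g := (s₁ + θ₁ + (s₂ + θ₂)) / 2)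
    (δ₀ := δ - e) (δ := δ) (e := e) (κ := s₁ + s₂ - 1 / 2) (ε := ε)
    (by linarith [(abs_le.1 hθ₁).2, (abs_le.1 hθ₂).2]) (by linarith)
  refine ⟨A * B, by positivity, fun μ hμ y hy₁ hy₂ => ?_⟩
  obtain ⟨w, hw, hle⟩ := hformula μ hμ
  have _ : 0 < LambdaPoly μ := Mpoly_pos _ _ _ _
  rw [deltaExp_congr (ν := fun i => (η i : ℂ)) hμ]
  grw [hle y hy₁ hy₂, hMsym μ w hw]
  exact le_of_eq (by ring)

end WhittakerFormula

/-! ### Integration over the torus -/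

/-- The function equal to `t ^ (e - 1)` on `(0, 1]` and to `t ^ (-e - 1)` on `(1, ∞)`: the better
of the two bounds obtained by shifting a contour by `± e`. -/
def splitPower (e t : ℝ) : ℝ := if t ≤ 1 then t ^ (e - 1) else t ^ (-e - 1)

lemma integrableOn_splitPower {e : ℝ} (he : 0 < e) :
    IntegrableOn (splitPower e) (Set.Ioi 0) := by
  have hsmall : IntegrableOn (fun t : ℝ => t ^ (e - 1)) (Set.Ioc 0 1) :=
    (intervalIntegrable_iff_integrableOn_Ioc_of_le zero_le_one).1
      (intervalIntegral.intervalIntegrable_rpow' (by linarith))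
  have hlarge : IntegrableOn (fun t : ℝ => t ^ (-e - 1)) (Set.Ioi 1) :=
    integrableOn_Ioi_rpow_of_lt (by linarith) zero_lt_one
  rw [← Set.Ioc_union_Ioi_eq_Ioi zero_le_one]
  exact (hsmall.congr_fun (fun t ht => (if_pos ht.2).symm) measurableSet_Ioc).union
    (hlarge.congr_fun (fun t ht => (if_neg (not_le.2 ht)).symm) measurableSet_Ioi)

lemma exists_splitPower_eq_rpow (e t : ℝ) :
    ∃ θ ∈ ({e, -e} : Finset ℝ), splitPower e t = t ^ (-θ - 1) := by
  unfold splitPower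
  split_ifs
  · exact ⟨-e, by simp, by rw [neg_neg]⟩
  · exact ⟨e, by simp, rfl⟩

lemma rpow_mul_rpow_shift {r : ℝ} (hr : 0 < r) (s θ : ℝ) :
    r ^ (1 - (s + θ)) * r ^ (s + 1) = r ^ 3 * r ^ (-θ - 1) := by
  rw [← Real.rpow_natCast r 3, ← Real.rpow_add hr, ← Real.rpow_add hr]
  congr 1
  push_cast
  ring

lemma exists_norm_whittaker_mul_le_splitPower {s₁ s₂ e ε : ℝ} {η : Fin 3 → ℝ} (he : 0 < e)
    (heε : 4 * e ≤ ε) (hη : η 0 + η 1 + η 2 = 0) (h₁ : ∀ i, e < s₁ - η i)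
    (h₂ : ∀ i, e < s₂ + η i) :
    ∃ C : ℝ, ∀ μ : Fin 3 → ℂ, μ 0 + μ 1 + μ 2 = 0 → (∀ i, (μ i).re = η i) →
      ∀ y : ℝ × ℝ, 0 < y.1 → 0 < y.2 →
      ‖whittaker (torus y) μ (1, 1)‖ * y.1 ^ (s₁ + 1) * y.2 ^ (s₂ + 1) ≤
        C * (Msym ε (s₁ + s₂ - 1 / 2) (deltaExp s₁ s₂ μ) μ / LambdaPoly μ) *
          ((y.1 * y.2) ^ 3 * (splitPower e y.1 * splitPower e y.2)) := by
  have habs {θ : ℝ} (hθ : θ ∈ ({e, -e} : Finset ℝ)) : |θ| ≤ e := by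
    rw [Finset.mem_insert, Finset.mem_singleton, ← abs_eq he.le] at hθ
    exact hθ.le
  choose! C hC hbound using fun (θ : ℝ × ℝ) (hθ : θ ∈ ({e, -e} ×ˢ {e, -e} : Finset (ℝ × ℝ))) =>
    exists_norm_whittakerFormula_le_Msym he heε hη h₁ h₂ (habs (Finset.mem_product.1 hθ).1)
      (habs (Finset.mem_product.1 hθ).2)
  refine ⟨∑ θ ∈ {e, -e} ×ˢ {e, -e}, C θ, fun μ hsum hμ y hy₁ hy₂ => ?_⟩
  have hM : 0 ≤ Msym ε (s₁ + s₂ - 1 / 2) (deltaExp s₁ s₂ μ) μ / LambdaPoly μ :=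
    div_nonneg (Msym_pos _ _ _ _).le (Mpoly_pos _ _ _ _).le
  obtain ⟨θ₁, hθ₁, hsplit₁⟩ := exists_splitPower_eq_rpow e y.1
  obtain ⟨θ₂, hθ₂, hsplit₂⟩ := exists_splitPower_eq_rpow e y.2
  have hθ := Finset.mk_mem_product hθ₁ hθ₂
  rw [whittaker_eq_whittakerFormula hy₁ hy₂ hsum, hsplit₁, hsplit₂]
  grw [hbound _ hθ μ hμ y hy₁ hy₂, Finset.single_le_sum hC hθ]
  refine le_of_eq ?_
  have hrpow₁ := rpow_mul_rpow_shift hy₁ s₁ θ₁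
  have hrpow₂ := rpow_mul_rpow_shift hy₂ s₂ θ₂
  linear_combination ((∑ θ ∈ {e, -e} ×ˢ {e, -e}, C θ) *
    (Msym ε (s₁ + s₂ - 1 / 2) (deltaExp s₁ s₂ μ) μ / LambdaPoly μ)) *
    (y.2 ^ (1 - (s₂ + θ₂)) * y.2 ^ (s₂ + 1) * hrpow₁ + y.1 ^ 3 * y.1 ^ (-θ₁ - 1) * hrpow₂)

lemma ae_measY_pos : ∀ᵐ y ∂measY, 0 < y.1 ∧ 0 < y.2 :=
  (withDensity_absolutelyContinuous _ _).ae_le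
    (ae_restrict_mem (measurableSet_Ioi.prod measurableSet_Ioi))

lemma measurable_whittakerFormula (μ : Fin 3 → ℂ) :
    Measurable fun y : ℝ × ℝ => whittakerFormula y μ := by
  have htriple : Measurable fun y : ℝ × ℝ => tripleInt (y.1 ^ 2, π ^ 2 * y.2 ^ 2, π ^ 2)
      ((μ 0 - μ 1) / 2) ((μ 0 - μ 2) / 2) :=
    (stronglyMeasurable_tripleInt _ _).measurable.comp
      (f := fun y : ℝ × ℝ => (y.1 ^ 2, π ^ 2 * y.2 ^ 2, π ^ 2)) (by fun_prop)
  unfold whittakerFormula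
  exact Measurable.mul (by fun_prop) htriple

lemma aestronglyMeasurable_whittaker {μ : Fin 3 → ℂ} (hμ : μ 0 + μ 1 + μ 2 = 0) :
    AEStronglyMeasurable (fun y : ℝ × ℝ => whittaker (torus y) μ (1, 1)) measY := by
  refine (measurable_whittakerFormula μ).aestronglyMeasurable.congr ?_
  filter_upwards [ae_measY_pos] with y ⟨hy₁, hy₂⟩
  exact (whittaker_eq_whittakerFormula hy₁ hy₂ hμ).symm

section MeasY

variable {E : Type*} [NormedAddCommGroup E] [NormedSpace ℝ E]

lemma toReal_density_smul_eq (f : ℝ × ℝ → E) :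
    (fun y : ℝ × ℝ => (ENNReal.ofReal (1 / (y.1 * y.2) ^ 3)).toReal • ((y.1 * y.2) ^ 3 • f y))
      =ᵐ[volume.restrict (Set.Ioi 0 ×ˢ Set.Ioi 0)] f := by
  filter_upwards [ae_restrict_mem (measurableSet_Ioi.prod measurableSet_Ioi)] with y ⟨hy₁, hy₂⟩
  have hy : 0 < (y.1 * y.2) ^ 3 := pow_pos (mul_pos hy₁ hy₂) 3
  rw [ENNReal.toReal_ofReal (by positivity), one_div, inv_smul_smul₀ hy.ne']

lemma integrable_pow_smul_measY_iff {f : ℝ × ℝ → E} :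
    Integrable (fun y => (y.1 * y.2) ^ 3 • f y) measY ↔
      IntegrableOn f (Set.Ioi 0 ×ˢ Set.Ioi 0) := by
  rw [measY, integrable_withDensity_iff_integrable_smul' (by fun_prop)
    (Eventually.of_forall fun _ => ENNReal.ofReal_lt_top)]
  exact integrable_congr (toReal_density_smul_eq f)

lemma integral_pow_smul_measY (f : ℝ × ℝ → E) :
    ∫ y, (y.1 * y.2) ^ 3 • f y ∂measY = ∫ y in Set.Ioi 0 ×ˢ Set.Ioi 0, f y := by
  rw [measY, integral_withDensity_eq_integral_toReal_smul (by fun_prop)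
    (Eventually.of_forall fun _ => ENNReal.ofReal_lt_top)]
  exact integral_congr_ae (toReal_density_smul_eq f)

lemma integrable_and_integral_measY_le {F : ℝ × ℝ → ℝ} {φ : ℝ → ℝ} {C : ℝ}
    (hF : AEStronglyMeasurable F measY) (hφ : IntegrableOn φ (Set.Ioi 0))
    (hnonneg : ∀ y : ℝ × ℝ, 0 < y.1 → 0 < y.2 → 0 ≤ F y)
    (hle : ∀ y : ℝ × ℝ, 0 < y.1 → 0 < y.2 → F y ≤ C * ((y.1 * y.2) ^ 3 * (φ y.1 * φ y.2))) :
    Integrable F measY ∧ ∫ y, F y ∂measY ≤ C * (∫ t in Set.Ioi 0, φ t) ^ 2 := by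
  have hdom : Integrable (fun y => C * ((y.1 * y.2) ^ 3 * (φ y.1 * φ y.2))) measY := by
    refine (integrable_pow_smul_measY_iff.2 ?_).const_mul C
    rw [IntegrableOn, Measure.volume_eq_prod, ← Measure.prod_restrict]
    exact hφ.mul_prod hφ
  have hle_ae : F ≤ᵐ[measY] fun y => C * ((y.1 * y.2) ^ 3 * (φ y.1 * φ y.2)) :=
    ae_measY_pos.mono fun y hy => hle y hy.1 hy.2
  have hnonneg_ae : 0 ≤ᵐ[measY] F := ae_measY_pos.mono fun y hy => hnonneg y hy.1 hy.2
  refine ⟨hdom.mono' hF ?_, (integral_mono_of_nonneg hnonneg_ae hdom hle_ae).trans_eq ?_⟩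
  · filter_upwards [hle_ae, hnonneg_ae] with y hy hy₀
    rwa [Real.norm_of_nonneg hy₀]
  · have hintegral := integral_pow_smul_measY fun y : ℝ × ℝ => φ y.1 * φ y.2
    simp only [smul_eq_mul] at hintegral
    rw [integral_const_mul, hintegral, Measure.volume_eq_prod, ← Measure.prod_restrict,
      integral_prod_mul, sq]

end MeasY

end SL3

end

theorem mainTheorem8 (s₁ s₂ : ℝ) (η : Fin 3 → ℝ)
    (hs₁ : ∀ i, 0 < s₁ - η i) (hs₂ : ∀ i, 0 < s₂ + η i) (ε : ℝ) (hε : 0 < ε) :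
    ∃ C : ℝ, ∀ μ : Fin 3 → ℂ, μ 0 + μ 1 + μ 2 = 0 → (∀ i, (μ i).re = η i) →
      MeasureTheory.Integrable (fun t : ℝ × ℝ =>
        ‖SL3.whittaker (SL3.torus t) μ (1, 1)‖ * t.1 ^ (s₁ + 1) * t.2 ^ (s₂ + 1)) SL3.measY ∧
      ∫ t : ℝ × ℝ, ‖SL3.whittaker (SL3.torus t) μ (1, 1)‖ * t.1 ^ (s₁ + 1) * t.2 ^ (s₂ + 1)
          ∂SL3.measY
        ≤ C * (SL3.Msym ε (s₁ + s₂ - 1 / 2) (SL3.deltaExp s₁ s₂ μ) μ / SL3.LambdaPoly μ) := by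
  by_cases hη : η 0 + η 1 + η 2 = 0
  swap
  · refine ⟨0, fun μ hμ hre => absurd ?_ hη⟩
    rw [← hre, ← hre, ← hre, ← Complex.add_re, ← Complex.add_re, hμ, Complex.zero_re]
  have hsmall {r : ℝ} (hr : 0 < r) : ∀ᶠ e in 𝓝[>] 0, e < r :=
    (eventually_lt_nhds hr).filter_mono nhdsWithin_le_nhds
  obtain ⟨e, ⟨⟨he₁, he₂⟩, heε⟩, he : 0 < e⟩ := ((((eventually_all.2 fun i => hsmall (hs₁ i)).and
    (eventually_all.2 fun i => hsmall (hs₂ i))).and (hsmall (div_pos hε four_pos))).and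
    self_mem_nhdsWithin).exists
  obtain ⟨C, hC⟩ := SL3.exists_norm_whittaker_mul_le_splitPower (ε := ε) he (by linarith) hη he₁ he₂
  refine ⟨C * (∫ t in Set.Ioi 0, SL3.splitPower e t) ^ 2, fun μ hμ hre => ?_⟩
  rw [mul_right_comm]
  have hmeas := ((SL3.aestronglyMeasurable_whittaker hμ).norm.mul
    (measurable_fst.pow_const (s₁ + 1)).aestronglyMeasurable).mul
    (measurable_snd.pow_const (s₂ + 1)).aestronglyMeasurable
  exact SL3.integrable_and_integral_measY_le hmeas (SL3.integrableOn_splitPower he)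
    (fun y hy₁ hy₂ => by positivity) (hC μ hμ hre)
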